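/- Let $r,a>0$ and let $s(x)$ be one of the functions $x$ (rational case I), $\frac1r\sin(rx)$ (trigonometric case II), $\frac a\pi\sinh(\pi x/a)$ (hyperbolic case III), $\frac1r e^{ra/4}\vartheta_1(rx\,|\,ira/\pi)$ (elliptic case IV), where $\vartheta_1(z|\tau)=2e^{i\pi\tau/4}\sin z\prod_{n\ge1}(1-q^{2n})(1-2q^{2n}\cos 2z+q^{4n})$, $q=e^{i\pi\tau}$. Put $\rho=0,1,1,3$ in the four cases, $\omega_0=0$, $\omega_1=\pi/r$ (II, IV) or $ia$ (III), $\omega_2=ia$, $\omega_3=-\omega_1-\omega_2$, $\Omega=\sum_{\nu=0}^{\rho}\mathbb Z\omega_\nu$, and $(\xi_0,\xi_1,\xi_2,\xi_3)=(0,0,-1,1)$. Let $G(x;\alpha)$ ($\operatorname{Re}\alpha\ne0$) be any solution of $G(x+\tfrac{i\alpha}2;\alpha)=k_\alpha\,s(x)\,G(x-\tfrac{i\alpha}2;\alpha)$ with constants $k_\alpha\in\mathbb C^*$ (the value $0$ being assigned at poles, and the equation required where $s(x)\neq0$). Let $N,\tilde N\ge0$, $g_0,\dots,g_{2\rho+1}\in\mathbb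 R$, $\lambda\in\mathbb R\setminus\{0\}$, $\beta>0$, and assume that $n\,i\beta/m\notin\Omega$ for all $m\in\{\pm1,\pm1/\lambda\}$ and all nonzero integers $n$, and that $i(\lambda-1)\beta\notin\Omega$. Write $|g|=\sum_{\nu}g_\nu$, $|\omega|=\sum_{\nu=0}^{\rho}\omega_\nu$, $P=\frac14\prod_{\nu=1}^{\rho}s(\frac{\omega_\nu}2)^2$, $\kappa=2\lambda N-2\tilde N+|g|-\frac12(\rho+1)(\lambda+1)$, and for $x\in\mathbb C^N$, $\tilde x\in\mathbb C^{\tilde N}$ put $$V_j^{\pm}=\frac{\prod_{\nu=0}^{2\rho+1}s(\pm x_j-ig_\nu\beta)}{s(\pm2x_j)s(\pm2x_j-i\beta)}\prod_{\delta=\pm}\Bigl(\prod_{j'\ne j}\frac{s(x_j+\delta x_{j'}\mp i\lambda\beta)}{s(x_j+\delta x_{j'})}\prod_{k=1}^{\tilde N}\frac{s(x_j+\delta\tilde x_k\mp i(\lambda-1)\beta/2)}{s(x_j+\delta\tilde x_k\mp i(\lambda+1)\beta/2)}\Bigr),$$ $$\tilde V_k^{\pm}=\frac{\prod_{\nu=0}^{2\rho+1}s(\pm\tilde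 x_k+i(\frac{\lambda+1}2-g_\nu)\beta)}{s(\pm2\tilde x_k)s(\pm2\tilde x_k+i\lambda\beta)}\prod_{\delta=\pm}\Bigl(\prod_{k'\ne k}\frac{s(\tilde x_k+\delta\tilde x_{k'}\pm i\beta)}{s(\tilde x_k+\delta\tilde x_{k'})}\prod_{j=1}^{N}\frac{s(\tilde x_k+\delta x_j\mp i(\lambda-1)\beta/2)}{s(\tilde x_k+\delta x_j\pm i(\lambda+1)\beta/2)}\Bigr),$$ $$V^0=-P\sum_{\nu=0}^{\rho}\frac{e^{-r\xi_\nu\kappa\beta}}{\prod_{\mu\neq\nu}s(\frac{\omega_\nu-\omega_\mu}2)}\,\frac{\prod_{\mu=0}^{2\rho+1}s(\frac{\omega_\nu}2+\frac{i\beta}2-ig_\mu\beta)}{\prod_{\mu=0}^{\rho}s(\frac{\omega_\nu-\omega_\mu+i(1-\lambda)\beta}2)}\prod_{\delta=\pm}\Bigl(\prod_{j=1}^N\frac{s(\delta x_j+\frac{\omega_\nu}2+\frac{i\beta}2-i\lambda\beta)}{s(\delta x_j+\frac{\omega_\nu}2+\frac{i\beta}2)}\prod_{k=1}^{\tilde N}\frac{s(\delta\tilde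 x_k+\frac{\omega_\nu}2-\frac{i\lambda\beta}2+i\beta)}{s(\delta\tilde x_k+\frac{\omega_\nu}2-\frac{i\lambda\beta}2)}\Bigr),$$ $$c^0=P\sum_{\nu=0}^{\rho}\frac{e^{-r\xi_\nu(|g|-\frac12(\rho+1)(\lambda+1))\beta}}{\prod_{\mu\neq\nu}s(\frac{\omega_\nu-\omega_\mu}2)}\,\frac{\prod_{\mu=0}^{2\rho+1}s(\frac{\omega_\nu}2+\frac{i\lambda\beta}2-ig_\mu\beta)}{\prod_{\mu=0}^{\rho}s(\frac{\omega_\nu-\omega_\mu+i(\lambda-1)\beta}2)},\qquad \mathcal E_{N,\tilde N}=c^0+P\,s(i\beta\kappa-|\omega|).$$ The deformed van Diejen operator is $$H_{N,\tilde N}=\sum_{\varepsilon=\pm}\Bigl(s(i\lambda\beta)\sum_{j=1}^{N}(V_j^{\varepsilon})^{1/2}e^{-\varepsilon i\beta\partial_{x_j}}(V_j^{-\varepsilon})^{1/2}-s(i\beta)\sum_{k=1}^{\tilde N}(\tilde V_k^{\varepsilon})^{1/2}e^{\varepsilon i\lambda\beta\partial_{\tilde x_k}}(\tilde V_k^{-\varepsilon})^{1/2}\Bigr)+V^0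 .$$ Let $$\Psi_N(x;g,\lambda,\beta)=\prod_{j=1}^N\Bigl(\frac{G(2x_j+\frac{i\beta}2;\beta)G(-2x_j+\frac{i\beta}2;\beta)}{\prod_{\nu=0}^{2\rho+1}G(x_j+\frac{i\beta}2-ig_\nu\beta;\beta)G(-x_j+\frac{i\beta}2-ig_\nu\beta;\beta)}\Bigr)^{1/2}\prod_{j<k}\prod_{\varepsilon,\varepsilon'=\pm}\Bigl(\frac{G(\varepsilon x_j+\varepsilon'x_k+\frac{i\beta}2;\beta)}{G(\varepsilon x_j+\varepsilon'x_k-i\lambda\beta+\frac{i\beta}2;\beta)}\Bigr)^{1/2}$$ and, with $g'_\nu=(\lambda+1-2g_\nu)/(2\lambda)$, $$\Psi_{N,\tilde N}(x,\tilde x)=\frac{\Psi_N(x;g,\lambda,\beta)\,\Psi_{\tilde N}(\tilde x;g',1/\lambda,\lambda\beta)}{\prod_{j=1}^{N}\prod_{\delta=\pm}\prod_{k=1}^{\tilde N}\bigl(s(x_j+\delta\tilde x_k+i(\lambda-1)\beta/2)\,s(x_j+\delta\tilde x_k-i(\lambda-1)\beta/2)\bigr)^{1/2}} .$$ Then, in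 cases I, II, III for all such parameters, and in case IV if $2\lambda(N-1)-2(\tilde N+1)+\sum_{\nu=0}^{7}g_\nu=0$, $$H_{N,\tilde N}\Psi_{N,\tilde N}=\mathcal E_{N,\tilde N}\Psi_{N,\tilde N}.$$ The square roots are understood as follows. For every choice of branches (functions with the prescribed square, possibly with cuts) of $\Psi_{N,\tilde N}$, of all $(V_j^-)^{1/2}$ and of all $(\tilde V_k^-)^{1/2}$, there are branches of all $(V_j^+)^{1/2}$ and $(\tilde V_k^+)^{1/2}$ such that the equation holds at every point $(x,\tilde x)$ at which all factors $s(\cdot)$, $G(\cdot)$ of $\Psi_{N,\tilde N}^2$ at $(x,\tilde x)$, and all factors $s(\cdot)$ of the $V_j^\pm$, $\tilde V_k^\pm$ at $(x,\tilde x)$ and at the shifted points at which they are evaluated in the operator, are nonzero. Moreover no new cuts arise: $(V_j^+)^{1/2}$ is continuous at a point $q$ if $\Psi_{N,\tilde N}$ is continuous at $q$ and at $q'=q-i\beta e_{x_j}$, $(V_j^-)^{1/2}$ is continuous at $q'$, and the factors of $\Psi_{N,\tilde N}^2$ and $V_j^+$ at $q$ and of $V_j^-$ at $q'$ are nonzero;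 and the same holds for $(\tilde V_k^+)^{1/2}$ with $q'=q+i\lambda\beta e_{\tilde x_k}$. -/

import Mathlib

open Complex

noncomputable section

namespace VanDiejen

/-- The four cases: rational (I), trigonometric (II), hyperbolic (III), elliptic (IV). -/
inductive VDCase
  | rational
  | trigonometric
  | hyperbolic
  | elliptic

/-- The odd Jacobi theta function `ϑ₁(z | τ)` (`Im τ > 0`), by its product formula. -/
def theta1 (z τ : ℂ) : ℂ :=
  2 * exp (Real.pi * I * τ / 4) * sin z *
    ∏' n : ℕ, ((1 - exp (2 * Real.pi * I * (n + 1) * τ)) *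
      (1 - 2 * exp (2 * Real.pi * I * (n + 1) * τ) * cos (2 * z)
        + exp (4 * Real.pi * I * (n + 1) * τ)))

/-- The function `s(x)`. -/
def sFun (c : VDCase) (r a : ℝ) (x : ℂ) : ℂ :=
  match c with
  | .rational => x
  | .trigonometric => (1 / r) * sin (r * x)
  | .hyperbolic => (a / Real.pi) * sinh (Real.pi * x / a)
  | .elliptic => (1 / r) * exp (r * a / 4) * theta1 (r * x) (I * r * a / Real.pi)

/-- The integer `ρ`. -/
def rho : VDCase → ℕ
  | .rational => 0
  | .trigonometric => 1
  | .hyperbolic => 1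
  | .elliptic => 3

/-- `ω₁`; it is used in cases II, III, IV only. -/
def omegaOne (c : VDCase) (r a : ℝ) : ℂ :=
  match c with
  | .hyperbolic => I * a
  | _ => Real.pi / r

/-- The periods `ω₀, …, ω₃`; only those with index `≤ ρ` are used. -/
def omega (c : VDCase) (r a : ℝ) : ℕ → ℂ
  | 0 => 0
  | 1 => omegaOne c r a
  | 2 => I * a
  | _ => -omegaOne c r a - I * a

/-- The numbers `ξ₀, …, ξ₃ = 0, 0, -1, 1`. -/
def xi : ℕ → ℝ
  | 0 => 0
  | 1 => 0
  | 2 => -1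
  | _ => 1

/-- The period group `Ω`, generated by `ω₀, …, ω_ρ`. -/
def Omega (c : VDCase) (r a : ℝ) : AddSubgroup ℂ :=
  AddSubgroup.closure (omega c r a '' Set.Iic (rho c))

/-- The set `Λ = {1, -1, -1/λ, 1/λ}` of mass parameters. -/
def massSet (lam : ℝ) : Set ℝ := {1, -1, -(1 / lam), 1 / lam}

/-- `G` is a Gamma function for `s`: for each `α` with `Re α ≠ 0` there is a constant `k ≠ 0` with
`G(x + iα/2; α) / G(x - iα/2; α) = k s(x)`.  The equation is written without the quotient and away
from the zeros of `s`, so that a meromorphic solution may be given the value `0` at its poles. -/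
def IsGammaFunction (c : VDCase) (r a : ℝ) (G : ℂ → ℂ → ℂ) : Prop :=
  ∀ α : ℂ, α.re ≠ 0 → ∃ k : ℂ, k ≠ 0 ∧ ∀ x : ℂ, sFun c r a x ≠ 0 →
    G (x + I * α / 2) α = k * sFun c r a x * G (x - I * α / 2) α

section ExplicitGamma

/-- The hyperbolic Gamma function on the strip `|Im x - a/2| < Re(a + α)/2`. -/
def hypGammaStrip (a : ℝ) (x α : ℂ) : ℂ :=
  exp (I * ∫ y in Set.Ioi (0 : ℝ), (1 / (y : ℂ)) *
    (sin (2 * (x - I * a / 2) * y) / (2 * sinh (a * y) * sinh (α * y))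
      - (x - I * a / 2) / (a * α * y)))

/-- The number of steps `iα` from `x` to the strip `-Re(α)/2 ≤ Im x - a/2 < Re(α)/2`. -/
def hypSteps (a : ℝ) (x α : ℂ) : ℤ := ⌊(x.im - a / 2) / α.re + 1 / 2⌋

/-- The product `∏ u(k)` over `0 ≤ k < n`, or `∏ u(k)⁻¹` over `n ≤ k < 0` if `n` is negative. -/
def stepProd (u : ℤ → ℂ) (n : ℤ) : ℂ :=
  (∏ k ∈ Finset.Ico 0 n, u k) * (∏ k ∈ Finset.Ico n 0, u k)⁻¹

/-- The hyperbolic Gamma function: the integral in a period strip, continued to the plane by means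
of the functional equation with constant `-2πi/a`. -/
def hypGamma (a : ℝ) (x α : ℂ) : ℂ :=
  hypGammaStrip a (x - hypSteps a x α * (I * α)) α *
    stepProd (fun k => (-2 * Real.pi * I / a) *
      sFun .hyperbolic 1 a (x - hypSteps a x α * (I * α) + (k + 1 / 2) * (I * α)))
      (hypSteps a x α)

/-- The explicit Gamma functions for `Re α > 0`. -/
def gammaPos (c : VDCase) (r a : ℝ) (x α : ℂ) : ℂ :=
  match c with
  | .rational => Gamma (1 / 2 + x / (I * α))
  | .trigonometric => exp (-r * x ^ 2 / (2 * α)) *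
      (∏' n : ℕ, (1 - exp (-r * α * (2 * n + 1)) * exp (2 * I * r * x)))⁻¹
  | .hyperbolic => hypGamma a x α
  | .elliptic => exp (-r * x ^ 2 / (2 * α)) *
      ((∏' n : ℕ × ℕ, (1 - exp (-r * a * (2 * n.1 + 1)) * exp (-r * α * (2 * n.2 + 1))
          * exp (-2 * I * r * (x - I * a / 2)))) /
       (∏' n : ℕ × ℕ, (1 - exp (-r * a * (2 * n.1 + 1)) * exp (-r * α * (2 * n.2 + 1))
          * exp (2 * I * r * (x - I * a / 2)))))

/-- The explicit Gamma functions for `Re α ≠ 0`, with `G(x; -α) = G(-x; α)`. -/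
def explicitGamma (c : VDCase) (r a : ℝ) (x α : ℂ) : ℂ :=
  if 0 < α.re then gammaPos c r a x α else gammaPos c r a (-x) (-α)

/-- It suffices to treat `Re α > 0`. -/
theorem isGammaFunction_of_pos (c : VDCase) (r a : ℝ)
    (hodd : ∀ x, sFun c r a (-x) = -sFun c r a x)
    (h : ∀ α : ℂ, 0 < α.re → ∃ k : ℂ, k ≠ 0 ∧ ∀ x : ℂ, sFun c r a x ≠ 0 →
      gammaPos c r a (x + I * α / 2) α = k * sFun c r a x * gammaPos c r a (x - I * α / 2) α) :
    IsGammaFunction c r a (explicitGamma c r a) := by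
  intro α hα
  rcases lt_or_gt_of_ne hα with hneg | hpos
  · obtain ⟨k, hk, hG⟩ := h (-α) (by simpa using hneg)
    refine ⟨-k, neg_ne_zero.2 hk, fun x hx => ?_⟩
    have hnot : ¬ 0 < α.re := not_lt.2 hneg.le
    have h1 := hG (-x) (by rw [hodd]; exact neg_ne_zero.2 hx)
    rw [hodd] at h1
    simp only [explicitGamma, hnot, if_false]
    rw [show -(x + I * α / 2) = -x + I * -α / 2 by ring, h1,
      show -(x - I * α / 2) = -x - I * -α / 2 by ring]
    ring
  · obtain ⟨k, hk, hG⟩ := h α hpos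
    exact ⟨k, hk, fun x hx => by simpa [explicitGamma, hpos] using hG x hx⟩

theorem sFun_neg (c : VDCase) (r a : ℝ) (x : ℂ) : sFun c r a (-x) = -sFun c r a x := by
  cases c <;> simp [sFun, theta1, mul_neg, neg_div]

theorem gammaPos_rational (r a : ℝ) (α : ℂ) (hα : 0 < α.re) :
    ∃ k : ℂ, k ≠ 0 ∧ ∀ x : ℂ, sFun .rational r a x ≠ 0 →
      gammaPos .rational r a (x + I * α / 2) α
        = k * sFun .rational r a x * gammaPos .rational r a (x - I * α / 2) α := by
  have hα0 : α ≠ 0 := by rintro rfl; simp at hα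
  have hI : I * α ≠ 0 := mul_ne_zero I_ne_zero hα0
  refine ⟨1 / (I * α), one_div_ne_zero hI, fun x hx => ?_⟩
  simp only [sFun, gammaPos] at hx ⊢
  have e1 : (1 : ℂ) / 2 + (x + I * α / 2) / (I * α) = x / (I * α) + 1 := by
    field_simp; ring
  have e2 : (1 : ℂ) / 2 + (x - I * α / 2) / (I * α) = x / (I * α) := by
    field_simp; ring
  rw [e1, e2, Gamma_add_one _ (div_ne_zero hx hI)]
  ring

theorem gammaPos_hyperbolic (r a : ℝ) (ha : 0 < a) (α : ℂ) (hα : 0 < α.re) :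
    ∃ k : ℂ, k ≠ 0 ∧ ∀ x : ℂ, sFun .hyperbolic r a x ≠ 0 →
      gammaPos .hyperbolic r a (x + I * α / 2) α
        = k * sFun .hyperbolic r a x * gammaPos .hyperbolic r a (x - I * α / 2) α := by
  have ha' : (a : ℂ) ≠ 0 := by exact_mod_cast ha.ne'
  have hk : (-2 * Real.pi * I / a : ℂ) ≠ 0 := by
    refine div_ne_zero (mul_ne_zero (mul_ne_zero (by norm_num) ?_) I_ne_zero) ha'
    exact_mod_cast Real.pi_ne_zero
  refine ⟨_, hk, fun x hx => ?_⟩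
  have hstep : hypSteps a (x + I * α / 2) α = hypSteps a (x - I * α / 2) α + 1 := by
    unfold hypSteps
    rw [← Int.floor_add_one]
    congr 1
    have : (I * α / 2).im = α.re / 2 := by simp
    rw [add_im, sub_im, this]
    field_simp
    ring
  have hstepProd : ∀ (u : ℤ → ℂ) (n : ℤ), u n ≠ 0 →
      stepProd u (n + 1) = u n * stepProd u n := by
    intro u n hu
    unfold stepProd
    rcases le_or_gt 0 n with hn | hn
    · rw [← Finset.insert_Ico_right_eq_Ico_add_one hn, Finset.prod_insert (by simp),
        Finset.Ico_eq_empty_of_le hn, Finset.Ico_eq_empty_of_le (by omega : (0:ℤ) ≤ n + 1)]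
      ring
    · rw [← Finset.insert_Ico_add_one_left_eq_Ico hn, Finset.prod_insert (by simp),
        Finset.Ico_eq_empty_of_le hn.le, Finset.Ico_eq_empty_of_le (by omega : n + 1 ≤ (0:ℤ))]
      field_simp
  simp only [gammaPos, hypGamma, hstep]
  set n := hypSteps a (x - I * α / 2) α
  have e : x + I * α / 2 - ((n + 1 : ℤ) : ℂ) * (I * α) = x - I * α / 2 - n * (I * α) := by
    push_cast; ring
  rw [e, hstepProd]
  · rw [show x - I * α / 2 - n * (I * α) + ((n : ℂ) + 1 / 2) * (I * α) = x by ring]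
    simp only [sFun]
    ring
  · rw [show x - I * α / 2 - n * (I * α) + ((n : ℂ) + 1 / 2) * (I * α) = x by ring]
    exact mul_ne_zero hk hx

theorem norm_cexp_lt_one {z : ℂ} (hz : z.re < 0) : ‖exp z‖ < 1 := by
  rw [norm_exp]; simpa using hz

theorem multipliable_qProd {q : ℂ} (hq : ‖q‖ < 1) (z : ℂ) :
    Multipliable fun n : ℕ => 1 - q ^ n * z := by
  have : Summable fun n : ℕ => ‖-(q ^ n * z)‖ := by
    simp only [norm_neg, norm_mul, norm_pow]
    exact (summable_geometric_of_lt_one (norm_nonneg _) hq).mul_right _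
  simpa [sub_eq_add_neg] using multipliable_one_add_of_summable this

theorem multipliable_pqProd {p q : ℂ} (hp : ‖p‖ < 1) (hq : ‖q‖ < 1) (z : ℂ) :
    Multipliable fun n : ℕ × ℕ => 1 - p ^ n.1 * q ^ n.2 * z := by
  have : Summable fun n : ℕ × ℕ => ‖-(p ^ n.1 * q ^ n.2 * z)‖ := by
    simp only [norm_neg, norm_mul, norm_pow]
    exact ((summable_geometric_of_lt_one (norm_nonneg _) hp).mul_of_nonneg
      (summable_geometric_of_lt_one (norm_nonneg _) hq)
      (fun _ => pow_nonneg (norm_nonneg _) _) (fun _ => pow_nonneg (norm_nonneg _) _)).mul_right _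
  simpa [sub_eq_add_neg] using multipliable_one_add_of_summable this

theorem tprod_qProd {q : ℂ} (hq : ‖q‖ < 1) (z : ℂ) :
    ∏' n : ℕ, (1 - q ^ n * z) = (1 - z) * ∏' n : ℕ, (1 - q ^ n * (q * z)) := by
  have h := multipliable_qProd hq (q * z)
  rw [tprod_eq_zero_mul' (by simpa [pow_succ, mul_assoc] using h)]
  simp [pow_succ, mul_assoc]

theorem tprod_pqProd {p q : ℂ} (hp : ‖p‖ < 1) (hq : ‖q‖ < 1) (z : ℂ) :
    ∏' n : ℕ × ℕ, (1 - p ^ n.1 * q ^ n.2 * z)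
      = (∏' n : ℕ, (1 - p ^ n * z)) * ∏' n : ℕ × ℕ, (1 - p ^ n.1 * q ^ n.2 * (q * z)) := by
  let e : ℕ ⊕ (ℕ × ℕ) ≃ ℕ × ℕ :=
    { toFun := Sum.elim (fun n => (n, 0)) (fun n => (n.1, n.2 + 1))
      invFun := fun n => match n with
        | (n, 0) => Sum.inl n
        | (n, m + 1) => Sum.inr (n, m)
      left_inv := by rintro (n | ⟨n, m⟩) <;> rfl
      right_inv := by rintro ⟨n, m | m⟩ <;> rfl }
  rw [← e.tprod_eq]
  have h1 := multipliable_qProd hp z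
  have h2 := multipliable_pqProd hp hq (q * z)
  have h := (HasProd.sum (f := fun b => 1 - p ^ (e b).1 * q ^ (e b).2 * z)
    (by simpa [e, Function.comp_def] using h1.hasProd)
    (by simpa [e, Function.comp_def, pow_succ, mul_assoc] using h2.hasProd))
  rw [h.tprod_eq]
  simp only [mul_assoc]

theorem gammaPos_trigonometric (r a : ℝ) (hr : 0 < r) (α : ℂ) (hα : 0 < α.re) :
    ∃ k : ℂ, k ≠ 0 ∧ ∀ x : ℂ, sFun .trigonometric r a x ≠ 0 →
      gammaPos .trigonometric r a (x + I * α / 2) α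
        = k * sFun .trigonometric r a x * gammaPos .trigonometric r a (x - I * α / 2) α := by
  have hα0 : α ≠ 0 := by rintro rfl; simp at hα
  have hr0 : (r : ℂ) ≠ 0 := by exact_mod_cast hr.ne'
  refine ⟨-2 * I * r, by simp [hr0], fun x hx => ?_⟩
  have hq : ‖exp (-2 * r * α)‖ < 1 := norm_cexp_lt_one (by simp; positivity)
  have key := tprod_qProd hq (exp (2 * I * r * x))
  have hI2 : I * I = -1 := I_mul_I
  have e1 : ∀ n : ℕ, exp (-r * α * (2 * n + 1)) * exp (2 * I * r * (x + I * α / 2))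
      = exp (-2 * r * α) ^ n * (exp (-2 * r * α) * exp (2 * I * r * x)) := by
    intro n
    rw [← exp_nat_mul, ← exp_add, ← exp_add, ← exp_add]
    congr 1
    linear_combination r * α * hI2
  have e2 : ∀ n : ℕ, exp (-r * α * (2 * n + 1)) * exp (2 * I * r * (x - I * α / 2))
      = exp (-2 * r * α) ^ n * exp (2 * I * r * x) := by
    intro n
    rw [← exp_nat_mul, ← exp_add, ← exp_add]
    congr 1
    linear_combination -r * α * hI2
  have e3 : exp (-r * (x + I * α / 2) ^ 2 / (2 * α))
      = exp (-(I * r * x)) * exp (-r * (x - I * α / 2) ^ 2 / (2 * α)) := by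
    rw [← exp_add]
    congr 1
    field_simp
    ring
  have e4 : sFun .trigonometric r a x
      = (1 / r) * ((exp (-(I * r * x)) - exp (I * r * x)) * I / 2) := by
    simp only [sFun, Complex.sin]
    rw [show -(r * x) * I = -(I * r * x) by ring, show r * x * I = I * r * x by ring]
  have e5 : exp (2 * I * r * x) = exp (I * r * x) * exp (I * r * x) := by
    rw [← exp_add]; ring_nf
  have e6 : exp (-(I * r * x)) * exp (I * r * x) = 1 := by rw [← exp_add]; simp
  have e7 : -2 * I * r * sFun .trigonometric r a x
      = exp (-(I * r * x)) * (1 - exp (2 * I * r * x)) := by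
    rw [e4, e5]
    field_simp
    linear_combination (-exp (-(I * r * x)) + exp (I * r * x)) * hI2 + exp (I * r * x) * e6
  have h0 : 1 - exp (2 * I * r * x) ≠ 0 := by
    intro h
    rw [h, mul_zero] at e7
    exact (mul_ne_zero (by simp [hr0]) hx) e7
  rw [e7]
  simp only [gammaPos, e1, e2, key, e3]
  generalize (∏' n : ℕ, (1 - exp (-2 * r * α) ^ n * (exp (-2 * r * α) * exp (2 * I * r * x)))) = T
  generalize 1 - exp (2 * I * r * x) = u at h0 ⊢
  rw [mul_inv]
  field_simp

theorem gammaPos_elliptic (r a : ℝ) (hr : 0 < r) (ha : 0 < a) (α : ℂ) (hα : 0 < α.re) :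
    ∃ k : ℂ, k ≠ 0 ∧ ∀ x : ℂ, sFun .elliptic r a x ≠ 0 →
      gammaPos .elliptic r a (x + I * α / 2) α
        = k * sFun .elliptic r a x * gammaPos .elliptic r a (x - I * α / 2) α := by
  have hα0 : α ≠ 0 := by rintro rfl; simp at hα
  have hr0 : (r : ℂ) ≠ 0 := by exact_mod_cast hr.ne'
  have hI2 : I * I = -1 := I_mul_I
  have hq : ‖exp (-2 * r * α)‖ < 1 := norm_cexp_lt_one (by simp; positivity)
  have hp : ‖exp (-2 * r * a)‖ < 1 := norm_cexp_lt_one (by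
    have : (-2 * r * a : ℂ) = ((-2 * r * a : ℝ) : ℂ) := by push_cast; ring
    rw [this, ofReal_re]
    have := mul_pos hr ha
    linarith)
  set p := exp (-2 * r * a) with hpdef
  set q := exp (-2 * r * α) with hqdef
  set D : ℂ := ∏' n : ℕ, (1 - p ^ n * p) with hD
  have hD0 : D ≠ 0 := by
    have : Summable fun n : ℕ => ‖-(p ^ n * p)‖ := by
      simp only [norm_neg, norm_mul, norm_pow]
      exact (summable_geometric_of_lt_one (norm_nonneg _) hp).mul_right _
    have h := tprod_one_add_ne_zero_of_summable (f := fun n : ℕ => -(p ^ n * p)) ?_ this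
    · simpa [hD, sub_eq_add_neg] using h
    · intro n h
      have h1 : p ^ (n + 1) = 1 := by rw [pow_succ]; linear_combination -h
      have h2 : ‖p‖ ^ (n + 1) = 1 := by rw [← norm_pow, h1, norm_one]
      have h3 := pow_lt_one₀ (norm_nonneg p) hp (Nat.succ_ne_zero n)
      exact absurd h2 h3.ne
  refine ⟨-I * r / D, by simp [hr0, hD0], fun x hx => ?_⟩
  set z := exp (2 * I * r * x) with hz
  set z' := exp (-(2 * I * r * x)) with hz'
  have hzz : z * z' = 1 := by rw [hz, hz', ← exp_add]; simp
  -- the theta function as a product of three factors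
  have es : -I * r / D * sFun .elliptic r a x
      = exp (-(I * r * x)) * (∏' n : ℕ, (1 - p ^ n * z)) * ∏' n : ℕ, (1 - p ^ n * (p * z')) := by
    have hpi : (Real.pi : ℂ) ≠ 0 := by exact_mod_cast Real.pi_ne_zero
    have hpi' : (Real.pi : ℂ) * (I * r * a / Real.pi) = I * r * a := by field_simp
    have t1 : ∀ n : ℕ, exp (2 * Real.pi * I * (n + 1) * (I * r * a / Real.pi)) = p ^ n * p := by
      intro n
      rw [← pow_succ, hpdef, ← exp_nat_mul]
      congr 1
      push_cast
      linear_combination 2 * I * (n + 1 : ℂ) * hpi' + 2 * (n + 1 : ℂ) * r * a * hI2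
    have t2 : ∀ n : ℕ, exp (4 * Real.pi * I * (n + 1) * (I * r * a / Real.pi))
        = (p ^ n * p) * (p ^ n * p) := by
      intro n
      rw [← t1 n, ← exp_add]
      congr 1
      ring
    have t3 : 2 * cos (2 * (r * x)) = z + z' := by
      rw [Complex.cos, hz, hz', show 2 * (r * x) * I = 2 * I * r * x by ring,
        show -(2 * (r * x)) * I = -(2 * I * r * x) by ring]
      ring
    have t4 : exp (Real.pi * I * (I * r * a / Real.pi) / 4) * exp (r * a / 4) = 1 := by
      rw [← exp_add, ← exp_zero]
      congr 1
      linear_combination I / 4 * hpi' + r * a / 4 * hI2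
    have t5 : -I * (2 * sin (r * x)) = exp (-(I * r * x)) * (1 - z) := by
      have e5 : z = exp (I * r * x) * exp (I * r * x) := by
        rw [hz, ← exp_add]; ring_nf
      have e6 : exp (-(I * r * x)) * exp (I * r * x) = 1 := by rw [← exp_add]; simp
      rw [e5, Complex.sin, show -(r * x) * I = -(I * r * x) by ring,
        show r * x * I = I * r * x by ring]
      linear_combination (-exp (-(I * r * x)) + exp (I * r * x)) * hI2 + exp (I * r * x) * e6
    have t6 : ∏' n : ℕ, ((1 - exp (2 * Real.pi * I * (n + 1) * (I * r * a / Real.pi))) *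
        (1 - 2 * exp (2 * Real.pi * I * (n + 1) * (I * r * a / Real.pi)) * cos (2 * (r * x))
        + exp (4 * Real.pi * I * (n + 1) * (I * r * a / Real.pi))))
        = D * ((∏' n : ℕ, (1 - p ^ n * (p * z))) * ∏' n : ℕ, (1 - p ^ n * (p * z'))) := by
      rw [hD, ← (multipliable_qProd hp (p * z)).tprod_mul (multipliable_qProd hp (p * z')),
        ← (multipliable_qProd hp p).tprod_mul
          ((multipliable_qProd hp (p * z)).mul (multipliable_qProd hp (p * z')))]
      congr 1
      funext n
      rw [t1, t2]
      linear_combination (1 - p ^ n * p) * (-(p ^ n * p) * t3 - (p ^ n * p) ^ 2 * hzz)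
    rw [tprod_qProd hp z]
    simp only [sFun, theta1]
    rw [t6]
    set A := ∏' n : ℕ, (1 - p ^ n * (p * z))
    set B := ∏' n : ℕ, (1 - p ^ n * (p * z'))
    generalize exp (Real.pi * I * (I * r * a / Real.pi) / 4) = E₁ at t4 ⊢
    generalize exp ((r : ℂ) * a / 4) = E₂ at t4 ⊢
    field_simp
    linear_combination (-2 * I * sin (r * x) * A * B) * t4 + A * B * t5
  have hBne : (∏' n : ℕ, (1 - p ^ n * z)) ≠ 0 := by
    intro h
    rw [h, mul_zero, zero_mul] at es
    exact mul_ne_zero (by simp [hr0, hD0]) hx es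
  have e3 : exp (-r * (x + I * α / 2) ^ 2 / (2 * α))
      = exp (-(I * r * x)) * exp (-r * (x - I * α / 2) ^ 2 / (2 * α)) := by
    rw [← exp_add]
    congr 1
    field_simp
    ring
  have f1 : ∀ n : ℕ × ℕ, exp (-r * a * (2 * n.1 + 1)) * exp (-r * α * (2 * n.2 + 1))
      * exp (-2 * I * r * (x + I * α / 2 - I * a / 2)) = p ^ n.1 * q ^ n.2 * (p * z') := by
    intro n
    rw [hpdef, hqdef, hz', ← exp_nat_mul, ← exp_nat_mul]
    simp only [← exp_add]
    congr 1
    linear_combination (-r * α + r * a) * hI2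
  have f2 : ∀ n : ℕ × ℕ, exp (-r * a * (2 * n.1 + 1)) * exp (-r * α * (2 * n.2 + 1))
      * exp (-2 * I * r * (x - I * α / 2 - I * a / 2)) = p ^ n.1 * q ^ n.2 * (q * (p * z')) := by
    intro n
    rw [hpdef, hqdef, hz', ← exp_nat_mul, ← exp_nat_mul]
    simp only [← exp_add]
    congr 1
    linear_combination (r * α + r * a) * hI2
  have f3 : ∀ n : ℕ × ℕ, exp (-r * a * (2 * n.1 + 1)) * exp (-r * α * (2 * n.2 + 1))
      * exp (2 * I * r * (x + I * α / 2 - I * a / 2)) = p ^ n.1 * q ^ n.2 * (q * z) := by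
    intro n
    rw [hpdef, hqdef, hz, ← exp_nat_mul, ← exp_nat_mul]
    simp only [← exp_add]
    congr 1
    linear_combination (r * α - r * a) * hI2
  have f4 : ∀ n : ℕ × ℕ, exp (-r * a * (2 * n.1 + 1)) * exp (-r * α * (2 * n.2 + 1))
      * exp (2 * I * r * (x - I * α / 2 - I * a / 2)) = p ^ n.1 * q ^ n.2 * z := by
    intro n
    rw [hpdef, hqdef, hz, ← exp_nat_mul, ← exp_nat_mul]
    simp only [← exp_add]
    congr 1
    linear_combination (-r * α - r * a) * hI2
  rw [es]
  simp only [gammaPos, f1, f2, f3, f4, e3]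
  rw [tprod_pqProd hp hq (p * z'), tprod_pqProd hp hq z]
  set A := ∏' n : ℕ × ℕ, (1 - p ^ n.1 * q ^ n.2 * (q * (p * z')))
  set C := ∏' n : ℕ × ℕ, (1 - p ^ n.1 * q ^ n.2 * (q * z))
  set B := ∏' n : ℕ, (1 - p ^ n * z)
  generalize (∏' n : ℕ, (1 - p ^ n * (p * z'))) = B'
  rw [div_eq_mul_inv, div_eq_mul_inv, mul_inv]
  field_simp

/-- The explicit Gamma functions are Gamma functions in all four cases. -/
theorem isGammaFunction_explicitGamma (c : VDCase) (r a : ℝ) (hr : 0 < r) (ha : 0 < a) :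
    IsGammaFunction c r a (explicitGamma c r a) := by
  refine isGammaFunction_of_pos c r a (sFun_neg c r a) fun α hα => ?_
  cases c
  · exact gammaPos_rational r a α hα
  · exact gammaPos_trigonometric r a hr α hα
  · exact gammaPos_hyperbolic r a ha α hα
  · exact gammaPos_elliptic r a hr ha α hα

end ExplicitGamma

variable {N M : ℕ}

/-- The sign `±1` as a complex number. -/
def sgn (ε : ℤˣ) : ℂ := ((ε : ℤ) : ℂ)

/-- The points `(x, x̃)`. -/
abbrev Pt (N M : ℕ) := (Fin N → ℂ) × (Fin M → ℂ)

/-- `x_j ↦ x_j + t`. -/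
def shiftX (p : Pt N M) (j : Fin N) (t : ℂ) : Pt N M :=
  (Function.update p.1 j (p.1 j + t), p.2)

/-- `x̃_k ↦ x̃_k + t`. -/
def shiftY (p : Pt N M) (k : Fin M) (t : ℂ) : Pt N M :=
  (p.1, Function.update p.2 k (p.2 k + t))

/-- The coefficients `V_j^±(x, x̃)`. -/
def coeffV (c : VDCase) (r a : ℝ) (g : Fin (2 * rho c + 2) → ℝ) (lam β : ℝ)
    (ε : ℤˣ) (j : Fin N) (p : Pt N M) : ℂ :=
  (∏ ν, sFun c r a (sgn ε * p.1 j - I * g ν * β)) /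
      (sFun c r a (sgn ε * (2 * p.1 j)) * sFun c r a (sgn ε * (2 * p.1 j) - I * β)) *
    ∏ δ : ℤˣ,
      ((∏ j' ∈ Finset.univ.erase j,
          sFun c r a (p.1 j + sgn δ * p.1 j' - sgn ε * (I * lam * β)) /
            sFun c r a (p.1 j + sgn δ * p.1 j')) *
        ∏ k : Fin M,
          sFun c r a (p.1 j + sgn δ * p.2 k - sgn ε * (I * (lam - 1) * β / 2)) /
            sFun c r a (p.1 j + sgn δ * p.2 k - sgn ε * (I * (lam + 1) * β / 2)))

/-- The coefficients `Ṽ_k^±(x, x̃)`, with `g̃_ν = (λ + 1)/2 - g_ν`. -/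
def coeffVt (c : VDCase) (r a : ℝ) (g : Fin (2 * rho c + 2) → ℝ) (lam β : ℝ)
    (ε : ℤˣ) (k : Fin M) (p : Pt N M) : ℂ :=
  (∏ ν, sFun c r a (sgn ε * p.2 k + I * ((lam + 1) / 2 - g ν) * β)) /
      (sFun c r a (sgn ε * (2 * p.2 k)) * sFun c r a (sgn ε * (2 * p.2 k) + I * lam * β)) *
    ∏ δ : ℤˣ,
      ((∏ k' ∈ Finset.univ.erase k,
          sFun c r a (p.2 k + sgn δ * p.2 k' + sgn ε * (I * β)) /
            sFun c r a (p.2 k + sgn δ * p.2 k')) *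
        ∏ j : Fin N,
          sFun c r a (p.2 k + sgn δ * p.1 j - sgn ε * (I * (lam - 1) * β / 2)) /
            sFun c r a (p.2 k + sgn δ * p.1 j + sgn ε * (I * (lam + 1) * β / 2)))

/-- The constant `(∏_{ν=1}^ρ s(ω_ν/2)²) / 4`. -/
def prefactor (c : VDCase) (r a : ℝ) : ℂ :=
  (∏ ν ∈ Finset.Icc 1 (rho c), sFun c r a (omega c r a ν / 2)) ^ 2 / 4

/-- The coefficient `V⁰(x, x̃)`. -/
def coeffV0 (c : VDCase) (r a : ℝ) (g : Fin (2 * rho c + 2) → ℝ) (lam β : ℝ)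
    (p : Pt N M) : ℂ :=
  -prefactor c r a * ∑ ν ∈ Finset.range (rho c + 1),
    exp (-r * xi ν * (2 * lam * N - 2 * M + ∑ μ, (g μ : ℂ)
          - (rho c + 1) * (lam + 1) / 2) * β) /
        (∏ μ ∈ (Finset.range (rho c + 1)).erase ν,
          sFun c r a ((omega c r a ν - omega c r a μ) / 2)) *
      ((∏ μ, sFun c r a (omega c r a ν / 2 + I * β / 2 - I * g μ * β)) /
        ∏ μ ∈ Finset.range (rho c + 1),
          sFun c r a ((omega c r a ν - omega c r a μ + I * (1 - lam) * β) / 2)) *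
      ∏ δ : ℤˣ,
        ((∏ j : Fin N,
            sFun c r a (sgn δ * p.1 j + omega c r a ν / 2 + I * β / 2 - I * lam * β) /
              sFun c r a (sgn δ * p.1 j + omega c r a ν / 2 + I * β / 2)) *
          ∏ k : Fin M,
            sFun c r a (sgn δ * p.2 k + omega c r a ν / 2 - I * lam * β / 2 + I * β) /
              sFun c r a (sgn δ * p.2 k + omega c r a ν / 2 - I * lam * β / 2))

/-- The constant `c⁰`. -/
def constC0 (c : VDCase) (r a : ℝ) (g : Fin (2 * rho c + 2) → ℝ) (lam β : ℝ) : ℂ :=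
  prefactor c r a * ∑ ν ∈ Finset.range (rho c + 1),
    exp (-r * xi ν * (∑ μ, (g μ : ℂ) - (rho c + 1) * (lam + 1) / 2) * β) /
        (∏ μ ∈ (Finset.range (rho c + 1)).erase ν,
          sFun c r a ((omega c r a ν - omega c r a μ) / 2)) *
      ((∏ μ, sFun c r a (omega c r a ν / 2 + I * lam * β / 2 - I * g μ * β)) /
        ∏ μ ∈ Finset.range (rho c + 1),
          sFun c r a ((omega c r a ν - omega c r a μ + I * (lam - 1) * β) / 2))

/-- The eigenvalue `𝓔_{N,Ñ}(g, λ, β)`. -/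
def eigenvalue (c : VDCase) (r a : ℝ) (g : Fin (2 * rho c + 2) → ℝ) (lam β : ℝ)
    (N M : ℕ) : ℂ :=
  constC0 c r a g lam β + prefactor c r a *
    sFun c r a (I * β * (2 * lam * N - 2 * M + ∑ μ, (g μ : ℂ) - (rho c + 1) * (lam + 1) / 2)
      - ∑ ν ∈ Finset.range (rho c + 1), omega c r a ν)

/-- The radicand of `Ψ_N(x; g, λ, β)`, that is `Ψ_N²`. -/
def groundStateSq (c : VDCase) (G : ℂ → ℂ → ℂ) (g : Fin (2 * rho c + 2) → ℝ) (lam β : ℝ)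
    (x : Fin N → ℂ) : ℂ :=
  (∏ j, G (2 * x j + I * β / 2) β * G (-(2 * x j) + I * β / 2) β /
      ∏ ν, (G (x j + I * β / 2 - I * g ν * β) β * G (-x j + I * β / 2 - I * g ν * β) β)) *
    ∏ j, ∏ k ∈ Finset.Ioi j, ∏ ε : ℤˣ, ∏ ε' : ℤˣ,
      G (sgn ε * x j + sgn ε' * x k + I * β / 2) β /
        G (sgn ε * x j + sgn ε' * x k - I * lam * β + I * β / 2) β

/-- The radicand of `Ψ_{N,Ñ}(x, x̃; g, λ, β)`, that is `Ψ_{N,Ñ}²`, where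
`g'_ν = (λ + 1 - 2 g_ν)/(2λ)`. -/
def deformedGroundStateSq (c : VDCase) (r a : ℝ) (G : ℂ → ℂ → ℂ)
    (g : Fin (2 * rho c + 2) → ℝ) (lam β : ℝ) (p : Pt N M) : ℂ :=
  groundStateSq c G g lam β p.1 *
      groundStateSq c G (fun ν => (lam + 1 - 2 * g ν) / (2 * lam)) (1 / lam) (lam * β) p.2 /
    ∏ j, ∏ δ : ℤˣ, ∏ k,
      (sFun c r a (p.1 j + sgn δ * p.2 k + I * (lam - 1) * β / 2) *
        sFun c r a (p.1 j + sgn δ * p.2 k - I * (lam - 1) * β / 2))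

/-- `h` is a branch of `f^{1/2}`; such a global choice may be discontinuous along cuts. -/
def IsSqrtBranch {X : Type*} (h f : X → ℂ) : Prop := ∀ p, h p ^ 2 = f p

/-- The deformed operator `H_{N,Ñ}` applied to `Φ`; `v ε j` and `vt ε k` are the branches of
`(V_j^ε)^{1/2}` and `(Ṽ_k^ε)^{1/2}` in use, and `exp(t ∂/∂x_j)` is the shift `x_j ↦ x_j + t`. -/
def deformedH (c : VDCase) (r a : ℝ) (g : Fin (2 * rho c + 2) → ℝ) (lam β : ℝ)
    (v : ℤˣ → Fin N → Pt N M → ℂ) (vt : ℤˣ → Fin M → Pt N M → ℂ)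
    (Φ : Pt N M → ℂ) (p : Pt N M) : ℂ :=
  ∑ ε : ℤˣ,
    (sFun c r a (I * lam * β) * ∑ j : Fin N,
        v ε j p * (v (-ε) j (shiftX p j (-(sgn ε * (I * β)))) *
          Φ (shiftX p j (-(sgn ε * (I * β)))))
      - sFun c r a (I * β) * ∑ k : Fin M,
        vt ε k p * (vt (-ε) k (shiftY p k (sgn ε * (I * lam * β))) *
          Φ (shiftY p k (sgn ε * (I * lam * β)))))
    + coeffV0 c r a g lam β p * Φ p

/-- Generic points: the (Gamma, respectively `s`) factors in the numerators and denominators of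
`Ψ_{N,Ñ}²` at `p`, and of the `V_j^±`, `Ṽ_k^±` at `p` and at the shifted points at which the
operator evaluates them, are all nonzero. -/
structure IsGeneric (c : VDCase) (r a : ℝ) (G : ℂ → ℂ → ℂ)
    (g : Fin (2 * rho c + 2) → ℝ) (lam β : ℝ) (p : Pt N M) : Prop where
  psi : deformedGroundStateSq c r a G g lam β p ≠ 0
  v : ∀ ε j, coeffV c r a g lam β ε j p ≠ 0
  v_shift : ∀ ε j, coeffV c r a g lam β (-ε) j (shiftX p j (-(sgn ε * (I * β)))) ≠ 0
  vt : ∀ ε k, coeffVt c r a g lam β ε k p ≠ 0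
  vt_shift : ∀ ε k, coeffVt c r a g lam β (-ε) k (shiftY p k (sgn ε * (I * lam * β))) ≠ 0

end VanDiejen

end

open VanDiejen

/-! Conjugating by Ψ removes the square roots. Applied factor by factor, the functional equation of
G gives the gauge relation V_j^-(Tq) Ψ²(Tq) = V_j^+(q) Ψ²(q) for T : x_j ↦ x_j - iβ, and its
analogue for x̃_k (`coeffV_mul_deformedGroundStateSq_shiftX`,
`coeffVt_mul_deformedGroundStateSq_shiftY`). Hence (V_j^-)^{1/2}(Tq) Ψ(Tq) / Ψ(q) is a branch of
(V_j^+)^{1/2}, and with this branch every shift term of the operator multiplies Ψ by V_j^± or Ṽ_k^±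
(`exists_intertwining_branch`, `intertwining_branch_apply`). What remains is the source identity
s(iλβ) Σ V_j^± - s(iβ) Σ Ṽ_k^± + V⁰ = 𝓔 (`sourceSum_eq`).

The source identity is a sum of residues in one variable u. Take the quotient of products of s with
zeros ±x_j + iλβ, ±x̃_k + i(λ-1)β/2, i g_ν β and equally many poles ±x_j, ±x̃_k + i(λ+1)β/2, ω_ν/2 +
iβ/2, ω_ν/2 + iλβ/2. Times P, the residues of the four families are -s(iλβ) V_j^±, s(iβ) Ṽ_k^±, and
the terms of -V⁰ and of c⁰. The last family does not depend on x, x̃, because s is symmetric up to a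
multiplier about each half period.

The residues add up to s(d), where d = Σ poles - Σ zeros = |ω| - iβκ, provided d = 0 or s(x+y)s(x-y)
= s(x)² - s(y)² (`sum_zeroProd_div`). The second alternative covers cases I, II, III. In case IV |ω|
= 0, and the balancing condition says κ = 0. This summation formula follows by induction from
Weierstrass' three-term relation, which for the theta function is proved with Liouville's theorem
(`threeTerm_of_quasiPeriodic`).

The duality (x, x̃; g, λ, β) ↔ (x̃, x; g', 1/λ, λβ) exchanges the two families of variables and
transfers the gauge relation from one to the other. -/

namespace VanDiejen

/-! ### The three-term relation and partial fractions -/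

/-- Weierstrass' three-term relation. -/
def ThreeTerm (s : ℂ → ℂ) : Prop := ∀ x y z w : ℂ,
  s (x + y) * s (x - y) * (s (z + w) * s (z - w)) +
    s (y + z) * s (y - z) * (s (x + w) * s (x - w)) +
    s (z + x) * s (z - x) * (s (y + w) * s (y - w)) = 0

theorem threeTerm_of_sq_sub_sq {s : ℂ → ℂ} (h : ∀ x y, s (x + y) * s (x - y) = s x ^ 2 - s y ^ 2) :
    ThreeTerm s := by
  intro x y z w
  simp only [h]
  ring

/-- The products `∏ s(u - b)` over the zeros `b ∈ B`. -/
def zeroProd (s : ℂ → ℂ) (B : Multiset ℂ) (u : ℂ) : ℂ := (B.map fun b => s (u - b)).prod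

theorem zeroProd_cons (s : ℂ → ℂ) (b : ℂ) (B : Multiset ℂ) (u : ℂ) :
    zeroProd s (b ::ₘ B) u = s (u - b) * zeroProd s B u := by
  simp [zeroProd]

/-- A pole that cancels against a zero may be dropped. -/
theorem sum_zeroProd_cancel {ι : Type*} [DecidableEq ι] {s : ℂ → ℂ} (h0 : s 0 = 0)
    (a : ι → ℂ) (S : Finset ι) (ha : ∀ i ∈ S, ∀ j ∈ S, i ≠ j → s (a i - a j) ≠ 0)
    (B : Multiset ℂ) {i₁ : ι} (h₁ : i₁ ∈ S) :
    ∑ i ∈ S, s (a i - a i₁) * zeroProd s B (a i) / ∏ j ∈ S.erase i, s (a i - a j)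
      = ∑ i ∈ S.erase i₁, zeroProd s B (a i) / ∏ j ∈ (S.erase i₁).erase i, s (a i - a j) := by
  rw [← Finset.add_sum_erase S _ h₁, sub_self, h0]
  simp only [zero_mul, zero_div, zero_add]
  refine Finset.sum_congr rfl fun i hi => ?_
  obtain ⟨hne, hiS⟩ := Finset.mem_erase.1 hi
  have hmem : i₁ ∈ S.erase i := Finset.mem_erase.2 ⟨hne.symm, h₁⟩
  rw [← Finset.mul_prod_erase _ _ hmem, Finset.erase_right_comm]
  exact mul_div_mul_left _ _ (ha i hiS i₁ h₁ hne)

/-- The partial fraction identity behind the source identity. -/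
theorem sum_zeroProd_div {ι : Type*} [DecidableEq ι] {s : ℂ → ℂ} (hodd : ∀ x, s (-x) = -s x)
    (h3 : ThreeTerm s) (hz : ∀ u v, s u = 0 → s v = 0 → s (u - v) = 0) {d : ℂ}
    (hd : d = 0 ∨ ∀ x y, s (x + y) * s (x - y) = s x ^ 2 - s y ^ 2) (a : ι → ℂ) :
    ∀ (n : ℕ) (S : Finset ι) (B : Multiset ℂ), S.card = n + 1 → B.card = n + 1 →
      (∀ i ∈ S, ∀ j ∈ S, i ≠ j → s (a i - a j) ≠ 0) → ∑ i ∈ S, a i - B.sum = d →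
      ∑ i ∈ S, zeroProd s B (a i) / ∏ j ∈ S.erase i, s (a i - a j) = s d := by
  have h0 : s 0 = 0 := by
    have := hodd 0
    rw [neg_zero] at this
    linear_combination this / 2
  intro n
  induction n with
  | zero =>
    intro S B hS hB ha hsum
    obtain ⟨i, rfl⟩ := Finset.card_eq_one.1 hS
    obtain ⟨b, rfl⟩ := Multiset.card_eq_one.1 hB
    simp [zeroProd] at hsum ⊢
    rw [hsum]
  | succ n ih =>
    intro S B hS hB ha hsum
    obtain ⟨b, B', rfl⟩ : ∃ b B', B = b ::ₘ B' := by
      obtain ⟨b, hb⟩ := Multiset.card_pos_iff_exists_mem.1 (by omega : 0 < B.card)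
      exact ⟨b, _, (Multiset.cons_erase hb).symm⟩
    simp only [Multiset.card_cons, add_left_inj] at hB
    obtain ⟨b', C, rfl⟩ : ∃ b C, B' = b ::ₘ C := by
      obtain ⟨b, hb⟩ := Multiset.card_pos_iff_exists_mem.1 (by omega : 0 < B'.card)
      exact ⟨b, _, (Multiset.cons_erase hb).symm⟩
    simp only [Multiset.card_cons, add_left_inj] at hB
    simp only [Multiset.sum_cons] at hsum
    -- Two zeros b, b' are to be traded for a pole and a new zero. The coefficients of this exchange
    -- have s(a_i + a_j - b - b') in the denominator.
    by_cases hpair : ∃ i ∈ S, ∃ j ∈ S, i ≠ j ∧ s (a i + a j - (b + b')) ≠ 0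
    · obtain ⟨i, hi, j, hj, hij, hne⟩ := hpair
      have hA := ha j hj i hi hij.symm
      -- α and γ are forced by evaluating `key` at u = a_j and at u = a_i.
      set α := s (a j - b) * s (a j - b') / (s (a j - a i) * s (a i + a j - (b + b'))) with hα
      set γ := -(s (a i - b) * s (a i - b')) / (s (a j - a i) * s (a i + a j - (b + b'))) with hγ
      have key : ∀ u, zeroProd s (b ::ₘ b' ::ₘ C) u =
          α * (s (u - a i) * zeroProd s ((b + b' - a i) ::ₘ C) u) +
            γ * (s (u - a j) * zeroProd s ((b + b' - a j) ::ₘ C) u) := by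
        intro u
        simp only [zeroProd_cons]
        -- Centring at the midpoint of b and b' makes the three-term relation a linear relation
        -- between the three products in `key`.
        have h := h3 (u - (b + b') / 2) ((b - b') / 2) (a i - (b + b') / 2) (a j - (b + b') / 2)
        rw [show u - (b + b') / 2 + (b - b') / 2 = u - b' by ring,
          show u - (b + b') / 2 - (b - b') / 2 = u - b by ring,
          show a i - (b + b') / 2 + (a j - (b + b') / 2) = a i + a j - (b + b') by ring,
          show a i - (b + b') / 2 - (a j - (b + b') / 2) = -(a j - a i) by ring,
          show (b - b') / 2 + (a i - (b + b') / 2) = a i - b' by ring,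
          show (b - b') / 2 - (a i - (b + b') / 2) = -(a i - b) by ring,
          show u - (b + b') / 2 + (a j - (b + b') / 2) = u - (b + b' - a j) by ring,
          show u - (b + b') / 2 - (a j - (b + b') / 2) = u - a j by ring,
          show a i - (b + b') / 2 + (u - (b + b') / 2) = u - (b + b' - a i) by ring,
          show a i - (b + b') / 2 - (u - (b + b') / 2) = -(u - a i) by ring,
          show (b - b') / 2 + (a j - (b + b') / 2) = a j - b' by ring,
          show (b - b') / 2 - (a j - (b + b') / 2) = -(a j - b) by ring] at h
        simp only [hodd] at h
        rw [hα, hγ]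
        field_simp
        linear_combination (-zeroProd s C u) * h
      simp only [key, add_div, mul_div_assoc, Finset.sum_add_distrib, ← Finset.mul_sum]
      simp only [← mul_div_assoc]
      rw [sum_zeroProd_cancel h0 a S ha _ hi, sum_zeroProd_cancel h0 a S ha _ hj]
      have hsub : ∀ i₀ ∈ S, ∀ i ∈ S.erase i₀, ∀ j ∈ S.erase i₀, i ≠ j → s (a i - a j) ≠ 0 :=
        fun i₀ _ i hi j hj => ha i (Finset.mem_of_mem_erase hi) j (Finset.mem_of_mem_erase hj)
      have hcard : ∀ i₀ ∈ S, (S.erase i₀).card = n + 1 := fun i₀ h => by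
        rw [Finset.card_erase_of_mem h, hS]; rfl
      -- Dropping the pole a_{i₀} and replacing b, b' by b + b' - a_{i₀} preserves d.
      have hs : ∀ i₀ ∈ S, ∑ i ∈ S.erase i₀, a i - ((b + b' - a i₀) ::ₘ C).sum = d := by
        intro i₀ h
        rw [Multiset.sum_cons, ← hsum, ← Finset.add_sum_erase S a h]
        ring
      rw [ih _ _ (hcard i hi) (by simp [hB]) (hsub i hi) (hs i hi),
        ih _ _ (hcard j hj) (by simp [hB]) (hsub j hj) (hs j hj)]
      -- The induction hypothesis leaves (α + γ) s(d). This is 0 if d = 0; otherwise the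
      -- difference-of-squares formula gives α + γ = 1.
      rcases hd with rfl | hd
      · simp [h0]
      · have hαγ : α + γ = 1 := by
          have e1 := hd (a j - (b + b') / 2) ((b - b') / 2)
          have e2 := hd (a i - (b + b') / 2) ((b - b') / 2)
          have e3 := hd (a j - (b + b') / 2) (a i - (b + b') / 2)
          rw [show a j - (b + b') / 2 + (b - b') / 2 = a j - b' by ring,
            show a j - (b + b') / 2 - (b - b') / 2 = a j - b by ring] at e1
          rw [show a i - (b + b') / 2 + (b - b') / 2 = a i - b' by ring,
            show a i - (b + b') / 2 - (b - b') / 2 = a i - b by ring] at e2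
          rw [show a j - (b + b') / 2 + (a i - (b + b') / 2) = a i + a j - (b + b') by ring,
            show a j - (b + b') / 2 - (a i - (b + b') / 2) = a j - a i by ring] at e3
          rw [hα, hγ]
          field_simp
          linear_combination e1 - e2 - e3
        linear_combination s d * hαγ
    -- All pairs are degenerate. With two poles, s(d) = 0 and the two terms cancel, their numerators
    -- being equal and their denominators opposite. With three poles, two of them would differ by a
    -- zero of s.
    · push Not at hpair
      rcases Nat.eq_zero_or_pos n with rfl | hn
      · obtain ⟨i, j, hij, rfl⟩ := Finset.card_eq_two.1 hS
        obtain rfl : C = 0 := Multiset.card_eq_zero.1 hB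
        have hne := ha i (by simp) j (by simp) hij
        rw [Finset.sum_pair hij] at hsum ⊢
        have hdz : s d = 0 := by
          rw [← hsum, Multiset.sum_zero, add_zero]
          exact hpair i (by simp) j (by simp) hij
        rw [Finset.erase_insert (by simpa using hij), Finset.erase_insert_of_ne hij]
        simp only [Finset.erase_singleton, insert_empty_eq, Finset.prod_singleton, zeroProd,
          Multiset.map_cons, Multiset.prod_cons, Multiset.map_zero, Multiset.prod_zero, mul_one, hdz]
        have hb : s (a i - b) * s (a i - b') = s (a j - b) * s (a j - b') := by
          rcases hd with rfl | hd
          · simp only [Multiset.sum_zero, add_zero] at hsum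
            rw [show a i - b = -(a j - b') by linear_combination hsum,
              show a i - b' = -(a j - b) by linear_combination hsum, hodd, hodd]
            ring
          · have e1 := hd (a j - (b + b') / 2) ((b - b') / 2)
            have e2 := hd (a i - (b + b') / 2) ((b - b') / 2)
            have e3 := hd (a j - (b + b') / 2) (a i - (b + b') / 2)
            rw [show a j - (b + b') / 2 + (b - b') / 2 = a j - b' by ring,
              show a j - (b + b') / 2 - (b - b') / 2 = a j - b by ring] at e1
            rw [show a i - (b + b') / 2 + (b - b') / 2 = a i - b' by ring,
              show a i - (b + b') / 2 - (b - b') / 2 = a i - b by ring] at e2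
            rw [show a j - (b + b') / 2 + (a i - (b + b') / 2) = a i + a j - (b + b') by ring,
              hpair i (by simp) j (by simp) hij, zero_mul] at e3
            linear_combination e2 - e1 + e3
        rw [hb, show a j - a i = -(a i - a j) by ring, hodd]
        ring
      · obtain ⟨i, j, k, hi, hj, hk, hij, hik, hjk⟩ :=
          Finset.two_lt_card_iff.1 (by omega : 2 < S.card)
        exfalso
        refine ha j hj k hk hjk ?_
        have := hz _ _ (hpair i hi j hj hij) (hpair i hi k hk hik)
        rwa [show a i + a j - (b + b') - (a i + a k - (b + b')) = a j - a k by ring] at this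

/-! ### The three-term relation for quasi-periodic functions -/

open Set Filter Topology

/-- An entire function that vanishes on a translate of the zero set of an entire function `s` with
simple zeros is divisible by that translate of `s`. -/
theorem exists_eq_mul_of_simple_zeros {s f : ℂ → ℂ} (hs : Differentiable ℂ s)
    (hf : Differentiable ℂ f) (hsimple : ∀ x, s x = 0 → deriv s x ≠ 0)
    (h0 : ∀ x, s x = 0 → f x = 0) : ∃ h : ℂ → ℂ, Differentiable ℂ h ∧ ∀ x, f x = s x * h x := by
  classical
  refine ⟨fun x => if s x = 0 then deriv f x / deriv s x else f x / s x, ?_, ?_⟩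
  · intro x₀
    by_cases hx : s x₀ = 0
    · have hf1 : DifferentiableAt ℂ (dslope f x₀) x₀ :=
        ((differentiableOn_dslope univ_mem).2 hf.differentiableOn).differentiableAt univ_mem
      have hs1 : DifferentiableAt ℂ (dslope s x₀) x₀ :=
        ((differentiableOn_dslope univ_mem).2 hs.differentiableOn).differentiableAt univ_mem
      have hne : dslope s x₀ x₀ ≠ 0 := by rw [dslope_same]; exact hsimple x₀ hx
      -- Near x₀ the quotient is the quotient of the difference quotients of f and s at x₀. They are
      -- holomorphic, and that of s does not vanish at x₀ because the zero is simple.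
      refine (hf1.div hs1 hne).congr_of_eventuallyEq ?_
      filter_upwards [hs1.continuousAt.eventually_ne hne] with x hxs
      rcases eq_or_ne x x₀ with rfl | hxx
      · simp [hx, dslope_same]
      · have e1 := sub_smul_dslope s x₀ x
        have e2 := sub_smul_dslope f x₀ x
        rw [hx, sub_zero, smul_eq_mul] at e1
        rw [h0 _ hx, sub_zero, smul_eq_mul] at e2
        have hxx' : x - x₀ ≠ 0 := sub_ne_zero.2 hxx
        simp only [Pi.div_apply, ← e1, ← e2, mul_eq_zero, hxx', hxs, or_self, if_false]
        field_simp
    · refine ((hf x₀).div (hs x₀) hx).congr_of_eventuallyEq ?_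
      filter_upwards [(hs x₀).continuousAt.eventually_ne hx] with x hxs
      simp [hxs]
  · intro x
    by_cases hx : s x = 0
    · simp [hx, h0 x hx]
    · simp only [hx, if_false]
      field_simp

/-- Countable sets have dense complement in ℂ, so continuous identities may be checked away from
such zeros. -/
theorem countable_zeros_comp {s : ℂ → ℂ} (hs : {x | s x = 0}.Countable) {c : ℂ} (hc : c ≠ 0)
    (d : ℂ) : {t | s (c * t + d) = 0}.Countable :=
  hs.preimage_of_injOn (f := fun t => c * t + d)
    (fun _ _ _ _ h => mul_left_cancel₀ hc (add_right_cancel h))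

/-- A continuous function with the periods `A > 0` and `iB`, `B > 0`, is bounded. -/
theorem isBounded_range_of_periodic {h : ℂ → ℂ} (hc : Continuous h) {A B : ℝ} (hA : 0 < A)
    (hB : 0 < B) (hpA : ∀ x, h (x + A) = h x) (hpB : ∀ x, h (x + I * B) = h x) :
    Bornology.IsBounded (range h) := by
  have h1 : Function.Periodic h (A : ℂ) := hpA
  have h2 : Function.Periodic h (I * B) := hpB
  refine (((isCompact_Icc (a := (0 : ℝ)) (b := A)).prod
    (isCompact_Icc (a := (0 : ℝ)) (b := B))).image
    (f := fun p : ℝ × ℝ => h (p.1 + p.2 * I)) (by fun_prop)).isBounded.subset ?_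
  rintro _ ⟨x, rfl⟩
  have hx1 := Int.sub_floor_div_mul_nonneg x.re hA
  have hx2 := (Int.sub_floor_div_mul_lt x.re hA).le
  have hy1 := Int.sub_floor_div_mul_nonneg x.im hB
  have hy2 := (Int.sub_floor_div_mul_lt x.im hB).le
  refine ⟨(x.re - ⌊x.re / A⌋ * A, x.im - ⌊x.im / B⌋ * B), ⟨⟨hx1, hx2⟩, ⟨hy1, hy2⟩⟩, ?_⟩
  have e1 := h1.int_mul ⌊x.re / A⌋
  have e2 := h2.int_mul ⌊x.im / B⌋
  refine (e1 _).symm.trans ((e2 _).symm.trans (congrArg h ?_))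
  simp only [ofReal_sub, ofReal_mul, ofReal_intCast]
  linear_combination x.re_add_im

/-- Entire functions that are quasi-periodic with respect to a rectangular lattice, with simple
zeros in the lattice points only, satisfy the three-term relation. -/
theorem threeTerm_of_quasiPeriodic {s : ℂ → ℂ} (hs : Differentiable ℂ s)
    (hodd : ∀ x, s (-x) = -s x) {L : AddSubgroup ℂ} (hL : (L : Set ℂ).Countable)
    (hz : ∀ x, s x = 0 → x ∈ L)
    (hq : ∀ l ∈ L, ∃ c d : ℂ, ∀ x, s (x + l) = exp (c * x + d) * s x) (hd : deriv s 0 ≠ 0)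
    {A B : ℝ} (hA : 0 < A) (hB : 0 < B) (hAL : (A : ℂ) ∈ L) (hBL : I * B ∈ L) : ThreeTerm s := by
  have h0 : s 0 = 0 := by
    have := hodd 0
    rw [neg_zero] at this
    linear_combination this / 2
  have hzL : ∀ l ∈ L, s l = 0 := fun l hl => by
    obtain ⟨c, d, h⟩ := hq l hl
    simpa [h0] using h 0
  have hcount : {x | s x = 0}.Countable := hL.mono hz
  -- Differentiating s(x + l) = e^{cx+d} s(x) at 0 carries the simple zero at 0 to every lattice
  -- point.
  have hsimple : ∀ x, s x = 0 → deriv s x ≠ 0 := by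
    intro l hl
    obtain ⟨c, d, h⟩ := hq l (hz l hl)
    have e1 : HasDerivAt (fun x => s (x + l)) (deriv s l) 0 := by
      have := (hs (0 + l)).hasDerivAt.comp_add_const 0 l
      simpa using this
    have e2 : HasDerivAt (fun x => exp (c * x + d) * s x) (exp (c * 0 + d) * deriv s 0) 0 := by
      have h1 : DifferentiableAt ℂ (fun x : ℂ => exp (c * x + d)) 0 := by fun_prop
      simpa [h0] using HasDerivAt.fun_mul h1.hasDerivAt (hs 0).hasDerivAt
    rw [(funext h : (fun x => s (x + l)) = _)] at e1
    rw [e1.unique e2]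
    exact mul_ne_zero (exp_ne_zero _) hd
  have hsub : ∀ y, Differentiable ℂ (fun x => s (x - y)) := fun y =>
    hs.comp (differentiable_id.sub_const y)
  have hadd : ∀ y, Differentiable ℂ (fun x => s (x + y)) := fun y =>
    hs.comp (differentiable_id.add_const y)
  intro x y z w
  -- For generic y, regard the relation as a statement about a function f of x and divide f by s(x -
  -- y) s(x + y).
  have hgen : ∀ y, s (2 * y) ≠ 0 → s (z - y) * s (z + y) ≠ 0 →
      s (x + y) * s (x - y) * (s (z + w) * s (z - w)) +
        s (y + z) * s (y - z) * (s (x + w) * s (x - w)) +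
        s (z + x) * s (z - x) * (s (y + w) * s (y - w)) = 0 := by
    intro y hy hzy
    set f : ℂ → ℂ := fun x => s (y + z) * s (y - z) * (s (x + w) * s (x - w)) -
      s (x + z) * s (x - z) * (s (y + w) * s (y - w)) with hfdef
    have hf : Differentiable ℂ f :=
      (((hadd w).mul (hsub w)).const_mul _).sub (((hadd z).mul (hsub z)).mul_const _)
    -- The multiplier of s(u - v) s(u + v) does not depend on v, so f and the divisor have the same
    -- multiplier.
    have hfq : ∀ l ∈ L, ∃ e : ℂ → ℂ, (∀ u, e u ≠ 0) ∧ (∀ u, f (u + l) = e u * f u) ∧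
        ∀ u, s (u + l - y) * s (u + l + y) = e u * (s (u - y) * s (u + y)) := by
      intro l hl
      obtain ⟨c, d, h⟩ := hq l hl
      have hh : ∀ u v, s (u + l - v) * s (u + l + v)
          = exp (2 * c * u + 2 * d) * (s (u - v) * s (u + v)) := by
        intro u v
        rw [show u + l - v = u - v + l by ring, show u + l + v = u + v + l by ring, h, h,
          show 2 * c * u + 2 * d = (c * (u - v) + d) + (c * (u + v) + d) by ring,
          exp_add (c * (u - v) + d)]
        ring
      refine ⟨_, fun u => exp_ne_zero (2 * c * u + 2 * d), fun u => ?_, fun u => hh u y⟩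
      simp only [hfdef]
      linear_combination s (y + z) * s (y - z) * hh u w - s (y + w) * s (y - w) * hh u z
    have hfy : ∀ l ∈ L, f (l + y) = 0 ∧ f (l - y) = 0 := by
      intro l hl
      obtain ⟨e, -, he, -⟩ := hfq l hl
      rw [show l + y = y + l by ring, show l - y = -y + l by ring, he, he]
      have e1 : f y = 0 := by simp only [hfdef]; ring
      have e2 : f (-y) = 0 := by
        simp only [hfdef]
        rw [show -y + w = -(y - w) by ring, show -y - w = -(y + w) by ring,
          show -y + z = -(y - z) by ring, show -y - z = -(y + z) by ring, hodd, hodd, hodd, hodd]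
        ring
      simp [e1, e2]
    obtain ⟨h₁, hh₁, hfh₁⟩ := exists_eq_mul_of_simple_zeros (hsub y) hf
      (fun x hx => by
        rw [show deriv (fun x => s (x - y)) x = deriv s (x - y) from deriv_comp_sub_const _ _ _]
        exact hsimple _ hx)
      (fun x hx => by simpa using (hfy _ (hz _ hx)).1)
    -- Since s(2y) ≠ 0, the translates y + L and -y + L are disjoint, and division by s(x - y) did
    -- not use up the zeros on -y + L.
    obtain ⟨h₂, hh₂, hfh₂⟩ := exists_eq_mul_of_simple_zeros (hadd y) hh₁
      (fun x hx => by
        rw [show deriv (fun x => s (x + y)) x = deriv s (x + y) from deriv_comp_add_const _ _ _]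
        exact hsimple _ hx)
      (fun x hx => by
        have h1 := hfh₁ x
        have h2 : f x = 0 := by simpa using (hfy _ (hz _ hx)).2
        rw [h2] at h1
        refine (mul_eq_zero.1 h1.symm).resolve_left fun h3 => hy ?_
        have := L.sub_mem (hz _ hx) (hz _ h3)
        rw [show x + y - (x - y) = 2 * y by ring] at this
        exact hzL _ this)
    have hfac : ∀ u, f u = s (u - y) * s (u + y) * h₂ u := fun u => by
      rw [hfh₁, hfh₂, mul_assoc]
    have hper : ∀ l ∈ L, ∀ u, h₂ (u + l) = h₂ u := by
      intro l hl
      obtain ⟨e, he0, he, hey⟩ := hfq l hl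
      have hdense : Dense {u | s (1 * u + -y) = 0 ∨ s (1 * u + y) = 0}ᶜ :=
        ((countable_zeros_comp hcount one_ne_zero (-y)).union
          (countable_zeros_comp hcount one_ne_zero y)).dense_compl ℝ
      refine congrFun (Continuous.ext_on hdense
        (hh₂.continuous.comp (continuous_id.add continuous_const)) hh₂.continuous ?_)
      intro u hu
      simp only [mem_compl_iff, mem_ofPred_eq, not_or, one_mul, ← sub_eq_add_neg] at hu
      have h1 := hfac (u + l)
      rw [he, hey, hfac u, mul_assoc (e u)] at h1
      exact (mul_left_cancel₀ (mul_ne_zero hu.1 hu.2) (mul_left_cancel₀ (he0 u) h1)).symm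
    -- The quotient is entire and doubly periodic, so it is constant by Liouville; its value is read
    -- off at x = z.
    have hconst : h₂ x = h₂ z := hh₂.apply_eq_apply_of_bounded
      (isBounded_range_of_periodic hh₂.continuous hA hB (hper _ hAL) (hper _ hBL)) x z
    have hcz : h₂ z = -(s (z + w) * s (z - w)) := by
      have h1 := hfac z
      simp only [hfdef, sub_self, h0, mul_zero, zero_mul, sub_zero] at h1
      rw [show y - z = -(z - y) by ring, hodd] at h1
      have h2 : s (z - y) * s (z + y) * (h₂ z + s (z + w) * s (z - w)) = 0 := by
        rw [add_comm y z] at h1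
        linear_combination -h1
      linear_combination (mul_eq_zero.1 h2).resolve_left hzy
    have h1 := hfac x
    rw [hconst, hcz] at h1
    simp only [hfdef] at h1
    rw [show z - x = -(x - z) by ring, hodd, add_comm z x]
    linear_combination h1
  -- The excluded y form a countable set, and the relation is continuous in y.
  have hdense : Dense {y | s (2 * y + 0) = 0 ∨ s (-1 * y + z) = 0 ∨ s (1 * y + z) = 0}ᶜ :=
    ((countable_zeros_comp hcount two_ne_zero 0).union
      ((countable_zeros_comp hcount (by norm_num) z).union
        (countable_zeros_comp hcount one_ne_zero z))).dense_compl ℝ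
  have hsc := hs.continuous
  refine congrFun (Continuous.ext_on hdense (f := fun y =>
    s (x + y) * s (x - y) * (s (z + w) * s (z - w)) +
        s (y + z) * s (y - z) * (s (x + w) * s (x - w)) +
        s (z + x) * s (z - x) * (s (y + w) * s (y - w))) (g := fun _ => 0)
        (by fun_prop) continuous_const ?_) y
  intro u hu
  simp only [mem_compl_iff, mem_ofPred_eq, not_or, one_mul, add_zero, neg_mul] at hu
  refine hgen u hu.1 (mul_ne_zero ?_ ?_)
  · simpa [sub_eq_add_neg, add_comm] using hu.2.1
  · simpa [add_comm] using hu.2.2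

/-! ### Infinite q-products -/

section QPochhammer

/-- The infinite `q`-Pochhammer symbol `∏ (1 - pⁿ z)`. -/
noncomputable def qPoch (p z : ℂ) : ℂ := ∏' n : ℕ, (1 - p ^ n * z)

variable {p : ℂ}

theorem qPoch_eq_mul (hp : ‖p‖ < 1) (z : ℂ) : qPoch p z = (1 - z) * qPoch p (p * z) :=
  tprod_qProd hp z

/-- An absolutely convergent product vanishes only if one of its factors does. -/
theorem exists_of_qPoch_eq_zero (hp : ‖p‖ < 1) {z : ℂ} (h : qPoch p z = 0) :
    ∃ n : ℕ, p ^ n * z = 1 := by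
  by_contra! hn
  have hs : Summable fun n : ℕ => ‖-(p ^ n * z)‖ := by
    simp only [norm_neg, norm_mul, norm_pow]
    exact (summable_geometric_of_lt_one (norm_nonneg _) hp).mul_right _
  refine tprod_one_add_ne_zero_of_summable (f := fun n : ℕ => -(p ^ n * z)) (fun n h => hn n ?_) hs
    (by simpa [qPoch, sub_eq_add_neg] using h)
  linear_combination -h

theorem qPoch_self_ne_zero (hp : ‖p‖ < 1) : qPoch p p ≠ 0 := by
  intro h
  obtain ⟨n, hn⟩ := exists_of_qPoch_eq_zero hp h
  rw [← pow_succ] at hn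
  have h2 : ‖p‖ ^ (n + 1) = 1 := by rw [← norm_pow, hn, norm_one]
  exact absurd h2 (pow_lt_one₀ (norm_nonneg p) hp (Nat.succ_ne_zero n)).ne

/-- On the disc of radius R the n-th factor differs from 1 by at most |p|ⁿR, so the product
converges locally uniformly. -/
theorem differentiable_qPoch (hp : ‖p‖ < 1) : Differentiable ℂ (qPoch p) := by
  have hball : ∀ R : ℝ, DifferentiableOn ℂ (qPoch p) (Metric.ball 0 R) := by
    intro R
    have h : HasProdLocallyUniformlyOn (fun (n : ℕ) (z : ℂ) => 1 + -(p ^ n * z))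
        (fun z => ∏' n : ℕ, (1 + -(p ^ n * z))) (Metric.ball 0 R) := by
      refine Summable.hasProdLocallyUniformlyOn_nat_one_add Metric.isOpen_ball
        ((summable_geometric_of_lt_one (norm_nonneg p) hp).mul_right R)
        (Eventually.of_forall fun n z hz => ?_) (fun n => by fun_prop)
      rw [norm_neg, norm_mul, norm_pow]
      exact mul_le_mul_of_nonneg_left (by simpa using (Metric.mem_ball.1 hz).le) (by positivity)
    simp only [← sub_eq_add_neg] at h
    exact h.differentiableOn (Eventually.of_forall fun S => by
      simpa [Finset.prod_fn] using DifferentiableOn.finsetProd (fun _ _ => by fun_prop))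
      Metric.isOpen_ball
  intro z
  exact (hball (‖z‖ + 1)).differentiableAt (Metric.isOpen_ball.mem_nhds (by simp))

/-- 1 - p²ⁿz² = (1 - pⁿz)(1 + pⁿz); afterwards even and odd powers of p are separated. This is the
source of the duplication formula for theta functions. -/
theorem qPoch_sq (hp : ‖p‖ < 1) (z : ℂ) :
    qPoch (p ^ 2) (z ^ 2) = qPoch (p ^ 2) z * qPoch (p ^ 2) (p * z) *
      (qPoch (p ^ 2) (-z) * qPoch (p ^ 2) (-(p * z))) := by
  have hp2 : ‖p ^ 2‖ < 1 := by
    rw [norm_pow]; exact pow_lt_one₀ (norm_nonneg _) hp two_ne_zero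
  have hsplit : ∀ w, qPoch p w = qPoch (p ^ 2) w * qPoch (p ^ 2) (p * w) := by
    intro w
    have h1 := multipliable_qProd hp2 w
    have h2 := multipliable_qProd hp2 (p * w)
    unfold qPoch
    rw [← tprod_even_mul_odd (f := fun n : ℕ => 1 - p ^ n * w)]
    · congr 1 <;> congr 1 <;> funext n <;> ring
    · simpa [pow_mul] using h1
    · simpa [pow_mul, pow_succ, mul_assoc] using h2
  have h : qPoch (p ^ 2) (z ^ 2) = qPoch p z * qPoch p (-z) := by
    unfold qPoch
    rw [← (multipliable_qProd hp z).tprod_mul (multipliable_qProd hp (-z))]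
    congr 1
    funext n
    ring
  rw [h, hsplit z, hsplit (-z), mul_neg]

end QPochhammer

/-! ### The theta function: product formula, quasi-periods, zeros -/

section Elliptic

variable {r a : ℝ}

theorem norm_exp_neg_lt_one (hr : 0 < r) (ha : 0 < a) : ‖exp (-(r * a : ℂ))‖ < 1 :=
  norm_cexp_lt_one (by simpa using mul_pos hr ha)

theorem norm_exp_neg_sq_lt_one (hr : 0 < r) (ha : 0 < a) : ‖exp (-(r * a : ℂ)) ^ 2‖ < 1 := by
  rw [norm_pow]
  exact pow_lt_one₀ (norm_nonneg _) (norm_exp_neg_lt_one hr ha) two_ne_zero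

/-- The product formula for `s` in the elliptic case. -/
theorem exists_sFun_elliptic_eq (hr : 0 < r) (ha : 0 < a) :
    ∃ K : ℂ, K ≠ 0 ∧ ∀ x : ℂ, sFun .elliptic r a x = K * exp (-(I * r * x)) *
      qPoch (exp (-(r * a : ℂ)) ^ 2) (exp (2 * I * r * x)) *
      qPoch (exp (-(r * a : ℂ)) ^ 2) (exp (-(r * a : ℂ)) ^ 2 * exp (-(2 * I * r * x))) := by
  have hr0 : (r : ℂ) ≠ 0 := by exact_mod_cast hr.ne'
  have hI2 : I * I = -1 := I_mul_I
  have hp := norm_exp_neg_sq_lt_one hr ha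
  -- With τ = ira/π the nome is q = e^{-ra}, so p = q². The factor e^{ra/4} in s cancels q^{1/4},
  -- and the sine supplies the missing factor 1 - z of the first product.
  set p := exp (-(r * a : ℂ)) ^ 2 with hpdef
  have hD0 := qPoch_self_ne_zero hp
  refine ⟨I / r * qPoch p p, by simp [hr0, hD0], fun x => ?_⟩
  set z := exp (2 * I * r * x) with hz
  set z' := exp (-(2 * I * r * x)) with hz'
  have hzz : z * z' = 1 := by rw [hz, hz', ← exp_add]; simp
  have hpi : (Real.pi : ℂ) ≠ 0 := by exact_mod_cast Real.pi_ne_zero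
  have hpi' : (Real.pi : ℂ) * (I * r * a / Real.pi) = I * r * a := by field_simp
  have t1 : ∀ n : ℕ, exp (2 * Real.pi * I * (n + 1) * (I * r * a / Real.pi)) = p ^ n * p := by
    intro n
    rw [← pow_succ, hpdef, ← pow_mul, ← exp_nat_mul]
    congr 1
    push_cast
    linear_combination 2 * I * (n + 1 : ℂ) * hpi' + 2 * (n + 1 : ℂ) * r * a * hI2
  have t2 : ∀ n : ℕ, exp (4 * Real.pi * I * (n + 1) * (I * r * a / Real.pi))
      = (p ^ n * p) * (p ^ n * p) := by
    intro n
    rw [← t1 n, ← exp_add]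
    congr 1
    ring
  have t3 : 2 * cos (2 * (r * x)) = z + z' := by
    rw [Complex.cos, hz, hz', show 2 * (r * x) * I = 2 * I * r * x by ring,
      show -(2 * (r * x)) * I = -(2 * I * r * x) by ring]
    ring
  have t4 : exp (Real.pi * I * (I * r * a / Real.pi) / 4) * exp (r * a / 4) = 1 := by
    rw [← exp_add, ← exp_zero]
    congr 1
    linear_combination I / 4 * hpi' + r * a / 4 * hI2
  have t5 : -I * (2 * sin (r * x)) = exp (-(I * r * x)) * (1 - z) := by
    have e5 : z = exp (I * r * x) * exp (I * r * x) := by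
      rw [hz, ← exp_add]; ring_nf
    have e6 : exp (-(I * r * x)) * exp (I * r * x) = 1 := by rw [← exp_add]; simp
    rw [e5, Complex.sin, show -(r * x) * I = -(I * r * x) by ring,
      show r * x * I = I * r * x by ring]
    linear_combination (-exp (-(I * r * x)) + exp (I * r * x)) * hI2 + exp (I * r * x) * e6
  have t6 : ∏' n : ℕ, ((1 - exp (2 * Real.pi * I * (n + 1) * (I * r * a / Real.pi))) *
      (1 - 2 * exp (2 * Real.pi * I * (n + 1) * (I * r * a / Real.pi)) * cos (2 * (r * x))
      + exp (4 * Real.pi * I * (n + 1) * (I * r * a / Real.pi))))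
      = qPoch p p * (qPoch p (p * z) * qPoch p (p * z')) := by
    unfold qPoch
    rw [← (multipliable_qProd hp (p * z)).tprod_mul (multipliable_qProd hp (p * z')),
      ← (multipliable_qProd hp p).tprod_mul
        ((multipliable_qProd hp (p * z)).mul (multipliable_qProd hp (p * z')))]
    congr 1
    funext n
    rw [t1, t2]
    linear_combination (1 - p ^ n * p) * (-(p ^ n * p) * t3 - (p ^ n * p) ^ 2 * hzz)
  rw [qPoch_eq_mul hp z]
  simp only [sFun, theta1]
  rw [t6]
  generalize exp (Real.pi * I * (I * r * a / Real.pi) / 4) = E₁ at t4 ⊢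
  generalize exp ((r : ℂ) * a / 4) = E₂ at t4 ⊢
  generalize exp (-(I * r * x)) = E₃ at t5 ⊢
  field_simp
  linear_combination (2 * sin (r * x) * qPoch p (p * z) * qPoch p (p * z')) * t4
    + I * qPoch p (p * z) * qPoch p (p * z') * t5
    + 2 * sin (r * x) * qPoch p (p * z) * qPoch p (p * z') * hI2

theorem differentiable_sFun_elliptic (hr : 0 < r) (ha : 0 < a) :
    Differentiable ℂ (sFun .elliptic r a) := by
  obtain ⟨K, -, hK⟩ := exists_sFun_elliptic_eq hr ha
  rw [funext hK]
  have hq := differentiable_qPoch (norm_exp_neg_sq_lt_one hr ha)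
  exact (Differentiable.mul (by fun_prop) (hq.comp (by fun_prop))).mul (hq.comp (by fun_prop))

/-- The zero at 0 comes from the factor 1 - e^{2irx} alone; the remaining factors have a nonzero
product there. -/
theorem deriv_sFun_elliptic_zero_ne (hr : 0 < r) (ha : 0 < a) :
    deriv (sFun .elliptic r a) 0 ≠ 0 := by
  obtain ⟨K, hK0, hK⟩ := exists_sFun_elliptic_eq hr ha
  have hp := norm_exp_neg_sq_lt_one hr ha
  have hr0 : (r : ℂ) ≠ 0 := by exact_mod_cast hr.ne'
  set p := exp (-(r * a : ℂ)) ^ 2 with hpdef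
  have hq := differentiable_qPoch hp
  have hD0 := qPoch_self_ne_zero hp
  set B : ℂ → ℂ := fun x => K * exp (-(I * r * x)) * qPoch p (p * exp (2 * I * r * x)) *
    qPoch p (p * exp (-(2 * I * r * x))) with hB
  have hfac : sFun .elliptic r a = fun x => (1 - exp (2 * I * r * x)) * B x := by
    funext x
    rw [hK, qPoch_eq_mul hp (exp (2 * I * r * x))]
    simp only [hB]
    ring
  have hBd : DifferentiableAt ℂ B 0 :=
    ((Differentiable.mul (by fun_prop) (hq.comp (by fun_prop))).mul (hq.comp (by fun_prop))) 0
  have h1 : HasDerivAt (fun x : ℂ => 1 - exp (2 * I * r * x)) (-(2 * I * r)) 0 := by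
    have := ((hasDerivAt_id (0 : ℂ)).const_mul (2 * I * r)).cexp.const_sub 1
    simpa using this
  have h2 := HasDerivAt.fun_mul h1 hBd.hasDerivAt
  rw [hfac, h2.deriv]
  simp [hB, hK0, hD0, hr0]

theorem sFun_elliptic_add_real (hr : 0 < r) (x : ℂ) :
    sFun .elliptic r a (x + Real.pi / r) = -sFun .elliptic r a x := by
  have hr0 : (r : ℂ) ≠ 0 := by exact_mod_cast hr.ne'
  have h1 : (r : ℂ) * (x + Real.pi / r) = r * x + Real.pi := by field_simp
  simp only [sFun, theta1, h1, sin_add_pi, mul_add 2 ((r : ℂ) * x), cos_add_two_pi]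
  ring

/-- The translation multiplies e^{2irx} by p, which removes one factor from the first q-product and
adds one to the second. -/
theorem sFun_elliptic_add_imag (hr : 0 < r) (ha : 0 < a) (x : ℂ) :
    sFun .elliptic r a (x + I * a) = -exp (r * a - 2 * I * r * x) * sFun .elliptic r a x := by
  obtain ⟨K, hK0, hK⟩ := exists_sFun_elliptic_eq hr ha
  have hp := norm_exp_neg_sq_lt_one hr ha
  rw [hK, hK]
  set p := exp (-(r * a : ℂ)) ^ 2 with hpdef
  have hp0 : p ≠ 0 := pow_ne_zero _ (exp_ne_zero _)
  have e1 : exp (2 * I * r * (x + I * a)) = p * exp (2 * I * r * x) := by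
    rw [hpdef, ← exp_nat_mul, ← exp_add]
    congr 1
    push_cast
    linear_combination 2 * r * a * I_mul_I
  have e2 : p * exp (-(2 * I * r * (x + I * a))) = exp (-(2 * I * r * x)) := by
    rw [hpdef, ← exp_nat_mul, ← exp_add]
    congr 1
    push_cast
    linear_combination -2 * r * a * I_mul_I
  have e3 : exp (-(I * r * (x + I * a))) = exp (r * a) * exp (-(I * r * x)) := by
    rw [← exp_add]
    congr 1
    linear_combination -r * a * I_mul_I
  have e4 : exp (r * a - 2 * I * r * x) = exp (r * a) * exp (-(2 * I * r * x)) := by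
    rw [← exp_add]; ring_nf
  have e5 : exp (2 * I * r * x) * exp (-(2 * I * r * x)) = 1 := by rw [← exp_add]; simp
  rw [e1, e2, e3, e4, qPoch_eq_mul hp (exp (2 * I * r * x)),
    qPoch_eq_mul hp (exp (-(2 * I * r * x)))]
  linear_combination (-K * exp (r * a) * exp (-(I * r * x)) * qPoch p (p * exp (2 * I * r * x)) *
    qPoch p (p * exp (-(2 * I * r * x)))) * e5

/-- A vanishing factor of either q-product says that e^{2ir(x - nia)} = 1 for some integer n; n ≤ 0
for the first product and n ≥ 1 for the second. -/
theorem exists_of_sFun_elliptic_eq_zero (hr : 0 < r) (ha : 0 < a) {x : ℂ}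
    (h : sFun .elliptic r a x = 0) : ∃ m n : ℤ, x = m * (Real.pi / r) + n * (I * a) := by
  obtain ⟨K, hK0, hK⟩ := exists_sFun_elliptic_eq hr ha
  have hp := norm_exp_neg_sq_lt_one hr ha
  have hr0 : (r : ℂ) ≠ 0 := by exact_mod_cast hr.ne'
  rw [hK] at h
  have key : ∃ n : ℤ, exp (2 * I * r * (x - n * (I * a))) = 1 := by
    simp only [mul_eq_zero, hK0, exp_ne_zero, or_self, false_or] at h
    rcases h with h | h
    · obtain ⟨n, hn⟩ := exists_of_qPoch_eq_zero hp h
      refine ⟨-n, ?_⟩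
      rw [← hn, ← pow_mul, ← exp_nat_mul, ← exp_add]
      congr 1
      push_cast
      linear_combination 2 * n * r * a * I_mul_I
    · obtain ⟨n, hn⟩ := exists_of_qPoch_eq_zero hp h
      refine ⟨n + 1, ?_⟩
      rw [← inv_inj, inv_one, ← exp_neg, ← hn, ← pow_mul, ← exp_nat_mul, ← exp_nat_mul, ← exp_add,
        ← exp_add]
      congr 1
      push_cast
      linear_combination 2 * (n + 1) * r * a * I_mul_I
  obtain ⟨n, hn⟩ := key
  obtain ⟨m, hm⟩ := exp_eq_one_iff.1 hn
  refine ⟨m, n, ?_⟩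
  have h2 : (r : ℂ) * (x - n * (I * a)) = m * Real.pi := by
    have h3 : (2 * I) * ((r : ℂ) * (x - n * (I * a))) = (2 * I) * (m * Real.pi) := by
      linear_combination hm
    exact mul_left_cancel₀ (mul_ne_zero two_ne_zero I_ne_zero) h3
  field_simp
  linear_combination h2

end Elliptic

/-! ### The function s in all cases: duplication, zeros, half periods -/

variable {r a : ℝ}

/-- With P = e^{-ra}, translation by half of π/r changes the sign of z = e^{2iru}, and translation
by ia/2 multiplies z by P. So the four translates of s supply exactly the eight q-products into
which `qPoch_sq` splits s(2u). The constant is left open here and determined in `sFun_two_mul`. -/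
theorem exists_sFun_elliptic_two_mul (hr : 0 < r) (ha : 0 < a) :
    ∃ C : ℂ, ∀ u, sFun .elliptic r a (2 * u) = C * (sFun .elliptic r a u *
      sFun .elliptic r a (u - Real.pi / r / 2) * sFun .elliptic r a (u - I * a / 2) *
        sFun .elliptic r a (u + Real.pi / r / 2 + I * a / 2)) := by
  obtain ⟨K, hK0, hK⟩ := exists_sFun_elliptic_eq hr ha
  have hr0 : (r : ℂ) ≠ 0 := by exact_mod_cast hr.ne'
  have hP := norm_exp_neg_lt_one hr ha
  refine ⟨-(K ^ 3 * exp (r * a))⁻¹, fun u => ?_⟩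
  have e1 := sFun_elliptic_add_imag hr ha (u - I * a / 2)
  rw [show u - I * a / 2 + I * a = u + I * a / 2 by ring,
    show (r : ℂ) * a - 2 * I * r * (u - I * a / 2) = -(2 * I * r * u) by
      linear_combination r * a * I_mul_I] at e1
  set P := exp (-(r * a : ℂ)) with hPdef
  set z := exp (2 * I * r * u) with hz
  set z' := exp (-(2 * I * r * u)) with hz'
  set E := exp (-(I * r * u)) with hE
  set F := exp (r * a / 2 : ℂ) with hF
  have hzz : z * z' = 1 := by rw [hz, hz', ← exp_add]; simp
  have hEz : E ^ 2 * z = 1 := by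
    rw [hz, hE, ← exp_nat_mul, ← exp_add, ← exp_zero]
    congr 1
    push_cast
    ring
  have hFF : exp (r * a : ℂ) = F ^ 2 := by
    rw [hF, ← exp_nat_mul]
    congr 1
    push_cast
    ring
  have hPF : P * F ^ 2 = 1 := by
    rw [← hFF, hPdef, ← exp_add]; simp
  have hpiI : exp (Real.pi / 2 * I) = I := exp_pi_div_two_mul_I
  have hpiI' : exp (-(Real.pi / 2 * I)) = -I := by rw [exp_neg, hpiI, inv_I]
  have s0 : sFun .elliptic r a u = K * E * qPoch (P ^ 2) z * qPoch (P ^ 2) (P * (P * z')) := by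
    rw [hK, pow_two P, mul_assoc P P z']
  have s1 : sFun .elliptic r a (u - Real.pi / r / 2)
      = K * (I * E) * qPoch (P ^ 2) (-z) * qPoch (P ^ 2) (-(P * (P * z'))) := by
    rw [hK]
    have h1 : exp (-(I * r * (u - Real.pi / r / 2))) = I * E := by
      rw [hE]
      nth_rw 2 [← hpiI]
      rw [← exp_add]
      congr 1
      field_simp
      ring
    have h2 : exp (2 * I * r * (u - Real.pi / r / 2)) = -z := by
      rw [hz, ← exp_sub_pi_mul_I]
      congr 1
      field_simp
    have h3 : exp (-(2 * I * r * (u - Real.pi / r / 2))) = -z' := by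
      rw [hz', ← exp_add_pi_mul_I]
      congr 1
      field_simp
      ring
    rw [h1, h2, h3]
    ring_nf
  have s2 : sFun .elliptic r a (u + I * a / 2)
      = K * (F * E) * qPoch (P ^ 2) (P * z) * qPoch (P ^ 2) (P * z') := by
    rw [hK]
    have h1 : exp (-(I * r * (u + I * a / 2))) = F * E := by
      rw [hE, hF, ← exp_add]
      congr 1
      linear_combination -r * a / 2 * I_mul_I
    have h2 : exp (2 * I * r * (u + I * a / 2)) = P * z := by
      rw [hz, hPdef, ← exp_add]
      congr 1
      linear_combination r * a * I_mul_I
    have h3 : P ^ 2 * exp (-(2 * I * r * (u + I * a / 2))) = P * z' := by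
      rw [hz', hPdef, ← exp_nat_mul, ← exp_add, ← exp_add]
      congr 1
      push_cast
      linear_combination -r * a * I_mul_I
    rw [h1, h2, h3]
  have s3 : sFun .elliptic r a (u + Real.pi / r / 2 + I * a / 2)
      = K * (-I * F * E) * qPoch (P ^ 2) (-(P * z)) * qPoch (P ^ 2) (-(P * z')) := by
    rw [hK]
    have h1 : exp (-(I * r * (u + Real.pi / r / 2 + I * a / 2))) = -I * F * E := by
      rw [hE, hF, ← hpiI', ← exp_add, ← exp_add]
      congr 1
      field_simp
      linear_combination -r * a * I_mul_I
    have h2 : exp (2 * I * r * (u + Real.pi / r / 2 + I * a / 2)) = -(P * z) := by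
      rw [hz, hPdef, ← exp_add, ← exp_add_pi_mul_I]
      congr 1
      field_simp
      linear_combination r * a * I_mul_I
    have h3 : P ^ 2 * exp (-(2 * I * r * (u + Real.pi / r / 2 + I * a / 2))) = -(P * z') := by
      rw [hz', hPdef, ← exp_nat_mul, ← exp_add, ← exp_add, ← exp_sub_pi_mul_I]
      congr 1
      push_cast
      field_simp
      linear_combination -r * a * I_mul_I
    rw [h1, h2, h3]
  have s2' : sFun .elliptic r a (u - I * a / 2) = -(z * sFun .elliptic r a (u + I * a / 2)) := by
    linear_combination z * e1 - sFun .elliptic r a (u - I * a / 2) * hzz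
  have d0 : sFun .elliptic r a (2 * u)
      = K * E ^ 2 * qPoch (P ^ 2) (z ^ 2) * qPoch (P ^ 2) ((P * z') ^ 2) := by
    rw [hK]
    have h1 : exp (-(I * r * (2 * u))) = E ^ 2 := by
      rw [hE, ← exp_nat_mul]
      congr 1
      push_cast
      ring
    have h2 : exp (2 * I * r * (2 * u)) = z ^ 2 := by
      rw [hz, ← exp_nat_mul]
      congr 1
      push_cast
      ring
    have h3 : P ^ 2 * exp (-(2 * I * r * (2 * u))) = (P * z') ^ 2 := by
      rw [mul_pow, hz', ← exp_nat_mul (-(2 * I * r * u))]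
      congr 2
      push_cast
      ring
    rw [h1, h2, h3]
  rw [d0, s2', s0, s1, s2, s3, qPoch_sq hP, qPoch_sq hP, hFF]
  have hF0 : F ≠ 0 := exp_ne_zero _
  generalize qPoch (P ^ 2) z = q1
  generalize qPoch (P ^ 2) (P * z) = q2
  generalize qPoch (P ^ 2) (-z) = q3
  generalize qPoch (P ^ 2) (-(P * z)) = q4
  generalize qPoch (P ^ 2) (P * z') = q5
  generalize qPoch (P ^ 2) (P * (P * z')) = q6
  generalize qPoch (P ^ 2) (-(P * z')) = q7
  generalize qPoch (P ^ 2) (-(P * (P * z'))) = q8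
  field_simp
  linear_combination -(E ^ 2 * q1 * q2 * q3 * q4 * q5 * q6 * q7 * q8) * hEz +
    E ^ 4 * z * q1 * q2 * q3 * q4 * q5 * q6 * q7 * q8 * I_sq

variable {c : VDCase}

theorem sFun_zero (c : VDCase) (r a : ℝ) : sFun c r a 0 = 0 := by
  have := sFun_neg c r a 0
  rw [neg_zero] at this
  linear_combination this / 2

/-- A uniform inclusion only: in cases I and II the group on the right is larger than Ω. -/
theorem exists_of_mem_Omega {x : ℂ} (hx : x ∈ Omega c r a) :
    ∃ m n : ℤ, x = m * omegaOne c r a + n * (I * a) := by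
  refine AddSubgroup.closure_induction (p := fun x _ => ∃ m n : ℤ,
    x = m * omegaOne c r a + n * (I * a)) ?_ ⟨0, 0, by simp⟩ ?_ ?_ hx
  · rintro _ ⟨ν, -, rfl⟩
    rcases ν with _ | _ | _ | ν
    · exact ⟨0, 0, by simp [omega]⟩
    · exact ⟨1, 0, by simp [omega]⟩
    · exact ⟨0, 1, by simp [omega]⟩
    · exact ⟨-1, -1, by simp [omega]; ring⟩
  · rintro _ _ - - ⟨m, n, rfl⟩ ⟨m', n', rfl⟩
    exact ⟨m + m', n + n', by push_cast; ring⟩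
  · rintro _ - ⟨m, n, rfl⟩
    exact ⟨-m, -n, by push_cast; ring⟩

theorem countable_Omega (c : VDCase) (r a : ℝ) : (Omega c r a : Set ℂ).Countable := by
  refine (countable_range fun p : ℤ × ℤ => (p.1 * omegaOne c r a + p.2 * (I * a) : ℂ)).mono ?_
  intro x hx
  obtain ⟨m, n, rfl⟩ := exists_of_mem_Omega hx
  exact ⟨(m, n), rfl⟩

theorem omega_mem_Omega {ν : ℕ} (hν : ν ≤ rho c) : omega c r a ν ∈ Omega c r a :=
  AddSubgroup.subset_closure ⟨ν, hν, rfl⟩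

theorem mem_Omega_of_sFun_eq_zero (hr : 0 < r) (ha : 0 < a) {x : ℂ} (h : sFun c r a x = 0) :
    x ∈ Omega c r a := by
  have hr0 : (r : ℂ) ≠ 0 := by exact_mod_cast hr.ne'
  have ha0 : (a : ℂ) ≠ 0 := by exact_mod_cast ha.ne'
  have hpi : (Real.pi : ℂ) ≠ 0 := by exact_mod_cast Real.pi_ne_zero
  have h1 : 1 ≤ rho c → ∀ m : ℤ, m * omegaOne c r a ∈ Omega c r a := fun hc m => by
    have := (Omega c r a).zsmul_mem (omega_mem_Omega (c := c) hc) m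
    simpa [omega] using this
  cases c with
  | rational =>
    simp only [sFun] at h
    rw [h]
    exact zero_mem _
  | trigonometric =>
    simp only [sFun, mul_eq_zero, one_div, inv_eq_zero, hr0, false_or] at h
    obtain ⟨k, hk⟩ := Complex.sin_eq_zero_iff.1 h
    convert h1 le_rfl k using 1
    simp only [omegaOne]
    field_simp
    linear_combination hk
  | hyperbolic =>
    simp only [sFun, mul_eq_zero, div_eq_zero_iff, ha0, hpi, or_self, false_or] at h
    rw [← mul_left_inj' I_ne_zero, zero_mul, ← Complex.sin_mul_I] at h
    obtain ⟨k, hk⟩ := Complex.sin_eq_zero_iff.1 h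
    convert h1 le_rfl (-k) using 1
    simp only [omegaOne]
    have hx : x * I = k * a := by
      field_simp at hk
      linear_combination hk
    push_cast
    linear_combination -I * hx + x * I_mul_I
  | elliptic =>
    obtain ⟨m, n, rfl⟩ := exists_of_sFun_elliptic_eq_zero hr ha h
    refine add_mem (h1 (by simp [rho]) m) ?_
    have := (Omega .elliptic r a).zsmul_mem (omega_mem_Omega (r := r) (a := a) (c := .elliptic)
      (ν := 2) (by simp [rho])) n
    simpa [omega] using this

/-- The reflection of `s` in the half periods. -/
theorem sFun_half_period (hr : 0 < r) (ha : 0 < a) {ν : ℕ} (hν : ν ≤ rho c) :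
    ∃ τ : ℂ, τ ^ 2 = 1 ∧ ∀ y, sFun c r a (omega c r a ν / 2 + y)
      = τ * exp (2 * I * r * xi ν * y) * sFun c r a (omega c r a ν / 2 - y) := by
  have hr0 : (r : ℂ) ≠ 0 := by exact_mod_cast hr.ne'
  have ha0 : (a : ℂ) ≠ 0 := by exact_mod_cast ha.ne'
  have hpi : (Real.pi : ℂ) ≠ 0 := by exact_mod_cast Real.pi_ne_zero
  -- τ = -1 for ν = 0 and τ = 1 otherwise. Later τ occurs in pairs or needs only to be nonzero, so
  -- τ² = 1 suffices.
  rcases ν with _ | ν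
  · exact ⟨-1, by norm_num, fun y => by simp [omega, xi, sFun_neg]⟩
  refine ⟨1, by norm_num, fun y => ?_⟩
  cases c with
  | rational => simp [rho] at hν
  | trigonometric =>
    obtain rfl : ν = 0 := by simpa [rho] using hν
    simp only [sFun, omega, omegaOne, xi]
    rw [show (r : ℂ) * (Real.pi / r / 2 + y) = Real.pi - r * (Real.pi / r / 2 - y) by
      field_simp; ring, sin_pi_sub]
    simp
  | hyperbolic =>
    obtain rfl : ν = 0 := by simpa [rho] using hν
    simp only [sFun, omega, omegaOne, xi]
    rw [show (Real.pi : ℂ) * (I * a / 2 + y) / a = -(Real.pi * (I * a / 2 - y) / a) + Real.pi * I by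
      field_simp; ring, sinh_add, sinh_mul_I, cosh_mul_I]
    simp
  | elliptic =>
    have hre := sFun_elliptic_add_real (a := a) hr
    have him := sFun_elliptic_add_imag hr ha
    simp only [rho] at hν
    obtain rfl | rfl | rfl : ν = 0 ∨ ν = 1 ∨ ν = 2 := by omega
    · simp only [omega, omegaOne, xi]
      rw [show (Real.pi / r / 2 + y : ℂ) = -(Real.pi / r / 2 - y) + Real.pi / r by ring, hre,
        sFun_neg]
      simp
    · simp only [omega, xi]
      rw [show (I * a / 2 + y : ℂ) = -(I * a / 2 - y) + I * a by ring, him, sFun_neg]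
      rw [show (r : ℂ) * a - 2 * I * r * -(I * a / 2 - y) = 2 * I * r * ((-1 : ℝ) : ℂ) * y by
        push_cast
        linear_combination r * a * I_mul_I]
      ring
    -- For ω₃ = -ω₁ - ω₂ the translations by ω₂ and ω₁ are composed.
    · simp only [omega, omegaOne, xi]
      have h1 := him (-(((-(Real.pi / r) - I * a) / 2 - y)) - Real.pi / r - I * a)
      have h2 := hre (-(((-(Real.pi / r) - I * a) / 2 - y)) - Real.pi / r)
      rw [show -(((-(Real.pi / r : ℂ) - I * a) / 2 - y)) - Real.pi / r - I * a + I * a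
        = -(((-(Real.pi / r) - I * a) / 2 - y)) - Real.pi / r by ring] at h1
      rw [show -(((-(Real.pi / r : ℂ) - I * a) / 2 - y)) - Real.pi / r + Real.pi / r
        = -(((-(Real.pi / r) - I * a) / 2 - y)) by ring, h1, sFun_neg,
        show -(((-(Real.pi / r : ℂ) - I * a) / 2 - y)) - Real.pi / r - I * a
          = (-(Real.pi / r) - I * a) / 2 + y by ring] at h2
      have h3 : exp (r * a - 2 * I * r * ((-(Real.pi / r) - I * a) / 2 + y))
          * exp (2 * I * r * y) = -1 := by
        rw [← exp_add, ← exp_pi_mul_I]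
        congr 1
        field_simp
        linear_combination r * a * I_mul_I
      push_cast
      rw [mul_one, one_mul]
      linear_combination exp (2 * I * r * y) * h2 +
        sFun .elliptic r a ((-(Real.pi / r) - I * a) / 2 + y) * h3

/-- Reflection in ω_ν/2 followed by x ↦ -x is translation by ω_ν; multipliers of the form e^{px+q}
are closed under composition and inversion. -/
theorem sFun_quasiPeriodic (hr : 0 < r) (ha : 0 < a) {l : ℂ} (hl : l ∈ Omega c r a) :
    ∃ p q : ℂ, ∀ x, sFun c r a (x + l) = exp (p * x + q) * sFun c r a x := by
  refine AddSubgroup.closure_induction (p := fun l _ => ∃ p q : ℂ,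
    ∀ x, sFun c r a (x + l) = exp (p * x + q) * sFun c r a x) ?_ ⟨0, 0, by simp⟩ ?_ ?_ hl
  · rintro _ ⟨ν, hν, rfl⟩
    obtain ⟨τ, hτ, h⟩ := sFun_half_period hr ha hν
    obtain ⟨t, ht⟩ : ∃ t, exp t = -τ := by
      refine ⟨log (-τ), exp_log ?_⟩
      rintro h0
      rw [neg_eq_zero.1 h0] at hτ
      norm_num at hτ
    refine ⟨2 * I * r * xi ν, 2 * I * r * xi ν * (omega c r a ν / 2) + t, fun x => ?_⟩
    have h1 := h (x + omega c r a ν / 2)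
    rw [show omega c r a ν / 2 + (x + omega c r a ν / 2) = x + omega c r a ν by ring,
      show omega c r a ν / 2 - (x + omega c r a ν / 2) = -x by ring, sFun_neg] at h1
    rw [h1, ← add_assoc, exp_add _ t, ht, mul_add]
    ring
  · rintro l l' - - ⟨p, q, h⟩ ⟨p', q', h'⟩
    refine ⟨p + p', p' * l + q + q', fun x => ?_⟩
    rw [← add_assoc, h', h, ← mul_assoc, ← exp_add]
    congr 2
    ring
  · rintro l - ⟨p, q, h⟩
    refine ⟨-p, p * l - q, fun x => ?_⟩
    have h1 := h (x + -l)
    rw [neg_add_cancel_right] at h1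
    rw [h1, ← mul_assoc, ← exp_add]
    rw [show -p * x + (p * l - q) + (p * (x + -l) + q) = 0 by ring, exp_zero, one_mul]

theorem sFun_eq_zero_iff (hr : 0 < r) (ha : 0 < a) {x : ℂ} :
    sFun c r a x = 0 ↔ x ∈ Omega c r a := by
  refine ⟨mem_Omega_of_sFun_eq_zero hr ha, fun hx => ?_⟩
  obtain ⟨p, q, h⟩ := sFun_quasiPeriodic hr ha hx
  simpa [sFun_zero] using h 0

theorem differentiable_sFun (c : VDCase) (hr : 0 < r) (ha : 0 < a) :
    Differentiable ℂ (sFun c r a) := by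
  cases c with
  | rational => exact differentiable_id
  | trigonometric => unfold sFun; fun_prop
  | hyperbolic => unfold sFun; fun_prop
  | elliptic => exact differentiable_sFun_elliptic hr ha

/-- This difference-of-squares formula is the reason that cases I, II, III need no balancing
condition. -/
theorem sFun_add_mul_sub (hc : c ≠ .elliptic) (x y : ℂ) :
    sFun c r a (x + y) * sFun c r a (x - y) = sFun c r a x ^ 2 - sFun c r a y ^ 2 := by
  cases c with
  | rational => simp only [sFun]; ring
  | trigonometric =>
    simp only [sFun, mul_add, mul_sub, sin_add, sin_sub]
    linear_combination (1 / r) ^ 2 * (sin (r * x) ^ 2 * sin_sq_add_cos_sq (r * y) -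
      sin (r * y) ^ 2 * sin_sq_add_cos_sq (r * x))
  | hyperbolic =>
    simp only [sFun, mul_add, mul_sub, add_div, sub_div, sinh_add, sinh_sub]
    linear_combination (a / Real.pi) ^ 2 * (sinh (Real.pi * x / a) ^ 2 * cosh_sq (Real.pi * y / a) -
      sinh (Real.pi * y / a) ^ 2 * cosh_sq (Real.pi * x / a))
  | elliptic => exact absurd rfl hc

theorem threeTerm_sFun (c : VDCase) (hr : 0 < r) (ha : 0 < a) : ThreeTerm (sFun c r a) := by
  by_cases hc : c = .elliptic
  · subst hc
    refine threeTerm_of_quasiPeriodic (differentiable_sFun _ hr ha) (sFun_neg _ r a)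
      (countable_Omega _ r a) (fun x => mem_Omega_of_sFun_eq_zero hr ha)
      (fun l => sFun_quasiPeriodic hr ha) (deriv_sFun_elliptic_zero_ne hr ha)
      (div_pos Real.pi_pos hr) ha ?_ ?_
    · simpa [omega, omegaOne] using
        omega_mem_Omega (r := r) (a := a) (c := .elliptic) (ν := 1) (by simp [rho])
    · simpa [omega] using
        omega_mem_Omega (r := r) (a := a) (c := .elliptic) (ν := 2) (by simp [rho])
  · exact threeTerm_of_sq_sub_sq (sFun_add_mul_sub hc)

/-- The duplication formula. -/
theorem sFun_two_mul (hr : 0 < r) (ha : 0 < a) (u : ℂ) :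
    sFun c r a (2 * u) * ∏ ν ∈ Finset.Icc 1 (rho c), sFun c r a (omega c r a ν / 2)
      = 2 * (-1) ^ rho c * ∏ ν ∈ Finset.range (rho c + 1), sFun c r a (u - omega c r a ν / 2) := by
  have hr0 : (r : ℂ) ≠ 0 := by exact_mod_cast hr.ne'
  have ha0 : (a : ℂ) ≠ 0 := by exact_mod_cast ha.ne'
  have hpi : (Real.pi : ℂ) ≠ 0 := by exact_mod_cast Real.pi_ne_zero
  cases c with
  | rational => simp [sFun, rho, omega]
  | trigonometric =>
    simp only [rho, Finset.Icc_self, Finset.prod_singleton, Finset.prod_range_succ,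
      Finset.prod_range_zero, omega, omegaOne, sFun]
    rw [show (r : ℂ) * (Real.pi / r / 2) = Real.pi / 2 by field_simp,
      show (r : ℂ) * (u - Real.pi / r / 2) = r * u - Real.pi / 2 by field_simp,
      show (r : ℂ) * (2 * u) = 2 * (r * u) by ring, sin_pi_div_two, sin_sub_pi_div_two,
      sin_two_mul]
    simp
    ring
  | hyperbolic =>
    simp only [rho, Finset.Icc_self, Finset.prod_singleton, Finset.prod_range_succ,
      Finset.prod_range_zero, omega, omegaOne, sFun]
    rw [show (Real.pi : ℂ) * (I * a / 2) / a = Real.pi / 2 * I by field_simp,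
      show (Real.pi : ℂ) * (u - I * a / 2) / a = Real.pi * u / a - Real.pi / 2 * I by field_simp,
      show (Real.pi : ℂ) * (2 * u) / a = 2 * (Real.pi * u / a) by ring, sinh_sub, sinh_mul_I,
      cosh_mul_I, sinh_two_mul, sin_pi_div_two, cos_pi_div_two]
    simp
    ring
  | elliptic =>
    -- The constant is found by comparing derivatives at u = 0, where s has a simple zero: 2 = C ∏
    -- s(half periods), with signs.
    obtain ⟨C, hC⟩ := exists_sFun_elliptic_two_mul hr ha
    have hs := differentiable_sFun .elliptic hr ha
    set s := sFun .elliptic r a with hsdef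
    have hs0 : s 0 = 0 := sFun_zero _ _ _
    have hC2 : ∀ u, s (2 * u) = s u * (C * (s (u - Real.pi / r / 2) * s (u - I * a / 2) *
        s (u + Real.pi / r / 2 + I * a / 2))) := fun u => by rw [hC]; ring
    have h1 : HasDerivAt (fun u => s (2 * u)) (2 * deriv s 0) 0 := by
      have := ((hs (2 * 0)).hasDerivAt).comp (0 : ℂ) ((hasDerivAt_id (0 : ℂ)).const_mul 2)
      simpa [Function.comp_def, mul_comm] using this
    have h2 := HasDerivAt.fun_mul (hs 0).hasDerivAt (DifferentiableAt.hasDerivAt (f := fun u =>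
      C * (s (u - Real.pi / r / 2) * s (u - I * a / 2) *
        s (u + Real.pi / r / 2 + I * a / 2))) (by fun_prop) (x := 0))
    rw [(funext hC2 : (fun u => s (2 * u)) = _)] at h1
    have h3 := h1.unique h2
    rw [hs0, zero_mul, add_zero, mul_comm 2] at h3
    have h4 := mul_left_cancel₀ (deriv_sFun_elliptic_zero_ne hr ha) h3
    rw [show (0 : ℂ) - Real.pi / r / 2 = -(Real.pi / r / 2) by ring,
      show (0 : ℂ) - I * a / 2 = -(I * a / 2) by ring,
      show (0 : ℂ) + Real.pi / r / 2 + I * a / 2 = -((-(Real.pi / r) - I * a) / 2) by ring] at h4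
    simp only [hsdef, sFun_neg] at h4
    rw [show Finset.Icc 1 (rho .elliptic) = {1, 2, 3} by decide]
    simp only [rho, Finset.prod_range_succ, Finset.prod_range_zero, omega, omegaOne]
    rw [Finset.prod_insert (by decide), Finset.prod_insert (by decide), Finset.prod_singleton]
    rw [← hsdef] at h4
    rw [hC, show u - (-(Real.pi / r : ℂ) - I * a) / 2 = u + Real.pi / r / 2 + I * a / 2 by ring,
      zero_div, sub_zero]
    linear_combination (s u * s (u - Real.pi / r / 2) * s (u - I * a / 2) *
        s (u + Real.pi / r / 2 + I * a / 2)) * h4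

/-- Otherwise half the difference of two periods would lie in the lattice; comparing real and
imaginary parts makes an odd integer even. -/
theorem sFun_half_period_sub_ne_zero (hr : 0 < r) (ha : 0 < a) {ν μ : ℕ} (hν : ν ≤ rho c)
    (hμ : μ ≤ rho c) (hne : ν ≠ μ) : sFun c r a ((omega c r a ν - omega c r a μ) / 2) ≠ 0 := by
  intro h
  obtain ⟨m, n, hmn⟩ := exists_of_mem_Omega (mem_Omega_of_sFun_eq_zero hr ha h)
  have hπr : Real.pi / r ≠ 0 := (div_pos Real.pi_pos hr).ne'
  have key1 : ∀ k l : ℤ, (k : ℝ) * (Real.pi / r) = l * (Real.pi / r) → k = l := fun k l h => by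
    exact_mod_cast mul_right_cancel₀ hπr h
  have key2 : ∀ k l : ℤ, (k : ℝ) * a = l * a → k = l := fun k l h => by
    exact_mod_cast mul_right_cancel₀ ha.ne' h
  have hcast : (Real.pi / r : ℂ) = ((Real.pi / r : ℝ) : ℂ) := by push_cast; rfl
  have hre := congrArg Complex.re hmn
  have him := congrArg Complex.im hmn
  cases c <;> simp only [rho] at hν hμ <;> interval_cases ν <;> interval_cases μ <;>
    first
    | exact absurd rfl hne
    | (simp [omega, omegaOne, hcast, -ofReal_div] at hre him
       first
       | (have := key1 (2 * m) 1 (by push_cast; linarith)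
          omega)
       | (have := key1 (2 * m) (-1) (by push_cast; linarith)
          omega)
       | (have := key1 (2 * m) 2 (by push_cast; linarith)
          have := key2 (2 * n) 1 (by push_cast; linarith)
          omega)
       | (have := key2 (2 * n) 1 (by push_cast; linarith)
          omega)
       | (have := key2 (2 * n) (-1) (by push_cast; linarith)
          omega)
       | (have := key2 (2 * (m + n)) 1 (by push_cast; linarith)
          omega)
       | (have := key2 (2 * (m + n)) (-1) (by push_cast; linarith)
          omega))

theorem xi_eq_zero (hc : c ≠ .elliptic) {ν : ℕ} (hν : ν ≤ rho c) : xi ν = 0 := by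
  cases c
  · obtain rfl : ν = 0 := by simpa [rho] using hν
    rfl
  · obtain rfl | rfl : ν = 0 ∨ ν = 1 := by simp only [rho] at hν; omega
    · rfl
    · rfl
  · obtain rfl | rfl : ν = 0 ∨ ν = 1 := by simp only [rho] at hν; omega
    · rfl
    · rfl
  · exact absurd rfl hc

variable {N M : ℕ}

/-! ### Sums and products over signs -/

section Signs

theorem sgn_one : sgn 1 = 1 := by simp [sgn]

theorem sgn_neg (ε : ℤˣ) : sgn (-ε) = -sgn ε := by simp [sgn]

theorem sgn_mul_self (ε : ℤˣ) : sgn ε * sgn ε = 1 := by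
  rcases Int.units_eq_one_or ε with rfl | rfl <;> simp [sgn]

theorem prod_units {R : Type*} [CommMonoid R] (f : ℤˣ → R) : ∏ δ, f δ = f 1 * f (-1) := by
  rw [UnitsInt.univ, Finset.prod_pair (by decide)]

theorem sum_units {R : Type*} [AddCommMonoid R] (f : ℤˣ → R) : ∑ δ, f δ = f 1 + f (-1) := by
  rw [UnitsInt.univ, Finset.sum_pair (by decide)]

theorem prod_units_neg {R : Type*} [CommMonoid R] (f : ℤˣ → R) : ∏ δ, f (-δ) = ∏ δ, f δ := by
  rw [prod_units, prod_units, neg_neg, mul_comm]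

theorem sFun_sgn_mul_ne_zero (ε : ℤˣ) {x : ℂ} :
    sFun c r a (sgn ε * x) ≠ 0 ↔ sFun c r a x ≠ 0 := by
  rcases Int.units_eq_one_or ε with rfl | rfl <;> simp [sgn, sFun_neg]

theorem sFun_sub_comm (x y : ℂ) : sFun c r a (x - y) = -sFun c r a (y - x) := by
  rw [← sFun_neg, neg_sub]

end Signs

/-! ### Duality between x and x̃; nonvanishing factors -/

section Symmetry

variable {g : Fin (2 * rho c + 2) → ℝ} {lam β : ℝ}

/-- The parameters of the dual family of variables. -/
noncomputable def dualParam (lam : ℝ) {n : ℕ} (g : Fin n → ℝ) : Fin n → ℝ :=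
  fun ν => (lam + 1 - 2 * g ν) / (2 * lam)

theorem dualParam_dualParam (hlam : lam ≠ 0) {n : ℕ} (g : Fin n → ℝ) :
    dualParam (1 / lam) (dualParam lam g) = g := by
  funext ν
  simp only [dualParam]
  field_simp
  ring

theorem prod_neg_even {ι : Type*} [Fintype ι] (h : Even (Fintype.card ι)) (f : ι → ℂ) :
    ∏ i, -f i = ∏ i, f i := by
  rw [Finset.prod_neg, Finset.card_univ, h.neg_one_pow, one_mul]

/-- Duality turns iβ into iλβ, while the coefficients for x̃ shift in the opposite direction, whence
the sign -ε. The signs from the oddness of s cancel, since the number 2ρ + 2 of parameters g_ν is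
even. -/
theorem coeffVt_eq_coeffV (hlam : lam ≠ 0) (ε : ℤˣ) (k : Fin M) (p : Pt N M) :
    coeffVt c r a g lam β ε k p
      = coeffV c r a (dualParam lam g) (1 / lam) (lam * β) (-ε) k p.swap := by
  have hl : (lam : ℂ) ≠ 0 := by exact_mod_cast hlam
  unfold coeffVt coeffV
  simp only [Prod.fst_swap, Prod.snd_swap, sgn_neg, dualParam]
  push_cast
  congr 1
  · congr 1
    · rw [← prod_neg_even (by simp; exact ⟨rho c + 1, by ring⟩)]
      refine Finset.prod_congr rfl fun ν _ => ?_
      rw [← sFun_neg]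
      congr 1
      field_simp
      ring
    · rw [← neg_mul_neg, ← sFun_neg, ← sFun_neg]
      congr 2
      · ring
      · ring
  · refine Finset.prod_congr rfl fun δ _ => ?_
    congr 1
    · refine Finset.prod_congr rfl fun k' _ => ?_
      congr 2
      field_simp
      ring
    · refine Finset.prod_congr rfl fun j _ => ?_
      congr 2 <;>
      · field_simp
        ring

/-- The two factors Ψ_N² and Ψ_Ñ² change places because the duality is an involution. The mixed
product is symmetric since (1/λ - 1)λβ = -(λ - 1)β and s is odd. -/
theorem deformedGroundStateSq_swap (G : ℂ → ℂ → ℂ) (hlam : lam ≠ 0) (p : Pt N M) :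
    deformedGroundStateSq c r a G g lam β p
      = deformedGroundStateSq c r a G (dualParam lam g) (1 / lam) (lam * β) p.swap := by
  have hl : (lam : ℂ) ≠ 0 := by exact_mod_cast hlam
  unfold deformedGroundStateSq
  have h1 : (fun ν => (1 / lam + 1 - 2 * dualParam lam g ν) / (2 * (1 / lam))) = g :=
    dualParam_dualParam hlam g
  have h2 : 1 / lam * (lam * β) = β := by field_simp
  simp only [h1, h2, one_div_one_div, Prod.fst_swap, Prod.snd_swap]
  rw [mul_comm (groundStateSq c G g lam β p.1)]
  congr 1
  have h3 : ∀ x : ℂ, x * (((1 / lam : ℝ) : ℂ) - 1) * ((lam * β : ℝ) : ℂ) / 2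
      = -(x * (lam - 1) * β / 2) := by
    intro x
    push_cast
    field_simp
    ring
  simp only [prod_units, sgn_neg, sgn_one, h3, ← Finset.prod_mul_distrib]
  rw [Finset.prod_comm]
  refine Finset.prod_congr rfl fun k _ => Finset.prod_congr rfl fun j _ => ?_
  simp only [neg_mul, one_mul, ← sub_eq_add_neg, sub_neg_eq_add]
  rw [show p.1 j - p.2 k + I * (lam - 1) * β / 2 = -(p.2 k - p.1 j - I * (lam - 1) * β / 2) by ring,
    show p.1 j - p.2 k - I * (lam - 1) * β / 2 = -(p.2 k - p.1 j + I * (lam - 1) * β / 2) by ring,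
    sFun_neg, sFun_neg, add_comm (p.1 j)]
  ring

/-- The `s`-factors of the coefficient `V_j^ε`. -/
structure VFactors (c : VDCase) (r a : ℝ) (g : Fin (2 * rho c + 2) → ℝ) (lam β : ℝ) (ε : ℤˣ)
    (j : Fin N) (p : Pt N M) : Prop where
  num : ∀ ν, sFun c r a (sgn ε * p.1 j - I * g ν * β) ≠ 0
  two : sFun c r a (sgn ε * (2 * p.1 j)) ≠ 0
  two_sub : sFun c r a (sgn ε * (2 * p.1 j) - I * β) ≠ 0
  pair_num : ∀ δ : ℤˣ, ∀ j', j' ≠ j →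
    sFun c r a (p.1 j + sgn δ * p.1 j' - sgn ε * (I * lam * β)) ≠ 0
  pair_den : ∀ δ : ℤˣ, ∀ j', j' ≠ j → sFun c r a (p.1 j + sgn δ * p.1 j') ≠ 0
  mixed_num : ∀ (δ : ℤˣ) (k : Fin M),
    sFun c r a (p.1 j + sgn δ * p.2 k - sgn ε * (I * (lam - 1) * β / 2)) ≠ 0
  mixed_den : ∀ (δ : ℤˣ) (k : Fin M),
    sFun c r a (p.1 j + sgn δ * p.2 k - sgn ε * (I * (lam + 1) * β / 2)) ≠ 0

/-- Division by zero gives 0, so a nonzero coefficient has nonzero denominators as well as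
numerators. -/
theorem vFactors_of_coeffV_ne_zero {ε : ℤˣ} {j : Fin N} {p : Pt N M}
    (h : coeffV c r a g lam β ε j p ≠ 0) : VFactors c r a g lam β ε j p := by
  simp only [coeffV, ne_eq, mul_eq_zero, div_eq_zero_iff, Finset.prod_eq_zero_iff,
    Finset.mem_univ, true_and, Finset.mem_erase, and_true, not_or, not_exists, not_and] at h
  obtain ⟨⟨h1, h2, h3⟩, h4⟩ := h
  exact ⟨h1, h2, h3, fun δ j' hj => ((h4 δ).1 j' hj).1, fun δ j' hj => ((h4 δ).1 j' hj).2,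
    fun δ k => ((h4 δ).2 k).1, fun δ k => ((h4 δ).2 k).2⟩

theorem VFactors.continuousAt (hr : 0 < r) (ha : 0 < a) {ε : ℤˣ} {j : Fin N} {p : Pt N M}
    (h : VFactors c r a g lam β ε j p) : ContinuousAt (coeffV c r a g lam β ε j) p := by
  have hs := (differentiable_sFun c hr ha).continuous
  unfold coeffV
  refine ContinuousAt.mul (ContinuousAt.div (by fun_prop) (by fun_prop)
    (mul_ne_zero h.two h.two_sub)) ?_
  refine tendsto_finsetProd _ fun δ _ => ContinuousAt.mul ?_ ?_
  · exact tendsto_finsetProd _ fun j' hj => ContinuousAt.div (by fun_prop) (by fun_prop)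
      (h.pair_den δ j' (Finset.ne_of_mem_erase hj))
  · exact tendsto_finsetProd _ fun k _ => ContinuousAt.div (by fun_prop) (by fun_prop)
      (h.mixed_den δ k)

end Symmetry

/-! ### Products with one index removed -/

section FinsetErase

theorem prod_erase_inl {ι κ R : Type*} [Fintype ι] [Fintype κ] [DecidableEq ι] [DecidableEq κ]
    [CommMonoid R] (f : ι ⊕ κ → R) (i : ι) :
    ∏ x ∈ Finset.univ.erase (Sum.inl i), f x
      = (∏ x ∈ Finset.univ.erase i, f (Sum.inl x)) * ∏ x, f (Sum.inr x) := by
  rw [← Finset.prod_disjSum]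
  refine Finset.prod_congr ?_ fun _ _ => rfl
  ext (x | x) <;> simp

theorem prod_erase_inr {ι κ R : Type*} [Fintype ι] [Fintype κ] [DecidableEq ι] [DecidableEq κ]
    [CommMonoid R] (f : ι ⊕ κ → R) (i : κ) :
    ∏ x ∈ Finset.univ.erase (Sum.inr i), f x
      = (∏ x, f (Sum.inl x)) * ∏ x ∈ Finset.univ.erase i, f (Sum.inr x) := by
  rw [← Finset.prod_disjSum]
  refine Finset.prod_congr ?_ fun _ _ => rfl
  ext (x | x) <;> simp

theorem prod_erase_units {ι R : Type*} [Fintype ι] [DecidableEq ι] [CommMonoid R]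
    (f : ι × ℤˣ → R) (i : ι) (ε : ℤˣ) :
    ∏ x ∈ Finset.univ.erase (i, ε), f x
      = (∏ j ∈ Finset.univ.erase i, ∏ δ : ℤˣ, f (j, δ)) * f (i, -ε) := by
  have hne : ε ≠ -ε := by
    rcases Int.units_eq_one_or ε with rfl | rfl <;> decide
  have : (Finset.univ.erase (i, ε) : Finset (ι × ℤˣ))
      = insert (i, -ε) (Finset.univ.erase i ×ˢ Finset.univ) := by
    ext ⟨j, δ⟩
    simp only [Finset.mem_erase, ne_eq, Prod.mk.injEq, not_and, Finset.mem_univ, and_true,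
      Finset.mem_insert, Finset.mem_product]
    by_cases hj : j = i
    · have := Int.units_ne_iff_eq_neg (u := δ) (v := ε)
      simp [hj, ← this]
    · simp [hj]
  rw [this, Finset.prod_insert (by simp), Finset.prod_product, mul_comm]

theorem prod_mul_prod_comm {α ι κ R : Type*} [Fintype α] [CommMonoid R] (S : Finset ι)
    (T : Finset κ) (f : α → ι → R) (h : α → κ → R) :
    ∏ x, ((∏ i ∈ S, f x i) * ∏ i ∈ T, h x i)
      = (∏ i ∈ S, ∏ x, f x i) * ∏ i ∈ T, ∏ x, h x i := by
  rw [Finset.prod_mul_distrib, Finset.prod_comm, Finset.prod_comm (t := T)]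

theorem prod_range_erase {R : Type*} [CommMonoid R] {n : ℕ} (f : ℕ → R) (i : Fin n) :
    ∏ x ∈ (Finset.range n).erase i, f x = ∏ x ∈ Finset.univ.erase i, f (x : ℕ) := by
  refine Finset.prod_bij' (fun x hx => ⟨x, Finset.mem_range.1 (Finset.mem_of_mem_erase hx)⟩)
    (fun x _ => (x : ℕ)) ?_ ?_ ?_ ?_ ?_
  · intro x hx
    simpa [Fin.ext_iff] using (Finset.ne_of_mem_erase hx)
  · intro x hx
    simpa [Fin.ext_iff] using hx
  · intros; rfl
  · intros; rfl
  · intros; rfl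

end FinsetErase

/-! ### Poles, zeros and residues -/

variable {g : Fin (2 * rho c + 2) → ℝ} {lam β : ℝ}

/-- For ε = 1 the two values of δ change places; for ε = -1 every argument changes sign, which
cancels in each quotient. -/
theorem prod_sign_div (ε : ℤˣ) (X x' A B : ℂ) :
    ∏ δ : ℤˣ, sFun c r a (sgn ε * X - (sgn δ * x' + A)) / sFun c r a (sgn ε * X - (sgn δ * x' + B))
      = ∏ δ : ℤˣ, sFun c r a (X + sgn δ * x' - sgn ε * A) /
          sFun c r a (X + sgn δ * x' - sgn ε * B) := by
  simp only [prod_units, sgn_one, sgn_neg]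
  rcases Int.units_eq_one_or ε with rfl | rfl
  · simp only [sgn_one, one_mul, neg_mul]
    rw [mul_comm]
    congr 3 <;> ring
  · simp only [sgn_one, sgn_neg, one_mul, neg_mul]
    have h : ∀ Y, -X - (x' + Y) = -(X + x' - -Y) := fun Y => by ring
    have h' : ∀ Y, -X - (-x' + Y) = -(X + -x' - -Y) := fun Y => by ring
    simp only [h, h', sFun_neg, neg_div_neg_eq]

theorem halfPeriodProd_ne_zero (hr : 0 < r) (ha : 0 < a) :
    ∏ ν ∈ Finset.Icc 1 (rho c), sFun c r a (omega c r a ν / 2) ≠ 0 := by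
  refine Finset.prod_ne_zero_iff.2 fun ν hν => ?_
  obtain ⟨h1, h2⟩ := Finset.mem_Icc.1 hν
  have := sFun_half_period_sub_ne_zero hr ha h2 (Nat.zero_le (rho c)) (by omega)
  simpa [omega] using this

theorem prod_sub_half_period (hr : 0 < r) (ha : 0 < a) (u h : ℂ) :
    2 * (-1) ^ rho c * ∏ ν : Fin (rho c + 1), sFun c r a (u - (omega c r a ν / 2 + h))
      = sFun c r a (2 * (u - h)) *
        ∏ ν ∈ Finset.Icc 1 (rho c), sFun c r a (omega c r a ν / 2) := by
  rw [sFun_two_mul hr ha, Finset.prod_range]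
  congr 1
  refine Finset.prod_congr rfl fun ν _ => ?_
  congr 1
  ring

/-- This explains the constant P: by the duplication formula it turns the two families of
half-period poles into the factors s(2(u - h)) s(2(u - h')). -/
theorem prefactor_div (hr : 0 < r) (ha : 0 < a) (u h h' : ℂ) :
    prefactor c r a / ((∏ ν : Fin (rho c + 1), sFun c r a (u - (omega c r a ν / 2 + h))) *
        ∏ ν : Fin (rho c + 1), sFun c r a (u - (omega c r a ν / 2 + h')))
      = 1 / (sFun c r a (2 * (u - h)) * sFun c r a (2 * (u - h'))) := by
  have h1 := prod_sub_half_period (c := c) hr ha u h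
  have h2 := prod_sub_half_period (c := c) hr ha u h'
  have h0 := halfPeriodProd_ne_zero (c := c) hr ha
  unfold prefactor
  set Q := ∏ ν ∈ Finset.Icc 1 (rho c), sFun c r a (omega c r a ν / 2)
  set D := ∏ ν : Fin (rho c + 1), sFun c r a (u - (omega c r a ν / 2 + h))
  set D' := ∏ ν : Fin (rho c + 1), sFun c r a (u - (omega c r a ν / 2 + h'))
  have e : ((-1 : ℂ) ^ rho c) * (-1) ^ rho c = 1 := by
    rw [← mul_pow]; simp
  have h3 : 4 * (D * D') = sFun c r a (2 * (u - h)) * sFun c r a (2 * (u - h')) * Q ^ 2 := by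
    linear_combination (-4 * D * D') * e + (2 * (-1) ^ rho c * D') * h1 +
      (sFun c r a (2 * (u - h)) * Q) * h2
  rw [div_div, h3, one_div, mul_comm, div_mul_cancel_left₀ (pow_ne_zero 2 h0)]

theorem sFun_sub_half_period_ne_zero (hr : 0 < r) (ha : 0 < a) {u h : ℂ}
    (hne : sFun c r a (2 * (u - h)) ≠ 0) (ν : Fin (rho c + 1)) :
    sFun c r a (u - (omega c r a ν / 2 + h)) ≠ 0 := by
  have h1 := mul_ne_zero hne (halfPeriodProd_ne_zero (c := c) hr ha)
  rw [← prod_sub_half_period hr ha] at h1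
  exact Finset.prod_ne_zero_iff.1 (right_ne_zero_of_mul h1) ν (Finset.mem_univ ν)

/-- The index set of the poles. -/
abbrev PoleIndex (c : VDCase) (N M : ℕ) :=
  (Fin N × ℤˣ) ⊕ ((Fin M × ℤˣ) ⊕ (Fin (rho c + 1) ⊕ Fin (rho c + 1)))

/-- The poles. -/
noncomputable def pole (c : VDCase) (r a lam β : ℝ) (p : Pt N M) : PoleIndex c N M → ℂ :=
  Sum.elim (fun i => sgn i.2 * p.1 i.1) <|
    Sum.elim (fun i => sgn i.2 * p.2 i.1 + I * (lam + 1) * β / 2) <|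
      Sum.elim (fun ν => omega c r a ν / 2 + I * β / 2)
        (fun ν => omega c r a ν / 2 + I * lam * β / 2)

/-- The zeros. -/
noncomputable def zeros (c : VDCase) (g : Fin (2 * rho c + 2) → ℝ) (lam β : ℝ) (p : Pt N M) :
    Multiset ℂ :=
  (Finset.univ.val.map fun i : Fin N × ℤˣ => sgn i.2 * p.1 i.1 + I * lam * β) +
    (Finset.univ.val.map (fun i : Fin M × ℤˣ => sgn i.2 * p.2 i.1 + I * (lam - 1) * β / 2) +
      Finset.univ.val.map fun ν => I * g ν * β)

theorem zeroProd_zeros (p : Pt N M) (u : ℂ) :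
    zeroProd (sFun c r a) (zeros c g lam β p) u =
      (∏ j, ∏ δ : ℤˣ, sFun c r a (u - (sgn δ * p.1 j + I * lam * β))) *
        ((∏ k, ∏ δ : ℤˣ, sFun c r a (u - (sgn δ * p.2 k + I * (lam - 1) * β / 2))) *
          ∏ ν, sFun c r a (u - I * g ν * β)) := by
  simp only [zeroProd, zeros, Multiset.map_add, Multiset.map_map, Multiset.prod_add,
    Function.comp_def, Finset.prod_map_val, ← Fintype.prod_prod_type']

/-- The residues of the product with the given zeros and poles. -/
noncomputable def residue (c : VDCase) (r a : ℝ) (g : Fin (2 * rho c + 2) → ℝ) (lam β : ℝ)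
    (p : Pt N M) (i : PoleIndex c N M) : ℂ :=
  zeroProd (sFun c r a) (zeros c g lam β p) (pole c r a lam β p i) /
    ∏ i' ∈ Finset.univ.erase i, sFun c r a (pole c r a lam β p i - pole c r a lam β p i')

/-- S is the factor s(±2x_j - iλβ), or s(±2x̃_k + iβ), which occurs in a residue but not in the
coefficient. It is the only factor that has to be cancelled. -/
theorem residue_algebra {P D D' T S : ℂ} (h : P / (D * D') = 1 / (T * S)) (hS : S ≠ 0)
    (L A A' B B' C W : ℂ) : P * (-L * S * A * (B * C) / (A' * W * (B' * (D * D'))))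
      = -(L * (C / (W * T) * (A / A' * (B / B')))) := by
  have h1 : P * (-L * S * A * (B * C) / (A' * W * (B' * (D * D'))))
      = P / (D * D') * S * (-L * A * (B * C) / (A' * W * B')) := by
    simp only [div_eq_mul_inv, mul_inv]
    ring
  rw [h1, h, one_div, mul_inv, inv_mul_cancel_right₀ hS]
  simp only [div_eq_mul_inv, mul_inv]
  ring

/-- The zero belonging to the reflected point -εx_j cancels the half-period poles with shift iλβ/2;
the others give s(2εx_j - iβ). The nonvanishing assumption is not part of genericity and is removed
in `sourceSum_eq`. -/
theorem prefactor_mul_residue_x (hr : 0 < r) (ha : 0 < a) (p : Pt N M) (j : Fin N) (ε : ℤˣ)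
    (h1 : sFun c r a (sgn ε * (2 * p.1 j) - I * lam * β) ≠ 0) :
    prefactor c r a * residue c r a g lam β p (Sum.inl (j, ε))
      = -(sFun c r a (I * lam * β) * coeffV c r a g lam β ε j p) := by
  set u := sgn ε * p.1 j with hu
  have key := prefactor_div (c := c) hr ha u (I * β / 2) (I * lam * β / 2)
  rw [show 2 * (u - I * β / 2) = sgn ε * (2 * p.1 j) - I * β by rw [hu]; ring,
    show 2 * (u - I * lam * β / 2) = sgn ε * (2 * p.1 j) - I * lam * β by rw [hu]; ring] at key
  have hx : ∀ j', ∏ δ : ℤˣ, sFun c r a (p.1 j + sgn δ * p.1 j' - sgn ε * (I * lam * β)) /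
      sFun c r a (p.1 j + sgn δ * p.1 j')
      = (∏ δ : ℤˣ, sFun c r a (u - (sgn δ * p.1 j' + I * lam * β))) /
        ∏ δ : ℤˣ, sFun c r a (u - sgn δ * p.1 j') := by
    intro j'
    have := prod_sign_div (c := c) (r := r) (a := a) ε (p.1 j) (p.1 j') (I * lam * β) 0
    simp only [add_zero, mul_zero, sub_zero] at this
    rw [← this, Finset.prod_div_distrib]
  have hy : ∀ k, ∏ δ : ℤˣ, sFun c r a (p.1 j + sgn δ * p.2 k - sgn ε * (I * (lam - 1) * β / 2)) /
      sFun c r a (p.1 j + sgn δ * p.2 k - sgn ε * (I * (lam + 1) * β / 2))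
      = (∏ δ : ℤˣ, sFun c r a (u - (sgn δ * p.2 k + I * (lam - 1) * β / 2))) /
        ∏ δ : ℤˣ, sFun c r a (u - (sgn δ * p.2 k + I * (lam + 1) * β / 2)) := by
    intro k
    rw [← prod_sign_div, Finset.prod_div_distrib]
  -- The zeros of the own particle: δ = ε gives s(-iλβ), and δ = -ε gives s(2εx_j - iλβ).
  have hown : ∏ δ : ℤˣ, sFun c r a (u - (sgn δ * p.1 j + I * lam * β))
      = -sFun c r a (I * lam * β) * sFun c r a (sgn ε * (2 * p.1 j) - I * lam * β) := by
    rw [prod_units, ← sFun_neg, hu]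
    rcases Int.units_eq_one_or ε with rfl | rfl <;> simp only [sgn_one, sgn_neg]
    · congr 2 <;> ring
    · rw [mul_comm]
      congr 2 <;> ring
  have hown' : u - sgn (-ε) * p.1 j = sgn ε * (2 * p.1 j) := by rw [sgn_neg, hu]; ring
  unfold residue coeffV
  rw [prod_erase_inl, prod_erase_units, Fintype.prod_sum_type, Fintype.prod_sum_type,
    zeroProd_zeros, Fintype.prod_prod_type]
  simp only [pole, Sum.elim_inl, Sum.elim_inr, ← hu, hown']
  rw [← Finset.mul_prod_erase Finset.univ (fun j' => ∏ δ : ℤˣ,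
    sFun c r a (u - (sgn δ * p.1 j' + I * lam * β))) (Finset.mem_univ j), hown]
  rw [prod_mul_prod_comm]
  simp only [hx, hy, Finset.prod_div_distrib]
  generalize (∏ ν : Fin (rho c + 1), sFun c r a (u - (omega c r a ν / 2 + I * β / 2))) = D at key ⊢
  generalize (∏ ν : Fin (rho c + 1), sFun c r a (u - (omega c r a ν / 2 + I * lam * β / 2))) = D'
    at key ⊢
  generalize sFun c r a (sgn ε * (2 * p.1 j) - I * lam * β) = S at h1 key ⊢
  exact residue_algebra key h1 _ _ _ _ _ _ _

/-- As for x_j, but the own zeros give +s(iβ), so the sign is opposite. -/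
theorem prefactor_mul_residue_y (hr : 0 < r) (ha : 0 < a) (p : Pt N M) (k : Fin M) (ε : ℤˣ)
    (h1 : sFun c r a (sgn ε * (2 * p.2 k) + I * β) ≠ 0) :
    prefactor c r a * residue c r a g lam β p (Sum.inr (Sum.inl (k, ε)))
      = sFun c r a (I * β) * coeffVt c r a g lam β ε k p := by
  set u := sgn ε * p.2 k + I * (lam + 1) * β / 2 with hu
  have key := prefactor_div (c := c) hr ha u (I * β / 2) (I * lam * β / 2)
  rw [show 2 * (u - I * β / 2) = sgn ε * (2 * p.2 k) + I * lam * β by rw [hu]; ring,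
    show 2 * (u - I * lam * β / 2) = sgn ε * (2 * p.2 k) + I * β by rw [hu]; ring] at key
  have hy : ∀ k', ∏ δ : ℤˣ, sFun c r a (p.2 k + sgn δ * p.2 k' + sgn ε * (I * β)) /
      sFun c r a (p.2 k + sgn δ * p.2 k')
      = (∏ δ : ℤˣ, sFun c r a (u - (sgn δ * p.2 k' + I * (lam - 1) * β / 2))) /
        ∏ δ : ℤˣ, sFun c r a (u - (sgn δ * p.2 k' + I * (lam + 1) * β / 2)) := by
    intro k'
    have := prod_sign_div (c := c) (r := r) (a := a) ε (p.2 k) (p.2 k') (-(I * β)) 0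
    simp only [add_zero, mul_zero, sub_zero, mul_neg, sub_neg_eq_add] at this
    rw [← this, Finset.prod_div_distrib]
    congr 1 <;> refine Finset.prod_congr rfl fun δ _ => ?_ <;> rw [hu] <;> congr 1 <;> ring
  have hx : ∀ j, ∏ δ : ℤˣ, sFun c r a (p.2 k + sgn δ * p.1 j - sgn ε * (I * (lam - 1) * β / 2)) /
      sFun c r a (p.2 k + sgn δ * p.1 j + sgn ε * (I * (lam + 1) * β / 2))
      = (∏ δ : ℤˣ, sFun c r a (u - (sgn δ * p.1 j + I * lam * β))) /
        ∏ δ : ℤˣ, sFun c r a (u - sgn δ * p.1 j) := by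
    intro j
    have := prod_sign_div (c := c) (r := r) (a := a) ε (p.2 k) (p.1 j) (I * (lam - 1) * β / 2)
      (-(I * (lam + 1) * β / 2))
    simp only [mul_neg, sub_neg_eq_add] at this
    rw [← this, Finset.prod_div_distrib]
    congr 1 <;> refine Finset.prod_congr rfl fun δ _ => ?_ <;> rw [hu] <;> congr 1 <;> ring
  have hown : ∏ δ : ℤˣ, sFun c r a (u - (sgn δ * p.2 k + I * (lam - 1) * β / 2))
      = sFun c r a (I * β) * sFun c r a (sgn ε * (2 * p.2 k) + I * β) := by
    rw [prod_units, hu]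
    rcases Int.units_eq_one_or ε with rfl | rfl <;> simp only [sgn_one, sgn_neg]
    · congr 2 <;> ring
    · rw [mul_comm]
      congr 2 <;> ring
  have hown' : u - (sgn (-ε) * p.2 k + I * (lam + 1) * β / 2) = sgn ε * (2 * p.2 k) := by
    rw [sgn_neg, hu]; ring
  have hg : ∀ ν, sgn ε * p.2 k + I * ((lam + 1) / 2 - g ν) * β = u - I * g ν * β := fun ν => by
    rw [hu]; ring
  unfold residue coeffVt
  rw [prod_erase_inr, prod_erase_inl, prod_erase_units, Fintype.prod_sum_type,
    zeroProd_zeros, Fintype.prod_prod_type]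
  simp only [pole, Sum.elim_inl, Sum.elim_inr, ← hu, hown', hg]
  rw [← Finset.mul_prod_erase Finset.univ (fun k' => ∏ δ : ℤˣ,
    sFun c r a (u - (sgn δ * p.2 k' + I * (lam - 1) * β / 2))) (Finset.mem_univ k), hown]
  rw [prod_mul_prod_comm]
  simp only [hx, hy, Finset.prod_div_distrib]
  generalize (∏ ν : Fin (rho c + 1), sFun c r a (u - (omega c r a ν / 2 + I * β / 2))) = D at key ⊢
  generalize (∏ ν : Fin (rho c + 1), sFun c r a (u - (omega c r a ν / 2 + I * lam * β / 2))) = D'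
    at key ⊢
  generalize sFun c r a (sgn ε * (2 * p.2 k) + I * β) = S at h1 key ⊢
  rw [← neg_eq_iff_eq_neg.2 (residue_algebra key h1 (sFun c r a (I * β)) _ _ _ _ _ _)]
  ring

/-- These are the terms of V⁰ with the exponential replaced by 1; that it equals 1 is
`xi_mul_kappa`. -/
theorem residue_half_period (p : Pt N M) (ν : Fin (rho c + 1)) :
    residue c r a g lam β p (Sum.inr (Sum.inr (Sum.inl ν))) =
      1 / (∏ μ ∈ (Finset.range (rho c + 1)).erase ν,
          sFun c r a ((omega c r a ν - omega c r a μ) / 2)) *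
      ((∏ μ, sFun c r a (omega c r a ν / 2 + I * β / 2 - I * g μ * β)) /
        ∏ μ ∈ Finset.range (rho c + 1),
          sFun c r a ((omega c r a ν - omega c r a μ + I * (1 - lam) * β) / 2)) *
      ∏ δ : ℤˣ,
        ((∏ j : Fin N,
            sFun c r a (sgn δ * p.1 j + omega c r a ν / 2 + I * β / 2 - I * lam * β) /
              sFun c r a (sgn δ * p.1 j + omega c r a ν / 2 + I * β / 2)) *
          ∏ k : Fin M,
            sFun c r a (sgn δ * p.2 k + omega c r a ν / 2 - I * lam * β / 2 + I * β) /
              sFun c r a (sgn δ * p.2 k + omega c r a ν / 2 - I * lam * β / 2)) := by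
  set u := omega c r a ν / 2 + I * β / 2 with hu
  have hx : ∀ j, ∏ δ : ℤˣ, sFun c r a (sgn δ * p.1 j + omega c r a ν / 2 + I * β / 2 - I * lam * β) /
      sFun c r a (sgn δ * p.1 j + omega c r a ν / 2 + I * β / 2)
      = (∏ δ : ℤˣ, sFun c r a (u - (sgn δ * p.1 j + I * lam * β))) /
        ∏ δ : ℤˣ, sFun c r a (u - sgn δ * p.1 j) := by
    intro j
    rw [← prod_units_neg, Finset.prod_div_distrib]
    simp only [sgn_neg]
    congr 1 <;> refine Finset.prod_congr rfl fun δ _ => ?_ <;> rw [hu] <;> congr 1 <;> ring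
  have hy : ∀ k, ∏ δ : ℤˣ, sFun c r a (sgn δ * p.2 k + omega c r a ν / 2 - I * lam * β / 2 + I * β) /
      sFun c r a (sgn δ * p.2 k + omega c r a ν / 2 - I * lam * β / 2)
      = (∏ δ : ℤˣ, sFun c r a (u - (sgn δ * p.2 k + I * (lam - 1) * β / 2))) /
        ∏ δ : ℤˣ, sFun c r a (u - (sgn δ * p.2 k + I * (lam + 1) * β / 2)) := by
    intro j
    rw [← prod_units_neg, Finset.prod_div_distrib]
    simp only [sgn_neg]
    congr 1 <;> refine Finset.prod_congr rfl fun δ _ => ?_ <;> rw [hu] <;> congr 1 <;> ring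
  have e1 : ∀ μ : ℕ, u - (omega c r a μ / 2 + I * β / 2) = (omega c r a ν - omega c r a μ) / 2 :=
    fun μ => by rw [hu]; ring
  have e2 : ∀ μ : ℕ, u - (omega c r a μ / 2 + I * lam * β / 2)
      = (omega c r a ν - omega c r a μ + I * (1 - lam) * β) / 2 := fun μ => by rw [hu]; ring
  unfold residue
  rw [prod_erase_inr, prod_erase_inr, prod_erase_inl, zeroProd_zeros, Fintype.prod_prod_type,
    Fintype.prod_prod_type, prod_range_erase, Finset.prod_range]
  simp only [pole, Sum.elim_inl, Sum.elim_inr, ← hu]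
  rw [prod_mul_prod_comm]
  simp only [hx, hy, e1, e2, Finset.prod_div_distrib]
  simp only [div_eq_mul_inv, mul_inv, one_mul]
  ring

/-- Reflection in ω_ν/2 maps the factors of the zeros at ±x_j, ±x̃_k to those of the poles, up to an
exponential. So the dependence on x and x̃ cancels and a constant remains. -/
theorem residue_half_period' (hr : 0 < r) (ha : 0 < a) (p : Pt N M)
    (h1 : ∀ j, ∀ ε : ℤˣ, sFun c r a (sgn ε * (2 * p.1 j) - I * lam * β) ≠ 0)
    (h2 : ∀ k, ∀ ε : ℤˣ, sFun c r a (sgn ε * (2 * p.2 k) + I * β) ≠ 0) (ν : Fin (rho c + 1)) :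
    residue c r a g lam β p (Sum.inr (Sum.inr (Sum.inr ν))) =
      exp (r * xi ν * (2 * lam * N - 2 * M) * β) /
        (∏ μ ∈ (Finset.range (rho c + 1)).erase ν,
          sFun c r a ((omega c r a ν - omega c r a μ) / 2)) *
      ((∏ μ, sFun c r a (omega c r a ν / 2 + I * lam * β / 2 - I * g μ * β)) /
        ∏ μ ∈ Finset.range (rho c + 1),
          sFun c r a ((omega c r a ν - omega c r a μ + I * (lam - 1) * β) / 2)) := by
  obtain ⟨τ, hτ, hrefl⟩ := sFun_half_period (c := c) hr ha (Nat.lt_succ_iff.1 ν.2)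
  set u := omega c r a ν / 2 + I * lam * β / 2 with hu
  -- Over δ = ± the factors τ square to 1 and the x_j in the exponents cancel.
  have hx : ∀ j, ∏ δ : ℤˣ, sFun c r a (u - (sgn δ * p.1 j + I * lam * β))
      = exp (r * xi ν * (2 * lam) * β) * ∏ δ : ℤˣ, sFun c r a (u - sgn δ * p.1 j) := by
    intro j
    have e : ∀ δ : ℤˣ, sFun c r a (u - (sgn δ * p.1 j + I * lam * β))
        = τ * exp (2 * I * r * xi ν * (-(sgn δ * p.1 j) - I * lam * β / 2)) *
          sFun c r a (u - sgn (-δ) * p.1 j) := by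
      intro δ
      rw [show u - (sgn δ * p.1 j + I * lam * β)
        = omega c r a ν / 2 + (-(sgn δ * p.1 j) - I * lam * β / 2) by rw [hu]; ring, hrefl,
        sgn_neg]
      congr 2
      rw [hu]
      ring
    simp only [e]
    rw [Finset.prod_mul_distrib, prod_units_neg (fun δ => sFun c r a (u - sgn δ * p.1 j)),
      prod_units]
    congr 1
    rw [mul_mul_mul_comm, ← pow_two, hτ, one_mul, ← exp_add]
    congr 1
    simp only [sgn_neg, sgn_one]
    linear_combination (-2 * r * xi ν * lam * β) * I_mul_I
  have hy : ∀ k, ∏ δ : ℤˣ, sFun c r a (u - (sgn δ * p.2 k + I * (lam - 1) * β / 2))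
      = exp (-(r * xi ν * 2 * β)) *
        ∏ δ : ℤˣ, sFun c r a (u - (sgn δ * p.2 k + I * (lam + 1) * β / 2)) := by
    intro k
    have e : ∀ δ : ℤˣ, sFun c r a (u - (sgn δ * p.2 k + I * (lam - 1) * β / 2))
        = τ * exp (2 * I * r * xi ν * (-(sgn δ * p.2 k) + I * β / 2)) *
          sFun c r a (u - (sgn (-δ) * p.2 k + I * (lam + 1) * β / 2)) := by
      intro δ
      rw [show u - (sgn δ * p.2 k + I * (lam - 1) * β / 2)
        = omega c r a ν / 2 + (-(sgn δ * p.2 k) + I * β / 2) by rw [hu]; ring, hrefl,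
        sgn_neg]
      congr 2
      rw [hu]
      ring
    simp only [e]
    rw [Finset.prod_mul_distrib,
      prod_units_neg (fun δ => sFun c r a (u - (sgn δ * p.2 k + I * (lam + 1) * β / 2))),
      prod_units]
    congr 1
    rw [mul_mul_mul_comm, ← pow_two, hτ, one_mul, ← exp_add]
    congr 1
    simp only [sgn_neg, sgn_one]
    linear_combination (2 * r * xi ν * β) * I_mul_I
  have hx0 : ∏ j, ∏ δ : ℤˣ, sFun c r a (u - sgn δ * p.1 j) ≠ 0 := by
    refine Finset.prod_ne_zero_iff.2 fun j _ => Finset.prod_ne_zero_iff.2 fun δ _ => ?_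
    have := sFun_sub_half_period_ne_zero (c := c) hr ha (u := sgn δ * p.1 j)
      (h := I * lam * β / 2) (by convert h1 j δ using 2; ring) ν
    rw [sFun_sub_comm]
    exact neg_ne_zero.2 this
  have hy0 : ∏ k, ∏ δ : ℤˣ, sFun c r a (u - (sgn δ * p.2 k + I * (lam + 1) * β / 2)) ≠ 0 := by
    refine Finset.prod_ne_zero_iff.2 fun k _ => Finset.prod_ne_zero_iff.2 fun δ _ => ?_
    have := sFun_sub_half_period_ne_zero (c := c) hr ha
      (u := sgn δ * p.2 k + I * (lam + 1) * β / 2)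
      (h := I * lam * β / 2) (by convert h2 k δ using 2; ring) ν
    rw [sFun_sub_comm]
    exact neg_ne_zero.2 this
  have e1 : ∀ μ : ℕ, u - (omega c r a μ / 2 + I * lam * β / 2)
      = (omega c r a ν - omega c r a μ) / 2 := fun μ => by rw [hu]; ring
  have e2 : ∀ μ : ℕ, u - (omega c r a μ / 2 + I * β / 2)
      = (omega c r a ν - omega c r a μ + I * (lam - 1) * β) / 2 := fun μ => by rw [hu]; ring
  have he : exp (r * xi ν * (2 * lam * N - 2 * M) * β)
      = exp (r * xi ν * (2 * lam) * β) ^ N * exp (-(r * xi ν * 2 * β)) ^ M := by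
    rw [← exp_nat_mul, ← exp_nat_mul, ← exp_add]
    congr 1
    ring
  unfold residue
  rw [prod_erase_inr, prod_erase_inr, prod_erase_inr, zeroProd_zeros, Fintype.prod_prod_type,
    Fintype.prod_prod_type, prod_range_erase, Finset.prod_range]
  simp only [pole, Sum.elim_inl, Sum.elim_inr, ← hu, hx, hy, e1, e2, Finset.prod_mul_distrib,
    Finset.prod_const, Finset.card_univ, Fintype.card_fin]
  rw [he]
  generalize ∏ j, ∏ δ : ℤˣ, sFun c r a (u - sgn δ * p.1 j) = X at hx0 ⊢
  generalize ∏ k, ∏ δ : ℤˣ, sFun c r a (u - (sgn δ * p.2 k + I * (lam + 1) * β / 2)) = Y at hy0 ⊢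
  field_simp

theorem sgn_mul (ε δ : ℤˣ) : sgn (ε * δ) = sgn ε * sgn δ := by simp [sgn]

theorem sFun_sgn_sub_sgn_ne_zero {x y : ℂ} {ε δ : ℤˣ}
    (h : sFun c r a (x + sgn (-(ε * δ)) * y) ≠ 0) : sFun c r a (sgn ε * x - sgn δ * y) ≠ 0 := by
  rw [← sFun_sgn_mul_ne_zero ε] at h
  convert h using 2
  rw [sgn_neg, sgn_mul]
  linear_combination sgn δ * y * sgn_mul_self ε

/-- Up to sign, or a half-period factor of the duplication formula, each difference is a denominator
of some V or Ṽ or one of the two extra factors. Differences of half periods are treated separately.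
-/
theorem sFun_pole_sub_ne_zero (hr : 0 < r) (ha : 0 < a)
    (hnondeg : I * (lam - 1) * β ∉ Omega c r a) {p : Pt N M}
    (hV : ∀ ε j, VFactors c r a g lam β ε j p)
    (hVt : ∀ ε k, VFactors c r a (dualParam lam g) (1 / lam) (lam * β) ε k p.swap)
    (h1 : ∀ j, ∀ ε : ℤˣ, sFun c r a (sgn ε * (2 * p.1 j) - I * lam * β) ≠ 0)
    (h2 : ∀ k, ∀ ε : ℤˣ, sFun c r a (sgn ε * (2 * p.2 k) + I * β) ≠ 0) :
    ∀ i i' : PoleIndex c N M, i ≠ i' →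
      sFun c r a (pole c r a lam β p i - pole c r a lam β p i') ≠ 0 := by
  have hsymm : ∀ {x y : ℂ}, sFun c r a (x - y) ≠ 0 → sFun c r a (y - x) ≠ 0 := fun h => by
    rw [sFun_sub_comm]
    exact neg_ne_zero.2 h
  have hunits : ∀ {ε δ : ℤˣ}, ε ≠ δ → δ = -ε := fun h => by
    rw [Int.units_ne_iff_eq_neg.1 h, neg_neg]
  have hxy : ∀ j ε k δ, sFun c r a (sgn ε * p.1 j - (sgn δ * p.2 k + I * (lam + 1) * β / 2)) ≠ 0 := by
    intro j ε k δ
    have h := (hV ε j).mixed_den (-(ε * δ)) k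
    rw [← sFun_sgn_mul_ne_zero ε] at h
    convert h using 2
    rw [sgn_neg, sgn_mul]
    linear_combination (sgn δ * p.2 k + I * (lam + 1) * β / 2) * sgn_mul_self ε
  have hx1 : ∀ j ε (ν : Fin (rho c + 1)),
      sFun c r a (sgn ε * p.1 j - (omega c r a ν / 2 + I * β / 2)) ≠ 0 := fun j ε ν =>
    sFun_sub_half_period_ne_zero hr ha (by convert (hV ε j).two_sub using 2; ring) ν
  have hx2 : ∀ j ε (ν : Fin (rho c + 1)),
      sFun c r a (sgn ε * p.1 j - (omega c r a ν / 2 + I * lam * β / 2)) ≠ 0 := fun j ε ν =>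
    sFun_sub_half_period_ne_zero hr ha (by convert h1 j ε using 2; ring) ν
  have hy1 : ∀ k ε (ν : Fin (rho c + 1)), sFun c r a
      (sgn ε * p.2 k + I * (lam + 1) * β / 2 - (omega c r a ν / 2 + I * β / 2)) ≠ 0 := by
    intro k ε ν
    refine sFun_sub_half_period_ne_zero hr ha ?_ ν
    have h := (hVt (-ε) k).two_sub
    simp only [Prod.fst_swap, sgn_neg, ofReal_mul] at h
    rw [← neg_ne_zero, ← sFun_neg] at h
    convert h using 2
    ring
  have hy2 : ∀ k ε (ν : Fin (rho c + 1)), sFun c r a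
      (sgn ε * p.2 k + I * (lam + 1) * β / 2 - (omega c r a ν / 2 + I * lam * β / 2)) ≠ 0 :=
    fun k ε ν => sFun_sub_half_period_ne_zero hr ha (by convert h2 k ε using 2; ring) ν
  -- Twice a lattice point, corrected by ω_ν - ω_μ, would be i(λ - 1)β; this is excluded by
  -- assumption.
  have h12 : ∀ ν μ : Fin (rho c + 1), sFun c r a
      (omega c r a ν / 2 + I * β / 2 - (omega c r a μ / 2 + I * lam * β / 2)) ≠ 0 := by
    intro ν μ h
    refine hnondeg ?_
    have h3 := (sFun_eq_zero_iff hr ha).1 h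
    have h4 := sub_mem (sub_mem (omega_mem_Omega (r := r) (a := a) (Nat.lt_succ_iff.1 ν.2))
      (omega_mem_Omega (Nat.lt_succ_iff.1 μ.2))) (add_mem h3 h3)
    convert h4 using 1
    ring
  have hνμ : ∀ ν μ : Fin (rho c + 1), ν ≠ μ → ∀ h : ℂ,
      sFun c r a (omega c r a ν / 2 + h - (omega c r a μ / 2 + h)) ≠ 0 := by
    intro ν μ hne h
    have := sFun_half_period_sub_ne_zero (c := c) hr ha (Nat.lt_succ_iff.1 ν.2)
      (Nat.lt_succ_iff.1 μ.2) (Fin.val_ne_of_ne hne)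
    convert this using 2
    ring
  rintro (⟨j, ε⟩ | ⟨k, ε⟩ | ν | ν) (⟨j', ε'⟩ | ⟨k', ε'⟩ | μ | μ) hne <;>
    simp only [pole, Sum.elim_inl, Sum.elim_inr]
  · by_cases hj : j' = j
    · subst hj
      rw [hunits (fun h => hne (by rw [h]) : ε ≠ ε')]
      convert (hV ε j').two using 2
      rw [sgn_neg]
      ring
    · exact sFun_sgn_sub_sgn_ne_zero ((hV 1 j).pair_den _ _ hj)
  · exact hxy j ε k' ε'
  · exact hx1 j ε μ
  · exact hx2 j ε μ
  · exact hsymm (hxy j' ε' k ε)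
  · rw [add_sub_add_right_eq_sub]
    by_cases hk : k' = k
    · subst hk
      rw [hunits (fun h => hne (by rw [h]) : ε ≠ ε')]
      convert (hVt ε k').two using 2
      rw [sgn_neg, Prod.fst_swap]
      ring
    · exact sFun_sgn_sub_sgn_ne_zero ((hVt 1 k).pair_den _ _ hk)
  · exact hy1 k ε μ
  · exact hy2 k ε μ
  · exact hsymm (hx1 j' ε' ν)
  · exact hsymm (hy1 k' ε' ν)
  · exact hνμ ν μ (fun h => hne (by rw [h])) _
  · exact h12 ν μ
  · exact hsymm (hx2 j' ε' ν)
  · exact hsymm (hy2 k' ε' ν)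
  · exact hsymm (h12 μ ν)
  · exact hνμ ν μ (fun h => hne (by rw [h])) _

/-! ### The source identity -/

/-- The exponent `κ`. -/
noncomputable def kappa (c : VDCase) (g : Fin (2 * rho c + 2) → ℝ) (lam : ℝ) (N M : ℕ) : ℂ :=
  2 * lam * N - 2 * M + ∑ μ, (g μ : ℂ) - (rho c + 1) * (lam + 1) / 2

/-- Summation over signs cancels x and x̃, so only the shifts contribute; this is the origin of κ.
-/
theorem sum_pole_sub_sum_zeros (p : Pt N M) :
    ∑ i, pole c r a lam β p i - (zeros c g lam β p).sum =
      -(I * β * kappa c g lam N M - ∑ ν ∈ Finset.range (rho c + 1), omega c r a ν) := by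
  have hx : ∀ {n : ℕ} (x : Fin n → ℂ) (A : ℂ), ∑ i : Fin n × ℤˣ, (sgn i.2 * x i.1 + A)
      = 2 * n * A := by
    intro n x A
    simp only [Fintype.sum_prod_type, sum_units, sgn_one, sgn_neg]
    rw [Finset.sum_congr rfl (fun j _ => show (1 * x j + A + (-1 * x j + A)) = 2 * A by ring)]
    simp
    ring
  have hx0 : ∑ i : Fin N × ℤˣ, sgn i.2 * p.1 i.1 = 0 := by simpa using hx p.1 0
  simp only [zeros, Multiset.sum_add, ← Finset.sum_eq_multiset_sum, hx, Fintype.sum_sum_type, pole,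
    Sum.elim_inl, Sum.elim_inr, hx0, kappa, Finset.sum_add_distrib, Finset.sum_const,
    Finset.card_univ, Fintype.card_fin, nsmul_eq_mul, ← Finset.sum_mul, ← Finset.mul_sum,
    ← Finset.sum_div, Finset.sum_range]
  push_cast
  ring

theorem card_zeros (p : Pt N M) :
    (zeros c g lam β p).card = 2 * N + 2 * M + 2 * rho c + 1 + 1 := by
  simp [zeros]
  ring

theorem card_poleIndex (c : VDCase) (N M : ℕ) :
    (Finset.univ : Finset (PoleIndex c N M)).card = 2 * N + 2 * M + 2 * rho c + 1 + 1 := by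
  simp
  ring

/-- For ρ = 3 the balancing condition is literally κ = 0. -/
theorem kappa_elliptic (hc : c = .elliptic)
    (hbal : 2 * lam * (N - 1) - 2 * (M + 1) + ∑ ν, g ν = 0) : kappa c g lam N M = 0 := by
  have h : (2 * lam * (N - 1) - 2 * (M + 1) + ∑ ν, (g ν : ℂ) : ℂ) = 0 := by exact_mod_cast hbal
  have h3 : (rho c : ℂ) = 3 := by rw [hc]; simp [rho]
  rw [kappa, h3]
  linear_combination h

theorem xi_mul_kappa (hbal : c = .elliptic → 2 * lam * (N - 1) - 2 * (M + 1) + ∑ ν, g ν = 0)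
    {ν : ℕ} (hν : ν ≤ rho c) : (xi ν : ℂ) * kappa c g lam N M = 0 := by
  by_cases hc : c = .elliptic
  · rw [kappa_elliptic hc (hbal hc), mul_zero]
  · rw [xi_eq_zero hc hν]
    simp

/-- In case IV both |ω| and κ vanish, so d = 0; in the other cases the difference-of-squares formula
holds. -/
theorem sum_residue (hr : 0 < r) (ha : 0 < a)
    (hbal : c = .elliptic → 2 * lam * (N - 1) - 2 * (M + 1) + ∑ ν, g ν = 0) {p : Pt N M}
    (hp : ∀ i i' : PoleIndex c N M, i ≠ i' →
      sFun c r a (pole c r a lam β p i - pole c r a lam β p i') ≠ 0) :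
    ∑ i, residue c r a g lam β p i = -sFun c r a (I * β * kappa c g lam N M -
      ∑ ν ∈ Finset.range (rho c + 1), omega c r a ν) := by
  rw [← sFun_neg, ← sum_pole_sub_sum_zeros (g := g) p]
  refine sum_zeroProd_div (sFun_neg c r a) (threeTerm_sFun c hr ha) (fun u v hu hv => ?_) ?_ _ _
    _ _ (card_poleIndex c N M) (card_zeros p) (fun i _ j _ h => hp i j h) rfl
  · rw [sFun_eq_zero_iff hr ha] at *
    exact sub_mem hu hv
  · by_cases hc : c = .elliptic
    · left
      rw [sum_pole_sub_sum_zeros, kappa_elliptic hc (hbal hc)]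
      subst hc
      simp [rho, Finset.sum_range_succ, omega]
    · exact Or.inr (sFun_add_mul_sub hc)

theorem coeffV0_eq_residue
    (hbal : c = .elliptic → 2 * lam * (N - 1) - 2 * (M + 1) + ∑ ν, g ν = 0) (p : Pt N M) :
    coeffV0 c r a g lam β p = -prefactor c r a *
      ∑ ν : Fin (rho c + 1), residue c r a g lam β p (Sum.inr (Sum.inr (Sum.inl ν))) := by
  unfold coeffV0
  rw [Finset.sum_range]
  congr 1
  refine Finset.sum_congr rfl fun ν _ => ?_
  rw [residue_half_period]
  have h := xi_mul_kappa hbal (Nat.lt_succ_iff.1 ν.2)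
  unfold kappa at h
  congr 3
  refine (congrArg exp ?_).trans exp_zero
  linear_combination (-r * β) * h

theorem constC0_eq_residue (hr : 0 < r) (ha : 0 < a)
    (hbal : c = .elliptic → 2 * lam * (N - 1) - 2 * (M + 1) + ∑ ν, g ν = 0) (p : Pt N M)
    (h1 : ∀ j, ∀ ε : ℤˣ, sFun c r a (sgn ε * (2 * p.1 j) - I * lam * β) ≠ 0)
    (h2 : ∀ k, ∀ ε : ℤˣ, sFun c r a (sgn ε * (2 * p.2 k) + I * β) ≠ 0) :
    constC0 c r a g lam β = prefactor c r a *
      ∑ ν : Fin (rho c + 1), residue c r a g lam β p (Sum.inr (Sum.inr (Sum.inr ν))) := by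
  unfold constC0
  rw [Finset.sum_range]
  congr 1
  refine Finset.sum_congr rfl fun ν _ => ?_
  rw [residue_half_period' hr ha p h1 h2]
  have h := xi_mul_kappa hbal (Nat.lt_succ_iff.1 ν.2)
  unfold kappa at h
  congr 3
  linear_combination (-r * β) * h

/-- The value of the operator on constants after the gauge transformation. -/
noncomputable def sourceSum (c : VDCase) (r a : ℝ) (g : Fin (2 * rho c + 2) → ℝ) (lam β : ℝ)
    (p : Pt N M) : ℂ :=
  ∑ ε : ℤˣ, (sFun c r a (I * lam * β) * ∑ j : Fin N, coeffV c r a g lam β ε j p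
      - sFun c r a (I * β) * ∑ k : Fin M, coeffVt c r a g lam β ε k p)
    + coeffV0 c r a g lam β p

/-- P times the residue sum, with the four families of residues identified. -/
theorem sourceSum_eq_of_ne (hlam : lam ≠ 0) (hr : 0 < r) (ha : 0 < a)
    (hnondeg : I * (lam - 1) * β ∉ Omega c r a)
    (hbal : c = .elliptic → 2 * lam * (N - 1) - 2 * (M + 1) + ∑ ν, g ν = 0) {p : Pt N M}
    (hV : ∀ ε j, coeffV c r a g lam β ε j p ≠ 0) (hVt : ∀ ε k, coeffVt c r a g lam β ε k p ≠ 0)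
    (h1 : ∀ j, ∀ ε : ℤˣ, sFun c r a (sgn ε * (2 * p.1 j) - I * lam * β) ≠ 0)
    (h2 : ∀ k, ∀ ε : ℤˣ, sFun c r a (sgn ε * (2 * p.2 k) + I * β) ≠ 0) :
    sourceSum c r a g lam β p = eigenvalue c r a g lam β N M := by
  have hpole := sFun_pole_sub_ne_zero hr ha hnondeg
    (fun ε j => vFactors_of_coeffV_ne_zero (hV ε j))
    (fun ε k => vFactors_of_coeffV_ne_zero (by
      have := hVt (-ε) k
      rwa [coeffVt_eq_coeffV hlam, neg_neg] at this)) h1 h2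
  have hsum := congrArg (prefactor c r a * ·) (sum_residue (g := g) hr ha hbal hpole)
  simp only [Fintype.sum_sum_type, mul_add, Finset.mul_sum, Fintype.sum_prod_type,
    prefactor_mul_residue_x hr ha p _ _ (h1 _ _), prefactor_mul_residue_y hr ha p _ _ (h2 _ _)]
    at hsum
  unfold sourceSum eigenvalue
  rw [coeffV0_eq_residue hbal, constC0_eq_residue hr ha hbal p h1 h2]
  simp only [sum_units, Finset.sum_add_distrib, Finset.sum_neg_distrib, ← Finset.mul_sum] at hsum ⊢
  unfold kappa at hsum
  linear_combination -hsum

theorem continuousAt_coeffVt (hlam : lam ≠ 0) (hr : 0 < r) (ha : 0 < a) {ε : ℤˣ} {k : Fin M}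
    {p : Pt N M} (h : coeffVt c r a g lam β ε k p ≠ 0) :
    ContinuousAt (coeffVt c r a g lam β ε k) p := by
  rw [coeffVt_eq_coeffV hlam] at h
  have h1 := (vFactors_of_coeffV_ne_zero h).continuousAt hr ha
  rw [funext fun q => coeffVt_eq_coeffV (c := c) (r := r) (a := a) (g := g) (β := β) hlam ε k q]
  exact ContinuousAt.comp (f := Prod.swap) h1 continuous_swap.continuousAt

/-- By the duplication formula the denominators of V⁰ divide s(±2x_j - iβ) and s(±2x̃_k + iλβ),
which occur in V and Ṽ. -/
theorem continuousAt_coeffV0 (hlam : lam ≠ 0) (hr : 0 < r) (ha : 0 < a) {p : Pt N M}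
    (hV : ∀ ε j, coeffV c r a g lam β ε j p ≠ 0) (hVt : ∀ ε k, coeffVt c r a g lam β ε k p ≠ 0) :
    ContinuousAt (coeffV0 c r a g lam β) p := by
  have hs := (differentiable_sFun c hr ha).continuous
  unfold coeffV0
  refine ContinuousAt.mul continuousAt_const (tendsto_finsetSum _ fun ν hν =>
    ContinuousAt.mul continuousAt_const (tendsto_finsetProd _ fun δ _ => ContinuousAt.mul ?_ ?_))
  · refine tendsto_finsetProd _ fun j _ => ContinuousAt.div (by fun_prop) (by fun_prop) ?_
    have h := sFun_sub_half_period_ne_zero (c := c) hr ha (u := sgn (-δ) * p.1 j) (h := I * β / 2)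
      (by convert (vFactors_of_coeffV_ne_zero (hV (-δ) j)).two_sub using 2; ring)
      ⟨ν, Finset.mem_range.1 hν⟩
    rw [← neg_ne_zero, ← sFun_neg] at h
    convert h using 2
    rw [sgn_neg]
    ring
  · refine tendsto_finsetProd _ fun k _ => ContinuousAt.div (by fun_prop) (by fun_prop) ?_
    have h1 := hVt (-δ) k
    rw [coeffVt_eq_coeffV hlam, neg_neg] at h1
    have h2 := (vFactors_of_coeffV_ne_zero h1).two_sub
    rw [← neg_ne_zero, ← sFun_neg] at h2
    have h := sFun_sub_half_period_ne_zero (c := c) hr ha (u := sgn (-δ) * p.2 k)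
      (h := -(I * lam * β / 2))
      (by convert h2 using 2; rw [sgn_neg, Prod.fst_swap]; push_cast; ring)
      ⟨ν, Finset.mem_range.1 hν⟩
    rw [← neg_ne_zero, ← sFun_neg] at h
    convert h using 2
    rw [sgn_neg]
    ring

/-- The source identity. -/
theorem sourceSum_eq (hlam : lam ≠ 0) (hr : 0 < r) (ha : 0 < a)
    (hnondeg : I * (lam - 1) * β ∉ Omega c r a)
    (hbal : c = .elliptic → 2 * lam * (N - 1) - 2 * (M + 1) + ∑ ν, g ν = 0) {p : Pt N M}
    (hV : ∀ ε j, coeffV c r a g lam β ε j p ≠ 0)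
    (hVt : ∀ ε k, coeffVt c r a g lam β ε k p ≠ 0) :
    sourceSum c r a g lam β p = eigenvalue c r a g lam β N M := by
  have hVc : ∀ ε j, ContinuousAt (coeffV c r a g lam β ε j) p := fun ε j =>
    (vFactors_of_coeffV_ne_zero (hV ε j)).continuousAt hr ha
  have hVtc : ∀ ε k, ContinuousAt (coeffVt c r a g lam β ε k) p := fun ε k =>
    continuousAt_coeffVt hlam hr ha (hVt ε k)
  have hcont : ContinuousAt (sourceSum c r a g lam β) p := by
    unfold sourceSum
    refine ContinuousAt.add (tendsto_finsetSum _ fun ε _ => ContinuousAt.sub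
      (ContinuousAt.mul continuousAt_const (tendsto_finsetSum _ fun j _ => hVc ε j))
      (ContinuousAt.mul continuousAt_const (tendsto_finsetSum _ fun k _ => hVtc ε k)))
      (continuousAt_coeffV0 hlam hr ha hV hVt)
  -- To remove the two extra assumptions, all coordinates are translated by a common t. Only
  -- countably many t violate them, and both sides are continuous at p.
  let γ : ℂ → Pt N M := fun t => (fun j => p.1 j + t, fun k => p.2 k + t)
  have hγ0 : γ 0 = p := by simp [γ]
  have hγ : Tendsto γ (𝓝 0) (𝓝 p) := by
    have : Continuous γ := by fun_prop
    simpa [hγ0] using this.tendsto 0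
  have hcount : {t : ℂ | sFun c r a t = 0}.Countable := (countable_Omega c r a).mono fun x hx =>
    (sFun_eq_zero_iff hr ha).1 hx
  set bad : Set ℂ := (⋃ i : Fin N × ℤˣ, {t | sFun c r a (2 * sgn i.2 * t +
      (sgn i.2 * (2 * p.1 i.1) - I * lam * β)) = 0}) ∪
    ⋃ i : Fin M × ℤˣ, {t | sFun c r a (2 * sgn i.2 * t + (sgn i.2 * (2 * p.2 i.1) + I * β)) = 0}
    with hbad
  have hsgn : ∀ ε : ℤˣ, 2 * sgn ε ≠ 0 := fun ε h => by
    have := sgn_mul_self ε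
    rw [(mul_eq_zero.1 h).resolve_left two_ne_zero] at this
    simp at this
  have hdense : Dense badᶜ := by
    refine (Set.Countable.union ?_ ?_).dense_compl ℝ
    · exact countable_iUnion fun i => countable_zeros_comp hcount (hsgn _) _
    · exact countable_iUnion fun i => countable_zeros_comp hcount (hsgn _) _
  by_contra hne
  have hev : ∀ᶠ t in 𝓝 (0 : ℂ), sourceSum c r a g lam β (γ t) ≠ eigenvalue c r a g lam β N M ∧
      (∀ ε j, coeffV c r a g lam β ε j (γ t) ≠ 0) ∧
        ∀ ε k, coeffVt c r a g lam β ε k (γ t) ≠ 0 := by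
    have e1 : ∀ᶠ q in 𝓝 p, ∀ ε j, coeffV c r a g lam β ε j q ≠ 0 :=
      eventually_all.2 fun ε => eventually_all.2 fun j => (hVc ε j).eventually_ne (hV ε j)
    have e2 : ∀ᶠ q in 𝓝 p, ∀ ε k, coeffVt c r a g lam β ε k q ≠ 0 :=
      eventually_all.2 fun ε => eventually_all.2 fun k => (hVtc ε k).eventually_ne (hVt ε k)
    exact hγ.eventually ((hcont.eventually_ne hne).and (e1.and e2))
  obtain ⟨t, ht, h1, h2, h3⟩ := ((mem_closure_iff_frequently.1 (hdense 0)).and_eventually hev).exists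
  simp only [hbad, mem_compl_iff, mem_union, mem_iUnion, mem_ofPred_eq, not_or, not_exists] at ht
  refine h1 (sourceSum_eq_of_ne hlam hr ha hnondeg hbal h2 h3 (fun j ε => ?_) fun k ε => ?_)
  · refine fun h => ht.1 (j, ε) (h ▸ congrArg _ ?_)
    simp only [γ]
    ring
  · refine fun h => ht.2 (k, ε) (h ▸ congrArg _ ?_)
    simp only [γ]
    ring

/-! ### Factorisation of Ψ² and the gauge relation -/

/-- This collects the pair factors that contain one given particle; by symmetry the pairs (i, i₀)
with i < i₀ join those with i > i₀. -/
theorem prod_Ioi_of_symm {n : ℕ} {R : Type*} [CommMonoid R] (F : Fin n → Fin n → R)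
    (hF : ∀ i j, F i j = F j i) (i₀ : Fin n) :
    ∏ i, ∏ j ∈ Finset.Ioi i, F i j = (∏ j ∈ Finset.univ.erase i₀, F i₀ j) *
      ∏ i ∈ Finset.univ.erase i₀, ∏ j ∈ (Finset.Ioi i).erase i₀, F i j := by
  rw [← Finset.mul_prod_erase Finset.univ _ (Finset.mem_univ i₀)]
  have h1 : ∀ i ∈ Finset.univ.erase i₀, ∏ j ∈ Finset.Ioi i, F i j
      = (if i < i₀ then F i₀ i else 1) * ∏ j ∈ (Finset.Ioi i).erase i₀, F i j := by
    intro i _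
    split_ifs with h
    · rw [hF i₀ i, Finset.mul_prod_erase _ _ (Finset.mem_Ioi.2 h)]
    · rw [one_mul, Finset.erase_eq_of_notMem (by simpa using h)]
  rw [Finset.prod_congr rfl h1, Finset.prod_mul_distrib, ← mul_assoc]
  congr 1
  rw [← Finset.prod_filter, ← Finset.prod_union]
  · refine Finset.prod_congr ?_ fun _ _ => rfl
    ext i
    simp only [Finset.mem_union, Finset.mem_Ioi, Finset.mem_filter, Finset.mem_erase, ne_eq,
      Finset.mem_univ, and_true]
    constructor
    · rintro (h | h)
      · exact h.ne'
      · exact h.1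
    · intro h
      rcases lt_or_gt_of_ne h with h' | h'
      · exact Or.inr ⟨h, h'⟩
      · exact Or.inl h'
  · rw [Finset.disjoint_left]
    intro i h h'
    exact absurd (Finset.mem_Ioi.1 h) (not_lt.2 (Finset.mem_filter.1 h').2.le)

variable {G : ℂ → ℂ → ℂ}

/-- The one-particle factors of `Ψ²`. -/
noncomputable def psiOne (c : VDCase) (G : ℂ → ℂ → ℂ) (g : Fin (2 * rho c + 2) → ℝ) (β : ℝ)
    (x : ℂ) : ℂ :=
  G (2 * x + I * β / 2) β * G (-(2 * x) + I * β / 2) β /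
      ∏ ν, (G (x + I * β / 2 - I * g ν * β) β * G (-x + I * β / 2 - I * g ν * β) β)

/-- The two-particle factors of `Ψ²`. -/
noncomputable def psiTwo (G : ℂ → ℂ → ℂ) (lam β : ℝ) (z : ℂ) : ℂ :=
  G (z + I * β / 2) β / G (z - I * lam * β + I * β / 2) β *
    (G (-z + I * β / 2) β / G (-z - I * lam * β + I * β / 2) β)

/-- The mixed factors of `Ψ²`. -/
noncomputable def psiMixed (c : VDCase) (r a lam β : ℝ) (z : ℂ) : ℂ :=
  (sFun c r a (z + I * (lam - 1) * β / 2) * sFun c r a (z - I * (lam - 1) * β / 2))⁻¹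

/-- The one-particle factors of the coefficients. -/
noncomputable def vOne (c : VDCase) (r a : ℝ) (g : Fin (2 * rho c + 2) → ℝ) (β : ℝ) (ε : ℤˣ)
    (x : ℂ) : ℂ :=
  (∏ ν, sFun c r a (sgn ε * x - I * g ν * β)) /
    (sFun c r a (sgn ε * (2 * x)) * sFun c r a (sgn ε * (2 * x) - I * β))

/-- The two-particle factors of the coefficients. -/
noncomputable def vTwo (c : VDCase) (r a lam β : ℝ) (ε : ℤˣ) (z : ℂ) : ℂ :=
  sFun c r a (z - sgn ε * (I * lam * β)) / sFun c r a z

/-- The mixed factors of the coefficients. -/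
noncomputable def vMixed (c : VDCase) (r a lam β : ℝ) (ε : ℤˣ) (z : ℂ) : ℂ :=
  sFun c r a (z - sgn ε * (I * (lam - 1) * β / 2)) /
    sFun c r a (z - sgn ε * (I * (lam + 1) * β / 2))

theorem coeffV_eq_prod (ε : ℤˣ) (j : Fin N) (p : Pt N M) :
    coeffV c r a g lam β ε j p = vOne c r a g β ε (p.1 j) *
      ((∏ j' ∈ Finset.univ.erase j, ∏ δ : ℤˣ, vTwo c r a lam β ε (p.1 j + sgn δ * p.1 j')) *
        ∏ k, ∏ δ : ℤˣ, vMixed c r a lam β ε (p.1 j + sgn δ * p.2 k)) := by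
  unfold coeffV
  rw [prod_mul_prod_comm]
  rfl

/-- The factors of `Ψ²` that do not contain `x_j`. -/
noncomputable def psiRest (c : VDCase) (r a : ℝ) (G : ℂ → ℂ → ℂ) (g : Fin (2 * rho c + 2) → ℝ)
    (lam β : ℝ) (j : Fin N) (p : Pt N M) : ℂ :=
  (∏ i ∈ Finset.univ.erase j, psiOne c G g β (p.1 i)) *
    (∏ i ∈ Finset.univ.erase j, ∏ i' ∈ (Finset.Ioi i).erase j,
      ∏ δ : ℤˣ, psiTwo G lam β (p.1 i + sgn δ * p.1 i')) *
    (∏ i ∈ Finset.univ.erase j, ∏ k, ∏ δ : ℤˣ, psiMixed c r a lam β (p.1 i + sgn δ * p.2 k)) *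
    groundStateSq c G (dualParam lam g) (1 / lam) (lam * β) p.2

/-- The dependence on x_j is split off. The four sign choices of a pair are grouped as ±(x_i +
x_{i'}) and ±(x_i - x_{i'}), so that each group depends on one argument z. -/
theorem deformedGroundStateSq_eq_prod (j : Fin N) (p : Pt N M) :
    deformedGroundStateSq c r a G g lam β p = psiOne c G g β (p.1 j) *
      ((∏ j' ∈ Finset.univ.erase j, ∏ δ : ℤˣ, psiTwo G lam β (p.1 j + sgn δ * p.1 j')) *
        ∏ k, ∏ δ : ℤˣ, psiMixed c r a lam β (p.1 j + sgn δ * p.2 k)) *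
      psiRest c r a G g lam β j p := by
  have h2 : ∀ i i', (∏ ε : ℤˣ, ∏ ε' : ℤˣ, G (sgn ε * p.1 i + sgn ε' * p.1 i' + I * β / 2) β /
        G (sgn ε * p.1 i + sgn ε' * p.1 i' - I * lam * β + I * β / 2) β)
      = ∏ δ : ℤˣ, psiTwo G lam β (p.1 i + sgn δ * p.1 i') := by
    intro i i'
    simp only [prod_units, sgn_one, sgn_neg, psiTwo, one_mul, neg_mul, neg_add, neg_neg]
    ring
  have hsymm : ∀ i i', ∏ δ : ℤˣ, psiTwo G lam β (p.1 i + sgn δ * p.1 i')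
      = ∏ δ : ℤˣ, psiTwo G lam β (p.1 i' + sgn δ * p.1 i) := by
    intro i i'
    simp only [prod_units, sgn_one, sgn_neg, psiTwo, one_mul, neg_mul, neg_add, neg_neg]
    simp only [add_comm (p.1 i'), add_comm (-p.1 i')]
    ring
  have hpsi : groundStateSq c G g lam β p.1 = (∏ i, psiOne c G g β (p.1 i)) *
      ∏ i, ∏ i' ∈ Finset.Ioi i, ∏ δ : ℤˣ, psiTwo G lam β (p.1 i + sgn δ * p.1 i') := by
    unfold groundStateSq
    simp only [h2]
    rfl
  have hmix : (∏ i, ∏ δ : ℤˣ, ∏ k,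
      (sFun c r a (p.1 i + sgn δ * p.2 k + I * (lam - 1) * β / 2) *
        sFun c r a (p.1 i + sgn δ * p.2 k - I * (lam - 1) * β / 2)))⁻¹
      = ∏ i, ∏ k, ∏ δ : ℤˣ, psiMixed c r a lam β (p.1 i + sgn δ * p.2 k) := by
    simp only [psiMixed, Finset.prod_inv_distrib]
    congr 1
    exact Finset.prod_congr rfl fun i _ => Finset.prod_comm
  unfold deformedGroundStateSq
  rw [hpsi, div_eq_mul_inv, hmix, prod_Ioi_of_symm _ hsymm j,
    ← Finset.mul_prod_erase Finset.univ (fun i => psiOne c G g β (p.1 i)) (Finset.mem_univ j),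
    ← Finset.mul_prod_erase Finset.univ (fun i => ∏ k, ∏ δ : ℤˣ,
      psiMixed c r a lam β (p.1 i + sgn δ * p.2 k)) (Finset.mem_univ j)]
  unfold psiRest
  -- The parameters g' in Ψ² agree with `dualParam lam g` by definition.
  change _ * _ * (_ * _) * groundStateSq c G (dualParam lam g) (1 / lam) (lam * β) p.2 * _ = _
  ring

theorem shiftX_of_ne (p : Pt N M) {j j' : Fin N} (h : j' ≠ j) (t : ℂ) :
    (shiftX p j t).1 j' = p.1 j' := by
  simp [shiftX, h]

theorem psiRest_shiftX (j : Fin N) (p : Pt N M) (t : ℂ) :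
    psiRest c r a G g lam β j (shiftX p j t) = psiRest c r a G g lam β j p := by
  have h : ∀ {i}, i ≠ j → (shiftX p j t).1 i = p.1 i := fun h => shiftX_of_ne p h t
  unfold psiRest
  congr 1
  congr 1
  · congr 1
    · exact Finset.prod_congr rfl fun i hi => by rw [h (Finset.ne_of_mem_erase hi)]
    · refine Finset.prod_congr rfl fun i hi => Finset.prod_congr rfl fun i' hi' => ?_
      rw [h (Finset.ne_of_mem_erase hi), h (Finset.ne_of_mem_erase hi')]
  · exact Finset.prod_congr rfl fun i hi => by
      rw [h (Finset.ne_of_mem_erase hi)]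
      rfl

section Shift

variable {k : ℂ}

/-- Since 2x moves by 2iβ, the functional equation is used twice for each factor G(±2x + iβ/2), and
once for each factor with g_ν. The powers of k are the same on both sides. -/
theorem vOne_mul_psiOne (hk : k ≠ 0) (hG : ∀ x : ℂ, sFun c r a x ≠ 0 →
      G (x + I * β / 2) β = k * sFun c r a x * G (x - I * β / 2) β) {x : ℂ}
    (h1 : ∀ ν, sFun c r a (x - I * g ν * β) ≠ 0) (h2 : sFun c r a (2 * x) ≠ 0)
    (h3 : sFun c r a (2 * x - I * β) ≠ 0)
    (h1' : ∀ ν, sFun c r a (-(x - I * β) - I * g ν * β) ≠ 0)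
    (h2' : sFun c r a (-(2 * (x - I * β))) ≠ 0)
    (h3' : sFun c r a (-(2 * (x - I * β)) - I * β) ≠ 0) :
    vOne c r a g β (-1) (x - I * β) * psiOne c G g β (x - I * β)
      = vOne c r a g β 1 x * psiOne c G g β x := by
  have e1 := hG _ h2
  have e2 := hG _ h3
  have e3 := hG _ h2'
  have e4 := hG _ h3'
  rw [show 2 * x - I * β + I * β / 2 = 2 * x - I * β / 2 by ring] at e2
  rw [show -(2 * (x - I * β)) - I * β + I * β / 2 = -(2 * (x - I * β)) - I * β / 2 by ring,
    show -(2 * (x - I * β)) - I * β - I * β / 2 = -(2 * x) + I * β / 2 by ring] at e4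
  have e5 : ∀ ν, G (x + I * β / 2 - I * g ν * β) β = k * sFun c r a (x - I * g ν * β) *
      G (x - I * β + I * β / 2 - I * g ν * β) β := fun ν => by
    have := hG _ (h1 ν)
    convert this using 2
    · ring
    · congr 1; ring
  have e6 : ∀ ν, G (-(x - I * β) + I * β / 2 - I * g ν * β) β =
      k * sFun c r a (-(x - I * β) - I * g ν * β) * G (-x + I * β / 2 - I * g ν * β) β := fun ν => by
    have := hG _ (h1' ν)
    convert this using 2
    · ring
    · congr 1; ring
  unfold vOne psiOne
  simp only [sgn_one, sgn_neg, one_mul, neg_mul]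
  simp only [e5, e6, Finset.prod_mul_distrib]
  rw [e1, e2, e3, e4, show 2 * (x - I * β) + I * β / 2 = 2 * x - I * β - I * β / 2 by ring]
  have h1p := Finset.prod_ne_zero_iff.2 fun ν (_ : ν ∈ Finset.univ) => h1 ν
  have h1p' := Finset.prod_ne_zero_iff.2 fun ν (_ : ν ∈ Finset.univ) => h1' ν
  simp only [Finset.prod_const]
  generalize ∏ ν, sFun c r a (x - I * g ν * β) = X at h1p ⊢
  generalize ∏ ν, sFun c r a (-(x - I * β) - I * g ν * β) = X' at h1p' ⊢
  generalize sFun c r a (2 * x) = s1 at h2 ⊢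
  generalize sFun c r a (2 * x - I * β) = s2 at h3 ⊢
  generalize sFun c r a (-(2 * (x - I * β))) = s3 at h2' ⊢
  generalize sFun c r a (-(2 * (x - I * β)) - I * β) = s4 at h3' ⊢
  generalize ∏ ν, G (x - I * β + I * β / 2 - I * g ν * β) β = Y
  generalize ∏ ν, G (-x + I * β / 2 - I * g ν * β) β = Y'
  field_simp

theorem vTwo_mul_psiTwo (hk : k ≠ 0) (hG : ∀ x : ℂ, sFun c r a x ≠ 0 →
      G (x + I * β / 2) β = k * sFun c r a x * G (x - I * β / 2) β) {z : ℂ}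
    (h1 : sFun c r a z ≠ 0) (h2 : sFun c r a (z - I * lam * β) ≠ 0)
    (h1' : sFun c r a (z - I * β) ≠ 0) (h2' : sFun c r a (z - I * β + I * lam * β) ≠ 0) :
    vTwo c r a lam β (-1) (z - I * β) * psiTwo G lam β (z - I * β)
      = vTwo c r a lam β 1 z * psiTwo G lam β z := by
  rw [← neg_ne_zero, ← sFun_neg] at h1' h2'
  have e1 := hG _ h1
  have e2 := hG _ h2
  have e3 := hG _ h1'
  have e4 := hG _ h2'
  unfold vTwo psiTwo
  simp only [sgn_one, sgn_neg, one_mul, neg_mul, sub_neg_eq_add]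
  rw [show z - I * β + I * β / 2 = z - I * β / 2 by ring,
    show z - I * β - I * lam * β + I * β / 2 = z - I * lam * β - I * β / 2 by ring,
    show -(z - I * β) - I * lam * β + I * β / 2 = -(z - I * β + I * lam * β) + I * β / 2 by ring,
    e1, e2, e3, e4, show -(z - I * β) - I * β / 2 = -z + I * β / 2 by ring,
    show -(z - I * β + I * lam * β) - I * β / 2 = -z - I * lam * β + I * β / 2 by ring]
  simp only [sFun_neg] at h1' h2' ⊢
  rw [neg_ne_zero] at h1' h2'
  generalize sFun c r a (z - I * lam * β) = s₁ at h2 ⊢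
  generalize sFun c r a (z - I * β + I * lam * β) = s₂ at h2' ⊢
  field_simp

/-- No Gamma function occurs here: the shift by iβ maps the arguments with λ - 1 to those with λ +
1. -/
theorem vMixed_mul_psiMixed {z : ℂ} (h1 : sFun c r a (z - I * (lam - 1) * β / 2) ≠ 0)
    (h2' : sFun c r a (z - I * β + I * (lam - 1) * β / 2) ≠ 0) :
    vMixed c r a lam β (-1) (z - I * β) * psiMixed c r a lam β (z - I * β)
      = vMixed c r a lam β 1 z * psiMixed c r a lam β z := by
  unfold vMixed psiMixed
  simp only [sgn_one, sgn_neg, one_mul, neg_mul, sub_neg_eq_add]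
  rw [show z - I * β + I * (lam + 1) * β / 2 = z + I * (lam - 1) * β / 2 by ring,
    show z - I * β - I * (lam - 1) * β / 2 = z - I * (lam + 1) * β / 2 by ring]
  generalize sFun c r a (z - I * (lam - 1) * β / 2) = s₁ at h1 ⊢
  generalize sFun c r a (z - I * β + I * (lam - 1) * β / 2) = s₂ at h2' ⊢
  field_simp

/-- The relation holds separately for the one-particle, pair and mixed factors. β may have either
sign, since the dual parameter λβ may be negative. -/
theorem coeffV_mul_deformedGroundStateSq_shiftX (hG : IsGammaFunction c r a G) (hβ : β ≠ 0)
    (j : Fin N) (p : Pt N M) (h : coeffV c r a g lam β 1 j p ≠ 0)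
    (h' : coeffV c r a g lam β (-1) j (shiftX p j (-(I * β))) ≠ 0) :
    coeffV c r a g lam β (-1) j (shiftX p j (-(I * β))) *
        deformedGroundStateSq c r a G g lam β (shiftX p j (-(I * β)))
      = coeffV c r a g lam β 1 j p * deformedGroundStateSq c r a G g lam β p := by
  obtain ⟨k, hk, hG⟩ := hG β (by simpa using hβ)
  have H := vFactors_of_coeffV_ne_zero h
  have H' := vFactors_of_coeffV_ne_zero h'
  rw [coeffV_eq_prod, coeffV_eq_prod, deformedGroundStateSq_eq_prod j,
    deformedGroundStateSq_eq_prod j, psiRest_shiftX]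
  have hxj : (shiftX p j (-(I * β))).1 j = p.1 j - I * β := by simp [shiftX, sub_eq_add_neg]
  have hx : ∀ {j'}, j' ≠ j → (shiftX p j (-(I * β))).1 j' = p.1 j' := fun h =>
    shiftX_of_ne p h _
  have hy : (shiftX p j (-(I * β))).2 = p.2 := rfl
  have hs : ∀ δ : ℤˣ, ∀ y : ℂ, p.1 j - I * β + sgn δ * y = p.1 j + sgn δ * y - I * β :=
    fun δ y => by ring
  have e1 : vOne c r a g β (-1) (p.1 j - I * β) * psiOne c G g β (p.1 j - I * β)
      = vOne c r a g β 1 (p.1 j) * psiOne c G g β (p.1 j) := by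
    have a1 := H.num
    have a2 := H.two
    have a3 := H.two_sub
    have b1 := H'.num
    have b2 := H'.two
    have b3 := H'.two_sub
    simp only [hxj, sgn_one, sgn_neg, one_mul, neg_mul] at a1 a2 a3 b1 b2 b3
    exact vOne_mul_psiOne hk hG a1 a2 a3 b1 b2 b3
  have e2 : (∏ j' ∈ Finset.univ.erase j, ∏ δ : ℤˣ,
        vTwo c r a lam β (-1) (p.1 j - I * β + sgn δ * (shiftX p j (-(I * β))).1 j')) *
      ∏ j' ∈ Finset.univ.erase j, ∏ δ : ℤˣ,
        psiTwo G lam β (p.1 j - I * β + sgn δ * (shiftX p j (-(I * β))).1 j')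
      = (∏ j' ∈ Finset.univ.erase j, ∏ δ : ℤˣ,
        vTwo c r a lam β 1 (p.1 j + sgn δ * p.1 j')) *
      ∏ j' ∈ Finset.univ.erase j, ∏ δ : ℤˣ, psiTwo G lam β (p.1 j + sgn δ * p.1 j') := by
    simp only [← Finset.prod_mul_distrib]
    refine Finset.prod_congr rfl fun j' hj' => Finset.prod_congr rfl fun δ _ => ?_
    have hne := Finset.ne_of_mem_erase hj'
    have a1 := H.pair_den δ j' hne
    have a2 := H.pair_num δ j' hne
    have b1 := H'.pair_den δ j' hne
    have b2 := H'.pair_num δ j' hne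
    simp only [hxj, hx hne, sgn_one, sgn_neg, one_mul, neg_mul, sub_neg_eq_add, hs]
      at a1 a2 b1 b2 ⊢
    exact vTwo_mul_psiTwo hk hG a1 a2 b1 b2
  have e3 : (∏ k, ∏ δ : ℤˣ, vMixed c r a lam β (-1) (p.1 j - I * β + sgn δ * p.2 k)) *
      ∏ k, ∏ δ : ℤˣ, psiMixed c r a lam β (p.1 j - I * β + sgn δ * p.2 k)
      = (∏ k, ∏ δ : ℤˣ, vMixed c r a lam β 1 (p.1 j + sgn δ * p.2 k)) *
      ∏ k, ∏ δ : ℤˣ, psiMixed c r a lam β (p.1 j + sgn δ * p.2 k) := by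
    simp only [← Finset.prod_mul_distrib]
    refine Finset.prod_congr rfl fun k _ => Finset.prod_congr rfl fun δ _ => ?_
    have a1 := H.mixed_num δ k
    have b1 := H'.mixed_num δ k
    simp only [hxj, hy, sgn_one, sgn_neg, one_mul, neg_mul, sub_neg_eq_add, hs] at a1 b1 ⊢
    exact vMixed_mul_psiMixed a1 b1
  rw [hxj, hy]
  linear_combination (norm := skip) (psiRest c r a G g lam β j p) *
    (congrArg₂ (· * ·) e1 (congrArg₂ (· * ·) e2 e3))
  ring

end Shift

theorem shiftX_swap (p : Pt N M) (k : Fin M) (t : ℂ) :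
    shiftX p.swap k t = (shiftY p k t).swap := rfl

/-- Duality exchanges ε and -ε, so this is the relation for V read backwards from the shifted point.
-/
theorem coeffVt_mul_deformedGroundStateSq_shiftY (hG : IsGammaFunction c r a G) (hlam : lam ≠ 0)
    (hβ : β ≠ 0) (k : Fin M) (p : Pt N M) (h : coeffVt c r a g lam β 1 k p ≠ 0)
    (h' : coeffVt c r a g lam β (-1) k (shiftY p k (I * lam * β)) ≠ 0) :
    coeffVt c r a g lam β (-1) k (shiftY p k (I * lam * β)) *
        deformedGroundStateSq c r a G g lam β (shiftY p k (I * lam * β))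
      = coeffVt c r a g lam β 1 k p * deformedGroundStateSq c r a G g lam β p := by
  rw [coeffVt_eq_coeffV hlam] at h h'
  rw [coeffVt_eq_coeffV hlam, coeffVt_eq_coeffV hlam, deformedGroundStateSq_swap G hlam,
    deformedGroundStateSq_swap G hlam p]
  rw [neg_neg] at h' ⊢
  -- The dual shift by -iλβ leads from the shifted point back to p.
  have hp : p.swap = shiftX (shiftY p k (I * lam * β)).swap k (-(I * (lam * β : ℝ))) := by
    rw [← shiftX_swap]
    simp [shiftX, mul_assoc]
    rfl
  rw [hp] at h ⊢
  exact (coeffV_mul_deformedGroundStateSq_shiftX hG (mul_ne_zero hlam hβ) k _ h' h).symm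

/-! ### Choice of branches -/

/-- Branches of `V_+^{1/2}` that intertwine `Ψ` with its translate under `T`. -/
theorem exists_intertwining_branch {X : Type*} [TopologicalSpace X] {T : X → X} (hT : Continuous T)
    {Ψ w W Vp Vm : X → ℂ} (hΨ : IsSqrtBranch Ψ W) (hw : IsSqrtBranch w Vm)
    (hgauge : ∀ q, Vp q ≠ 0 → Vm (T q) ≠ 0 → Vm (T q) * W (T q) = Vp q * W q)
    (hcont : ∀ q, Vp q ≠ 0 → ContinuousAt Vp q) :
    ∃ v : X → ℂ, IsSqrtBranch v Vp ∧
      (∀ q, W q ≠ 0 → Vp q ≠ 0 → Vm (T q) ≠ 0 → v q * Ψ q = w (T q) * Ψ (T q)) ∧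
      ∀ q, W q ≠ 0 → Vp q ≠ 0 → Vm (T q) ≠ 0 → ContinuousAt Ψ q → ContinuousAt Ψ (T q) →
        ContinuousAt w (T q) → ContinuousAt v q := by
  classical
  choose root hroot using fun q => IsAlgClosed.exists_pow_nat_eq (Vp q) (n := 2) (by norm_num)
  have hΨ0 : ∀ q, W q ≠ 0 → Ψ q ≠ 0 := fun q hq h => hq (by rw [← hΨ q, h]; simp)
  -- The intertwining relation dictates v where it is required; elsewhere any square root will do.
  refine ⟨fun q => if W q ≠ 0 ∧ Vp q ≠ 0 ∧ Vm (T q) ≠ 0 then w (T q) * Ψ (T q) / Ψ q else root q,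
    ?_, ?_, ?_⟩
  · intro q
    dsimp only
    split_ifs with h
    · rw [div_pow, mul_pow, hw, hΨ, hΨ, hgauge q h.2.1 h.2.2, mul_div_cancel_right₀ _ h.1]
    · exact hroot q
  · intro q h1 h2 h3
    simp only [ne_eq, h1, h2, h3, not_false_eq_true, and_self, if_true]
    exact div_mul_cancel₀ _ (hΨ0 q h1)
  · intro q h1 h2 h3 c1 c2 c3
    have hTq := hT.continuousAt (x := q)
    have d1 : ContinuousAt (fun q => Ψ (T q)) q := ContinuousAt.comp (f := T) c2 hTq
    have d2 : ContinuousAt (fun q => w (T q)) q := ContinuousAt.comp (f := T) c3 hTq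
    refine ((d2.mul d1).div c1 (hΨ0 q h1)).congr ?_
    -- G is arbitrary, so W need not be continuous by itself; nonvanishing near q comes from W = Ψ²
    -- and the continuity of Ψ.
    have e1 : ∀ᶠ q in 𝓝 q, W q ≠ 0 := by
      rw [← (funext hΨ : (fun q => Ψ q ^ 2) = W)] at h1 ⊢
      exact (c1.pow 2).eventually_ne h1
    have e3 : ∀ᶠ q in 𝓝 q, Vm (T q) ≠ 0 := by
      rw [← (funext hw : (fun q => w q ^ 2) = Vm)] at h3 ⊢
      exact (d2.pow 2).eventually_ne h3
    filter_upwards [e1, (hcont q h2).eventually_ne h2, e3] with q' f1 f2 f3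
    simp [f1, f2, f3]

/-- The action of the two shifts on `Ψ` is multiplication by the coefficients. -/
theorem intertwining_branch_apply {X : Type*} {T : X → X} {Ψ v w W Vp Vm : X → ℂ}
    (hv : IsSqrtBranch v Vp) (hw : IsSqrtBranch w Vm)
    (hgauge : ∀ q, Vp q ≠ 0 → Vm (T q) ≠ 0 → Vm (T q) * W (T q) = Vp q * W q)
    (hvΨ : ∀ q, W q ≠ 0 → Vp q ≠ 0 → Vm (T q) ≠ 0 → v q * Ψ q = w (T q) * Ψ (T q)) {p : X}
    (hW : W p ≠ 0) :
    (Vp p ≠ 0 → Vm (T p) ≠ 0 → v p * (w (T p) * Ψ (T p)) = Vp p * Ψ p) ∧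
      ∀ p', T p' = p → Vm p ≠ 0 → Vp p' ≠ 0 → w p * (v p' * Ψ p') = Vm p * Ψ p := by
  constructor
  · intro h1 h2
    rw [← hvΨ p hW h1 h2, ← hv p]
    ring
  · rintro p' rfl h1 h2
    -- Genericity does not mention Ψ² at the shifted point; the gauge relation supplies its
    -- nonvanishing.
    have h3 : W p' ≠ 0 := right_ne_zero_of_mul (hgauge p' h2 h1 ▸ mul_ne_zero h1 hW)
    rw [hvΨ p' h3 h2 h1, ← hw (T p')]
    ring

theorem shiftX_shiftX {N M : ℕ} (p : Pt N M) (j : Fin N) (t u : ℂ) :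
    shiftX (shiftX p j t) j u = shiftX p j (t + u) := by
  simp [shiftX, add_assoc]

theorem shiftY_shiftY {N M : ℕ} (p : Pt N M) (k : Fin M) (t u : ℂ) :
    shiftY (shiftY p k t) k u = shiftY p k (t + u) := by
  simp [shiftY, add_assoc]

theorem shiftX_zero {N M : ℕ} (p : Pt N M) (j : Fin N) : shiftX p j 0 = p := by simp [shiftX]

theorem shiftY_zero {N M : ℕ} (p : Pt N M) (k : Fin M) : shiftY p k 0 = p := by simp [shiftY]

theorem continuous_shiftX {N M : ℕ} (j : Fin N) (t : ℂ) :
    Continuous fun p : Pt N M => shiftX p j t :=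
  (continuous_fst.update j (by fun_prop)).prodMk continuous_snd

theorem continuous_shiftY {N M : ℕ} (k : Fin M) (t : ℂ) :
    Continuous fun p : Pt N M => shiftY p k t :=
  continuous_fst.prodMk (continuous_snd.update k (by fun_prop))

end VanDiejen

/-! ### The eigenvalue equation -/

open VanDiejen
theorem mainTheorem3
    (c : VDCase) (r a : ℝ) (hr : 0 < r) (ha : 0 < a)
    (G : ℂ → ℂ → ℂ) (hG : IsGammaFunction c r a G)
    (N M : ℕ) (g : Fin (2 * rho c + 2) → ℝ) (lam β : ℝ)
    (hlam : lam ≠ 0) (hβ : 0 < β)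
    (hperiod : ∀ m ∈ massSet lam, ∀ n : ℤ, n ≠ 0 → (n : ℂ) * (Complex.I * β / m) ∉ Omega c r a)
    (hnondeg : Complex.I * (lam - 1) * β ∉ Omega c r a)
    (hbal : c = VDCase.elliptic → 2 * lam * (N - 1) - 2 * (M + 1) + ∑ ν, g ν = 0)
    (Ψ : Pt N M → ℂ) (hΨ : IsSqrtBranch Ψ (deformedGroundStateSq c r a G g lam β))
    (w : Fin N → Pt N M → ℂ) (hw : ∀ j, IsSqrtBranch (w j) (coeffV c r a g lam β (-1) j))
    (wt : Fin M → Pt N M → ℂ) (hwt : ∀ k, IsSqrtBranch (wt k) (coeffVt c r a g lam β (-1) k)) :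
    ∃ (v : ℤˣ → Fin N → Pt N M → ℂ) (vt : ℤˣ → Fin M → Pt N M → ℂ),
      v (-1) = w ∧ vt (-1) = wt ∧
      (∀ ε j, IsSqrtBranch (v ε j) (coeffV c r a g lam β ε j)) ∧
      (∀ ε k, IsSqrtBranch (vt ε k) (coeffVt c r a g lam β ε k)) ∧
      (∀ j q, deformedGroundStateSq c r a G g lam β q ≠ 0 →
        coeffV c r a g lam β 1 j q ≠ 0 →
        coeffV c r a g lam β (-1) j (shiftX q j (-(Complex.I * β))) ≠ 0 →
        ContinuousAt Ψ q → ContinuousAt Ψ (shiftX q j (-(Complex.I * β))) →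
        ContinuousAt (w j) (shiftX q j (-(Complex.I * β))) →
        ContinuousAt (v 1 j) q) ∧
      (∀ k q, deformedGroundStateSq c r a G g lam β q ≠ 0 →
        coeffVt c r a g lam β 1 k q ≠ 0 →
        coeffVt c r a g lam β (-1) k (shiftY q k (Complex.I * lam * β)) ≠ 0 →
        ContinuousAt Ψ q → ContinuousAt Ψ (shiftY q k (Complex.I * lam * β)) →
        ContinuousAt (wt k) (shiftY q k (Complex.I * lam * β)) →
        ContinuousAt (vt 1 k) q) ∧
      ∀ p, IsGeneric c r a G g lam β p →
        deformedH c r a g lam β v vt Ψ p = eigenvalue c r a g lam β N M * Ψ p := by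
  have hgx := coeffV_mul_deformedGroundStateSq_shiftX (N := N) (M := M) (g := g) (lam := lam)
    hG hβ.ne'
  have hgy := coeffVt_mul_deformedGroundStateSq_shiftY (N := N) (M := M) (g := g) (lam := lam)
    hG hlam hβ.ne'
  choose v₁ hv₁ hvΨ hvc using fun j : Fin N =>
    exists_intertwining_branch (continuous_shiftX j _) hΨ (hw j) (hgx j) fun q h =>
      (vFactors_of_coeffV_ne_zero h).continuousAt hr ha
  choose vt₁ hvt₁ hvtΨ hvtc using fun k : Fin M =>
    exists_intertwining_branch (continuous_shiftY k _) hΨ (hwt k) (hgy k) fun q h =>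
      continuousAt_coeffVt hlam hr ha h
  have hne : (-1 : ℤˣ) ≠ 1 := by decide
  refine ⟨fun ε => if ε = 1 then v₁ else w, fun ε => if ε = 1 then vt₁ else wt, if_neg hne,
    if_neg hne, ?_, ?_, by simpa using hvc, by simpa using hvtc, ?_⟩
  · intro ε j
    rcases Int.units_eq_one_or ε with rfl | rfl
    · simpa using hv₁ j
    · simpa [hne] using hw j
  · intro ε k
    rcases Int.units_eq_one_or ε with rfl | rfl
    · simpa using hvt₁ k
    · simpa [hne] using hwt k
  · intro p hp
    have hsource := sourceSum_eq hlam hr ha hnondeg hbal hp.v hp.vt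
    have hx := fun j => intertwining_branch_apply (hv₁ j) (hw j) (hgx j) (hvΨ j) hp.psi
    have hy := fun k => intertwining_branch_apply (hvt₁ k) (hwt k) (hgy k) (hvtΨ k) hp.psi
    have hx1 := fun j => (hx j).1 (hp.v 1 j) (by simpa [sgn_one] using hp.v_shift 1 j)
    have hy1 := fun k => (hy k).1 (hp.vt 1 k) (by simpa [sgn_one] using hp.vt_shift 1 k)
    -- The terms with ε = -1 shift by +iβ, hence to the preimage of p under T, where the
    -- intertwining relation is applied.
    have hx2 := fun j => (hx j).2 (shiftX p j (I * β))
      (by rw [shiftX_shiftX, add_neg_cancel, shiftX_zero]) (hp.v (-1) j)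
      (by simpa [sgn_one, sgn_neg] using hp.v_shift (-1) j)
    have hy2 := fun k => (hy k).2 (shiftY p k (-(I * lam * β)))
      (by rw [shiftY_shiftY, neg_add_cancel, shiftY_zero]) (hp.vt (-1) k)
      (by simpa [sgn_one, sgn_neg] using hp.vt_shift (-1) k)
    rw [← hsource]
    unfold deformedH sourceSum
    simp only [sum_units, sgn_one, sgn_neg, hne, neg_neg, if_true, if_false, one_mul, neg_mul,
      hx1, hx2, hy1, hy2, ← Finset.sum_mul]
    ring
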